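/- **Setting.** Let $\Gamma$ be a real Banach space of $\mathbb R^n$-valued functions $U(\xi)$, $\xi>0$, and let $U^{(s)}=\mathcal R_sU$, $s\ge 0$, be a partially defined one-parameter semigroup of nonlinear maps of $\Gamma$ (the renormalization group; $t=-e^{-s}$ is physical time, the evolution of $U$ starts at $s=0$ and may cease to exist at a finite $s$). Let $\beta\in\mathbb R$; the physical radius belonging to $(s,\xi)$ is $r=e^{-\beta s}\xi$. Write $\mathcal T_{s,U}$ for the Fréchet derivative of $\mathcal R_s$ at $U$. Let $U_{\rm lc}=\{U_{\rm lc}^{(s)}\}$ be a limit cycle with fundamental period $\Delta>0$, $\mathcal T_\Delta=\mathcal T_{\Delta,U_{\rm lc}^{(0)}}$, $F_0=\frac{d}{ds}U_{\rm lc}^{(s)}|_{s=0}$, ${\rm dist}(U,U_{\rm lc})=\inf_s\|U-U_{\rm lc}^{(s)}\|$, and let $W^{\rm s}(U_{\rm lc})$ be the set of data $U$ whose evolution exists for all $s\ge 0$ and satisfies ${\rm dist}(U^{(s)},U_{\rm lc})\to0$. The evolution of $U$ *blows up* at $(s_{\rm AH},\xi_{\rm AH})$ (an apparent horizon forms, and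 $U$ leads to a black hole) if it exists exactly for $s<s_{\rm AH}$, with $0<s_{\rm AH}<\infty$, and $\xi_{\rm AH}$ is the largest $\xi_*>0$ such that $U^{(s)}(\xi)$ is unbounded as $s\nearrow s_{\rm AH}$, $\xi\to\xi_*$; put $r_{\rm AH}=e^{-\beta s_{\rm AH}}\xi_{\rm AH}$. A given set of data represents flat space-times, and $U$ *tends to a flat space-time* if $U^{(s)}$ exists for all $s\ge0$ and converges in $\Gamma$ to one of these as $s\to\infty$. The masses $M_{\rm AH}$ (inside the apparent horizon at its formation), $M_{\rm BH}$ (final mass of the black hole) and $M_0$ (initial mass) are real functions of the initial datum. **Assumptions.** * (L1′) $\Gamma=E^{\rm u}\oplus E^{\rm c}\oplus E^{\rm s}$ with $\mathcal T_\Delta$-invariant subspaces, $E^{\rm c}=\mathbb RF_0$ one-dimensional, $\mathcal T_\Delta F_0=F_0$, $\dim E^{\rm u}=N$, and for some $\bar\kappa>0$: $\|\mathcal T_\Delta F\|\ge e^{\bar\kappa\Delta}\|F\|$ on $E^{\rm u}$, $\|\mathcal T_\Delta F\|\le e^{-\bar\kappa\Delta}\|F\|$ on $E^{\rm s}$. *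 (L2′) For some $\delta_0>0$, $\mathcal R_sU$ exists for $0\le s\le\delta_0$, ${\rm dist}(U,U_{\rm lc})<\delta_0$, and $(s,U)\mapsto\mathcal R_sU$ is of class $C^{1,1}$ there (Fréchet differentiable with Lipschitz derivative). * (L1′A) $N=1$ and $E^{\rm u}=\mathbb RF_1$ with $\mathcal T_\Delta F_1=e^{\kappa\Delta}F_1$, $\kappa$ real. * (G1) Let $S=U_{\rm lc}^{(0)}+(E^{\rm u}\oplus E^{\rm s})$, and let $\mathcal P$ be the Poincaré map on $S$: $\mathcal P(U)=\mathcal R_{p(U)}U\in S$ with $|p(U)-\Delta|\le\rho$. Let $W^{\rm u}_{\rm loc}\subset S$ be the set of points having a backward $\mathcal P$-orbit that stays in the $\rho$-ball about $U_{\rm lc}^{(0)}$ and converges to $U_{\rm lc}^{(0)}$. For $\delta_3>0$ let $A_\pm(\varepsilon,\delta_3)$ be the set of $U=U_{\rm lc}^{(0)}\pm aF_1/\|F_1\|+v$ with $v\in E^{\rm s}$, $\varepsilon e^{-2\kappa\Delta}\le a\le\varepsilon$ and ${\rm dist}(U,W^{\rm u}_{\rm loc})\le\delta_3$. Then for some $\delta_3>0$: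 every $U\in A_-(\varepsilon,\delta_3)$ tends to a flat space-time, and every $U\in A_+(\varepsilon,\delta_3)$ blows up at some $(s_{\rm AH},\xi_{\rm AH})$, with $s_{\rm AH}$ and $\xi_{\rm AH}$ bounded above and below by positive constants uniformly in $U\in A_+(\varepsilon,\delta_3)$. * (G2) There is $C>0$ with $C^{-1}r_{\rm AH}\le M_{\rm AH}\le Cr_{\rm AH}$ whenever an apparent horizon forms. * (G3) There is $C'>0$ with $C'^{-1}M_{\rm AH}\le M_{\rm BH}\le C'M_{\rm AH}$ for all data sufficiently close to $U_{\rm lc}$ that lead to a black hole. **Theorem.** Let (L1′), (L2′), (L1′A) hold. Then for all sufficiently small $\rho>0$ and all $\varepsilon>0$ sufficiently small depending on $\rho$ (thresholds depending only on the flow, the cycle and the splitting), (G1) for these $\rho,\varepsilon$ together with (G2) and (G3) implies the following. For $0\le s_0<\Delta$ put $F_1^{(s_0)}=\mathcal T_{s_0,U_{\rm lc}^{(0)}}F_1$ and $S^{(s_0)}=U_{\rm lc}^{(s_0)}+\mathcal T_{s_0,U_{\rm lc}^{(0)}}(E^{\rm u}\oplus E^{\rm s})$. There are $\eta,\delta,\delta'>0$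 such that, with decompositions $$U=U_\perp+b\,\frac{F_1^{(s_0)}}{\|F_1^{(s_0)}\|},\qquad 0\le s_0<\Delta,\quad U_\perp\in W^{\rm s}(U_{\rm lc})\cap S^{(s_0)},\quad \|U_\perp-U_{\rm lc}^{(s_0)}\|\le\delta,\quad |b|\le\delta, \tag{$*$}$$ (i) every $U\notin W^{\rm s}(U_{\rm lc})$ with ${\rm dist}(U,U_{\rm lc})<\delta'$ has a decomposition $(*)$ with $b\ne0$. Every $U$ of the form $(*)$ with $b\neq0$ lies off $W^{\rm s}(U_{\rm lc})$ and finally deviates from $U_{\rm lc}$: from some moment of its life on, ${\rm dist}(U^{(s)},U_{\rm lc})\ge\eta$. If $b<0$ it tends to a flat space-time, and if $b>0$ it leads to a black hole. Before deviating, near-critical data approach $U_{\rm lc}$: for every $\zeta>0$ there is $b_0>0$ such that for every $U$ as in $(*)$ with $0<|b|\le b_0$ there is $s\ge0$ with ${\rm dist}(U^{(s)},U_{\rm lc})<\zeta$. (ii) for all $0<m\le M$ there are constants $C_1,C_2>0$ such that every $U$ as in $(*)$ with $0<b\le\delta$ (the black-hole side) whose initial mass satisfies $m\le M_0\le M$ obeys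 $$C_1|b|^{\beta/\kappa}\le\frac{M_{\rm BH}}{M_0}\le C_2|b|^{\beta/\kappa}.$$ -/

import Mathlib

open Set Filter Topology Metric

/-- A renormalization group on a phase space `Γ` (a real normed space of `ℝⁿ`-valued functions
`U(ξ)` of the scaled radius `ξ > 0`): a partially defined one-parameter semigroup `R_s`, `s ≥ 0`,
of nonlinear maps of `Γ`.  `Alive s U` says that the evolution of the datum `U` exists (in `Γ`) up
to and including scale time `s`; then `map s U` is `U^{(s)} = R_s U`.  The value of `map s U` is
irrelevant if `Alive s U` fails.  Scale time is related to physical time by `t = -e^{-s}`, so that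
`s = 0` is the initial time `t = -1`. -/
structure RGFlow (Γ : Type*) [NormedAddCommGroup Γ] [NormedSpace ℝ Γ] (n : ℕ) where
  profile : Γ →ₗ[ℝ] (Ioi (0 : ℝ) → Fin n → ℝ)
  profile_injective : Function.Injective profile
  Alive : ℝ → Γ → Prop
  map : ℝ → Γ → Γ
  alive_nonneg : ∀ s U, Alive s U → 0 ≤ s
  alive_zero : ∀ U, Alive 0 U
  alive_add : ∀ s t U, 0 ≤ s → 0 ≤ t → (Alive (s + t) U ↔ Alive s U ∧ Alive t (map s U))
  map_zero : ∀ U, map 0 U = U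
  map_add : ∀ s t U, 0 ≤ s → 0 ≤ t → Alive (s + t) U → map (s + t) U = map t (map s U)

/-- `f` is of class `C^{1,1}` on `D`: differentiable on `D` with Lipschitz derivative. -/
def IsC11On {E F : Type*} [NormedAddCommGroup E] [NormedSpace ℝ E]
    [NormedAddCommGroup F] [NormedSpace ℝ F] (f : E → F) (D : Set E) : Prop :=
  ∃ f' : E → E →L[ℝ] F,
    (∀ x ∈ D, HasFDerivWithinAt f (f' x) D x) ∧ ∃ K, LipschitzOnWith K f' D

namespace RGFlow

variable {Γ : Type*} [NormedAddCommGroup Γ] [NormedSpace ℝ Γ] {n : ℕ} (R : RGFlow Γ n)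

/-- The tangent map `T_{s,U}` of `R_s` at `U`. -/
noncomputable def tangentMap (s : ℝ) (U : Γ) : Γ →L[ℝ] Γ := fderiv ℝ (R.map s) U

/-- The evolution of `U` ends at the finite scale time `s > 0`, and `U^{(s')}(ξ')` is unbounded as
`s' → s` from below and `ξ' → ξ`. -/
def BlowUpPoint (U : Γ) (s : ℝ) (ξ : Ioi (0 : ℝ)) : Prop :=
  0 < s ∧ (∀ s' ∈ Ico 0 s, R.Alive s' U) ∧ ¬ R.Alive s U ∧
    ∀ M : ℝ, ∃ᶠ q : ℝ × Ioi (0 : ℝ) in 𝓝[<] s ×ˢ 𝓝 ξ, M < ‖R.profile (R.map q.1 U) q.2‖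

/-- The evolution of `U` blows up, and an apparent horizon forms, at scale time `s = s_AH` and at
scaled radius `ξ = ξ_AH` (the outermost radius at which the blow-up takes place). -/
def HorizonAt (U : Γ) (s : ℝ) (ξ : Ioi (0 : ℝ)) : Prop :=
  IsGreatest {ξ' | R.BlowUpPoint U s ξ'} ξ

/-- The evolution of `U` leads to a black hole. -/
def FormsBlackHole (U : Γ) : Prop := ∃ s ξ, R.HorizonAt U s ξ

/-- The evolution of `U` exists forever and tends to one of the data in `Flat`. -/
def TendsToFlat (Flat : Set Γ) (U : Γ) : Prop :=
  (∀ s, 0 ≤ s → R.Alive s U) ∧ ∃ V ∈ Flat, Tendsto (fun s => R.map s U) atTop (𝓝 V)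

/-- The physical radius `r = e^{-β s} ξ` of the point with scaled radius `ξ` at scale time `s`. -/
noncomputable def radius (β s : ℝ) (ξ : Ioi (0 : ℝ)) : ℝ := Real.exp (-β * s) * (ξ : ℝ)

/-- The mass `MAH U` inside the apparent horizon formed by the evolution of `U` is comparable to
the physical radius of the horizon. -/
def HorizonMassRelation (β : ℝ) (MAH : Γ → ℝ) : Prop :=
  ∃ C > 0, ∀ U s ξ, R.HorizonAt U s ξ →
    C⁻¹ * radius β s ξ ≤ MAH U ∧ MAH U ≤ C * radius β s ξ

end RGFlow

/-- A limit cycle: a periodic orbit through `base = U_lc^{(0)}` with fundamental period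
`period = Δ > 0`. -/
structure LimitCycle {Γ : Type*} [NormedAddCommGroup Γ] [NormedSpace ℝ Γ] {n : ℕ}
    (R : RGFlow Γ n) where
  base : Γ
  period : ℝ
  period_pos : 0 < period
  alive : R.Alive period base
  periodic : R.map period base = base
  fundamental : ∀ s ∈ Ioo 0 period, R.map s base ≠ base

namespace LimitCycle

variable {Γ : Type*} [NormedAddCommGroup Γ] [NormedSpace ℝ Γ] {n : ℕ} {R : RGFlow Γ n}
  (c : LimitCycle R)

/-- The point `U_lc^{(s)}`, `s ≥ 0`. -/
def point (s : ℝ) : Γ := R.map s c.base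

/-- The orbit `U_lc` as a set. -/
def orbit : Set Γ := c.point '' Icc 0 c.period

/-- The distance of `U` to the limit cycle. -/
noncomputable def distTo (U : Γ) : ℝ := infDist U c.orbit

/-- The tangent vector `F₀ = lim_{s → 0} (U_lc^{(s)} - U_lc^{(0)}) / s`. -/
noncomputable def tangent : Γ := derivWithin c.point (Ici 0) 0

/-- `T_Δ`, the tangent map of `R_Δ` at `U_lc^{(0)}`. -/
noncomputable def monodromy : Γ →L[ℝ] Γ := R.tangentMap c.period c.base

/-- The map `(s, U) ↦ R_s U` is of class `C^{1,1}` in a tubular neighbourhood of the limit cycle.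
(Regularity for longer times, as long as the orbit stays in the tube, follows from the semigroup
property.) -/
def SmoothNear : Prop :=
  ∃ δ₀ > 0, (∀ U, c.distTo U < δ₀ → ∀ s ∈ Icc 0 δ₀, R.Alive s U) ∧
    IsC11On (fun p : ℝ × Γ => R.map p.1 p.2) (Icc 0 δ₀ ×ˢ {U | c.distTo U < δ₀})

/-- Hyperbolic splitting `Γ = Eᵘ ⊕ Eᶜ ⊕ Eˢ` into invariant subspaces of `T_Δ`, where `Eᶜ` is the
line spanned by `F₀`, `T_Δ F₀ = F₀`, and `Eᵘ` has dimension `N` (so that `Eˢ` has codimension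
`N + 1`). -/
structure HyperbolicSplitting (Eu Es : Submodule ℝ Γ) (N : ℕ) : Prop where
  isInternal : DirectSum.IsInternal ![Eu, Submodule.span ℝ {c.tangent}, Es]
  finite : Module.Finite ℝ Eu
  finrank_eq : Module.finrank ℝ Eu = N
  tangent_ne_zero : c.tangent ≠ 0
  map_tangent : c.monodromy c.tangent = c.tangent
  map_unstable : ∀ F ∈ Eu, c.monodromy F ∈ Eu
  map_stable : ∀ F ∈ Es, c.monodromy F ∈ Es
  rates : ∃ κbar > 0,
    (∀ F ∈ Eu, Real.exp (κbar * c.period) * ‖F‖ ≤ ‖c.monodromy F‖) ∧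
    (∀ F ∈ Es, ‖c.monodromy F‖ ≤ Real.exp (-κbar * c.period) * ‖F‖)

/-- The relevant mode is unique: `N = 1`, and `Eᵘ` is spanned by `F₁` with
`T_Δ F₁ = e^{κ Δ} F₁`. -/
structure UniqueRelevantMode (Eu : Submodule ℝ Γ) (N : ℕ) (F₁ : Γ) (κ : ℝ) : Prop where
  dim_eq : N = 1
  ne_zero : F₁ ≠ 0
  span_eq : Eu = Submodule.span ℝ {F₁}
  map_eq : c.monodromy F₁ = Real.exp (κ * c.period) • F₁

/-- The stable manifold `Wˢ(U_lc)`: data whose evolution converges to the limit cycle. -/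
def stableManifold : Set Γ :=
  {U | (∀ s, 0 ≤ s → R.Alive s U) ∧ Tendsto (fun s => c.distTo (R.map s U)) atTop (𝓝 0)}

/-- The section `S^{(s)} = U_lc^{(s)} + T_{s, U_lc^{(0)}} (Eᵘ ⊕ Eˢ)`. -/
def sectionAt (Eu Es : Submodule ℝ Γ) (s : ℝ) : Set Γ :=
  {U | ∃ F ∈ Eu ⊔ Es, U = c.point s + R.tangentMap s c.base F}

/-- The normalized relevant mode `F₁^{(s)} / ‖F₁^{(s)}‖` at `U_lc^{(s)}`, where
`F₁^{(s)} = T_{s, U_lc^{(0)}} F₁`. -/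
noncomputable def relevantMode (F₁ : Γ) (s : ℝ) : Γ :=
  ‖R.tangentMap s c.base F₁‖⁻¹ • R.tangentMap s c.base F₁

/-- The Poincaré section `S = U_lc^{(0)} + (Eᵘ ⊕ Eˢ)`. -/
def poincareSection (Eu Es : Submodule ℝ Γ) : Set Γ := {U | U - c.base ∈ Eu ⊔ Es}

/-- `V = P(U)` for the Poincaré map `P` near `U_lc^{(0)}`: the orbit of `U ∈ S` meets `S` in `V`
after a time `p(U)` that is within `ρ` of `Δ`.  (For small `ρ` and `U` close to `U_lc^{(0)}` there
is exactly one such time.) -/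
def PoincareStep (Eu Es : Submodule ℝ Γ) (ρ : ℝ) (U V : Γ) : Prop :=
  U ∈ c.poincareSection Eu Es ∧ V ∈ c.poincareSection Eu Es ∧
    ∃ p, |p - c.period| ≤ ρ ∧ R.Alive p U ∧ R.map p U = V

/-- The local unstable manifold of the fixed point `U_lc^{(0)}` of the Poincaré map: points that
have a backward orbit under `P` that stays in the `ρ`-ball and converges to `U_lc^{(0)}`. -/
def unstableManifold (Eu Es : Submodule ℝ Γ) (ρ : ℝ) : Set Γ :=
  {U | ∃ V : ℕ → Γ, V 0 = U ∧
    (∀ k, ‖V k - c.base‖ ≤ ρ ∧ c.PoincareStep Eu Es ρ (V (k + 1)) (V k)) ∧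
    Tendsto V atTop (𝓝 c.base)}

/-- The exit tubes `A₊(ε, δ)` (for `sgn = 1`) and `A₋(ε, δ)` (for `sgn = -1`) in the Poincaré
section: points `U = U_lc^{(0)} ± a F₁/‖F₁‖ + v`, `v ∈ Eˢ`, with `ε e^{-2κΔ} ≤ a ≤ ε`, at distance
at most `δ` from the local unstable manifold. -/
def exitTube (Eu Es : Submodule ℝ Γ) (F₁ : Γ) (κ ρ : ℝ) (sgn ε δ : ℝ) : Set Γ :=
  {U | (∃ a : ℝ, ∃ v ∈ Es, U = c.base + (sgn * a) • (‖F₁‖⁻¹ • F₁) + v ∧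
      ε * Real.exp (-2 * κ * c.period) ≤ a ∧ a ≤ ε) ∧
    infDist U (c.unstableManifold Eu Es ρ) ≤ δ}

/-- Flows after the exit from the neighbourhood of the limit cycle, for the discrete dynamical
system on the Poincaré section: every point of `A₋(ε, δ₃)` tends to a flat space-time, every point
of `A₊(ε, δ₃)` blows up at some `(s_AH, ξ_AH)`, with uniform upper and (positive) lower bounds on
`s_AH` and `ξ_AH`. -/
def ExitFates (Eu Es : Submodule ℝ Γ) (F₁ : Γ) (κ ρ ε : ℝ) (Flat : Set Γ) : Prop :=
  ∃ δ₃ > 0,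
    (∀ U ∈ c.exitTube Eu Es F₁ κ ρ (-1) ε δ₃, R.TendsToFlat Flat U) ∧
    ∃ sLow > 0, ∃ sHigh, ∃ ξLow > 0, ∃ ξHigh : ℝ,
      ∀ U ∈ c.exitTube Eu Es F₁ κ ρ 1 ε δ₃, ∃ (s : ℝ) (ξ : Ioi (0 : ℝ)),
        R.HorizonAt U s ξ ∧ sLow ≤ s ∧ s ≤ sHigh ∧ ξLow ≤ (ξ : ℝ) ∧ (ξ : ℝ) ≤ ξHigh

/-- For all near-critical data that form a black hole, its final mass `MBH U` is comparable to the
mass `MAH U` at the formation of the apparent horizon. -/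
def FinalMassRelation (MAH MBH : Γ → ℝ) : Prop :=
  ∃ C > 0, ∃ δ > 0, ∀ U, c.distTo U < δ → R.FormsBlackHole U →
    C⁻¹ * MAH U ≤ MBH U ∧ MBH U ≤ C * MAH U

/-- `U = U_⊥ + b F₁^{(s₀)}/‖F₁^{(s₀)}‖` with `U_⊥ ∈ Wˢ(U_lc) ∩ S^{(s₀)}`,
`‖U_⊥ - U_lc^{(s₀)}‖ ≤ δ` and `|b| ≤ δ`. -/
def DecomposedAt (Eu Es : Submodule ℝ Γ) (F₁ : Γ) (δ s₀ b : ℝ) (Uperp U : Γ) : Prop :=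
  s₀ ∈ Ico 0 c.period ∧ Uperp ∈ c.stableManifold ∧ Uperp ∈ c.sectionAt Eu Es s₀ ∧
    ‖Uperp - c.point s₀‖ ≤ δ ∧ |b| ≤ δ ∧ U = Uperp + b • c.relevantMode F₁ s₀

/-- From some moment `s₁` of its life on, the evolution of `U` stays at distance at least `η` from
the limit cycle. -/
def FinallyDeviates (η : ℝ) (U : Γ) : Prop :=
  ∃ s₁, R.Alive s₁ U ∧ ∀ s, s₁ ≤ s → R.Alive s U → η ≤ c.distTo (R.map s U)

end LimitCycle

/-! On the Poincaré section the neutral direction F₀ disappears, and the return map P has a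
hyperbolic fixed point with a single expanding multiplier μ = e^{κΔ}. In coordinates (a, v) ∈ ℝ × Eˢ
with the sup norm, and after a cut-off that makes it globally close to its linear part, P is a
`SaddleMap`. Cones then control all orbits. A difference with ‖Δv‖ ≤ |Δa| keeps this property and
the sign of Δa, and grows by about μ per step. A difference that lies in the complementary stable
cone after k steps has been there all along and has shrunk by αᵏ.

A graph representation of the stable manifold is not needed: U = U_⊥ + b e is compared directly with
U_⊥. The orbit of U_⊥ decays geometrically, since otherwise it would enter the unstable cone and
leave through an exit tube, where (G1) prescribes a fate incompatible with convergence to the cycle.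
The images of U and U_⊥ in the section differ by a vector in the unstable cone of size comparable to
|b|, on the side given by the sign of b (`SmoothData.exists_transversal`).

The heart is a bounded distortion estimate, `SaddleMap.exists_exit`. If d_k is the separation after
k steps, then log d_{k+1} - log d_k - log μ is bounded by a multiple of the norms of the two k-th
iterates; this uses the C^{1,1} regularity. Up to the exit these norms are dominated by a geometric
series decaying from the start plus one growing towards the exit, so their sum is bounded
independently of b. The same sum bounds the deviation of the return times from Δ. Hence the exit
takes place at a time T with κT = -log |b| + O(1). The amplitude at exit lies in the range allowed
by the tube, and the long past near the fixed point brings the orbit close to the local unstable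
manifold, so that (G1) applies (`LocalPoincare.exists_exitTube`). The horizon radius is e^{-β(T+s)}
ξ, that is |b|^{β/κ} up to a bounded factor, and (G2), (G3) transfer this to the masses.

That data off the stable manifold decompose is a connectedness argument (`exists_decomposition`). A
suitable section S^{(s₀)} through U is found by the intermediate value theorem. The segment U + t e
in it runs from one half of the unstable cone to the other. The points that eventually enter either
half form disjoint open sets, so some point of the segment enters neither, and this is U_⊥. -/

/-! ### First-order expansions with quadratic error. -/

/-- `f` is linear with derivative `L` at `x₀` up to a quadratic error, with the single constant `C`
bounding the norm of `L`, the error, and the inverse of the radius on which the bound holds. -/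
structure QuadAt {E F : Type*} [NormedAddCommGroup E] [NormedSpace ℝ E]
    [NormedAddCommGroup F] [NormedSpace ℝ F] (f : E → F) (L : E →L[ℝ] F) (x₀ : E) (C : ℝ) :
    Prop where
  one_le : 1 ≤ C
  norm_le : ‖L‖ ≤ C
  est : ∀ x y, ‖x - x₀‖ ≤ C⁻¹ → ‖y - x₀‖ ≤ C⁻¹ →
    ‖f x - f y - L (x - y)‖ ≤ C * max ‖x - x₀‖ ‖y - x₀‖ * ‖x - y‖

namespace QuadAt

variable {E F G : Type*} [NormedAddCommGroup E] [NormedSpace ℝ E]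
  [NormedAddCommGroup F] [NormedSpace ℝ F] [NormedAddCommGroup G] [NormedSpace ℝ G]
  {f : E → F} {L : E →L[ℝ] F} {x₀ : E} {C : ℝ}

lemma mono (h : QuadAt f L x₀ C) {C' : ℝ} (hC : C ≤ C') : QuadAt f L x₀ C' := by
  have h1 := h.one_le
  have hinv : C'⁻¹ ≤ C⁻¹ := inv_anti₀ (by linarith) hC
  refine ⟨h1.trans hC, h.norm_le.trans hC, fun x y hx hy => ?_⟩
  refine (h.est x y (hx.trans hinv) (hy.trans hinv)).trans ?_
  gcongr

/-- On the ball of radius `C⁻¹` the factor in front of ‖x - y‖ in the error is at most 1. -/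
lemma lipschitz (h : QuadAt f L x₀ C) {x y : E} (hx : ‖x - x₀‖ ≤ C⁻¹) (hy : ‖y - x₀‖ ≤ C⁻¹) :
    ‖f x - f y‖ ≤ (C + 1) * ‖x - y‖ := by
  have h1 := h.one_le
  have h2 := h.est x y hx hy
  have h3 : ‖L (x - y)‖ ≤ C * ‖x - y‖ :=
    (L.le_opNorm _).trans (by gcongr; exact h.norm_le)
  have h4 : C * max ‖x - x₀‖ ‖y - x₀‖ ≤ 1 := by
    calc C * max ‖x - x₀‖ ‖y - x₀‖ ≤ C * C⁻¹ := by gcongr; exact max_le hx hy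
      _ = 1 := mul_inv_cancel₀ (by linarith)
  have h5 : ‖f x - f y‖ ≤ ‖f x - f y - L (x - y)‖ + ‖L (x - y)‖ := by
    simpa using norm_add_le (f x - f y - L (x - y)) (L (x - y))
  have h6 : C * max ‖x - x₀‖ ‖y - x₀‖ * ‖x - y‖ ≤ 1 * ‖x - y‖ := by gcongr
  linarith

lemma lipschitz_center (h : QuadAt f L x₀ C) {x : E} (hx : ‖x - x₀‖ ≤ C⁻¹) :
    ‖f x - f x₀‖ ≤ (C + 1) * ‖x - x₀‖ :=
  h.lipschitz hx (by have := h.one_le; simp; linarith)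

lemma hasFDerivAt (h : QuadAt f L x₀ C) : HasFDerivAt f L x₀ := by
  have h1 := h.one_le
  rw [hasFDerivAt_iff_isLittleO, Asymptotics.isLittleO_iff]
  intro c hc
  have hpos : 0 < min C⁻¹ (c / C) := lt_min (by positivity) (by positivity)
  filter_upwards [Metric.ball_mem_nhds x₀ hpos] with x hx
  rw [mem_ball, dist_eq_norm] at hx
  have h2 := h.est x x₀ (hx.le.trans (min_le_left _ _)) (by simp; linarith)
  refine h2.trans ?_
  gcongr
  simp only [sub_self, norm_zero, norm_nonneg, sup_of_le_left]
  have := hx.le.trans (min_le_right _ _)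
  rw [le_div_iff₀ (by linarith)] at this
  linarith

lemma congr (h : QuadAt f L x₀ C) {g : E → F}
    (hg : ∀ x, ‖x - x₀‖ ≤ C⁻¹ → g x = f x) : QuadAt g L x₀ C :=
  ⟨h.one_le, h.norm_le, fun x y hx hy => by rw [hg x hx, hg y hy]; exact h.est x y hx hy⟩

/-- The constant of a composition of maps with constant `C`. -/
def compConst (C : ℝ) : ℝ := C * (C + 1) ^ 2 + C ^ 2

lemma le_compConst (hC : 1 ≤ C) : C * (C + 1) ≤ compConst C := by
  unfold compConst; nlinarith

lemma le_compConst' (hC : 1 ≤ C) : C ≤ compConst C := by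
  unfold compConst; nlinarith

lemma comp_ball (h : QuadAt f L x₀ C) {x : E} (hx : ‖x - x₀‖ ≤ (compConst C)⁻¹) :
    ‖x - x₀‖ ≤ C⁻¹ ∧ ‖f x - f x₀‖ ≤ C⁻¹ := by
  have h1 := h.one_le
  have hx1 : ‖x - x₀‖ ≤ C⁻¹ := hx.trans (inv_anti₀ (by linarith) (le_compConst' h1))
  refine ⟨hx1, (h.lipschitz_center hx1).trans ?_⟩
  have h2 : ‖x - x₀‖ ≤ (C * (C + 1))⁻¹ :=
    hx.trans (inv_anti₀ (by positivity) (le_compConst h1))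
  calc (C + 1) * ‖x - x₀‖ ≤ (C + 1) * (C * (C + 1))⁻¹ := by gcongr
    _ = C⁻¹ := by field_simp

lemma comp {g : F → G} {M : F →L[ℝ] G} (hg : QuadAt g M (f x₀) C) (h : QuadAt f L x₀ C) :
    QuadAt (g ∘ f) (M.comp L) x₀ (compConst C) := by
  have h1 := h.one_le
  refine ⟨h1.trans (le_compConst' h1), ?_, fun x y hx hy => ?_⟩
  · refine (M.opNorm_comp_le L).trans ?_
    calc ‖M‖ * ‖L‖ ≤ C * C := mul_le_mul hg.norm_le h.norm_le (norm_nonneg _) (by linarith)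
      _ ≤ _ := by unfold compConst; nlinarith [mul_nonneg (by linarith : (0:ℝ) ≤ C) (sq_nonneg (C+1))]
  obtain ⟨hx1, hx2⟩ := h.comp_ball hx
  obtain ⟨hy1, hy2⟩ := h.comp_ball hy
  have e1 := hg.est (f x) (f y) hx2 hy2
  have e2 := h.est x y hx1 hy1
  have e3 := h.lipschitz hx1 hy1
  have e4 : max ‖f x - f x₀‖ ‖f y - f x₀‖ ≤ (C + 1) * max ‖x - x₀‖ ‖y - x₀‖ := by
    refine max_le ((h.lipschitz_center hx1).trans ?_) ((h.lipschitz_center hy1).trans ?_)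
    · gcongr; exact le_max_left _ _
    · gcongr; exact le_max_right _ _
  set m := max ‖x - x₀‖ ‖y - x₀‖
  have hm : 0 ≤ m := (norm_nonneg _).trans (le_max_left _ _)
  have e5 : ‖M (f x - f y - L (x - y))‖ ≤ C * (C * m * ‖x - y‖) :=
    (M.le_opNorm _).trans (mul_le_mul hg.norm_le e2 (norm_nonneg _) (by linarith))
  have e6 : C * max ‖f x - f x₀‖ ‖f y - f x₀‖ * ‖f x - f y‖ ≤
      C * ((C + 1) * m) * ((C + 1) * ‖x - y‖) := by gcongr
  -- The error of `g` at Lipschitz images contributes C(C+1)², and `M` applied to the error of `f`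
  -- contributes C².
  have e7 : (g ∘ f) x - (g ∘ f) y - (M.comp L) (x - y) =
      (g (f x) - g (f y) - M (f x - f y)) + M (f x - f y - L (x - y)) := by
    simp [map_sub]
  rw [e7]
  refine (norm_add_le _ _).trans ?_
  unfold compConst
  linarith

lemma affine (L : E →L[ℝ] F) (x₀ : E) (hC : 1 ≤ C) (hL : ‖L‖ ≤ C) (b : F) :
    QuadAt (fun x => b + L x) L x₀ C :=
  ⟨hC, hL, fun x y _ _ => by
    simp only [add_sub_add_left_eq_sub, ← map_sub, sub_self, norm_zero]
    positivity⟩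

/-- Mean value inequality on the convex set `S ∩ closedBall x₀ m`, where the derivative differs from
`f' x₀` by at most `K * m`. -/
lemma of_isC11On {D : Set E} {f' : E → E →L[ℝ] F} {K : NNReal}
    (hf : ∀ x ∈ D, HasFDerivWithinAt f (f' x) D x) (hK : LipschitzOnWith K f' D)
    {S : Set E} (hS : Convex ℝ S) (hSD : S ⊆ D) {x₀ x y : E} (hx₀ : x₀ ∈ S) (hx : x ∈ S)
    (hy : y ∈ S) : ‖f x - f y - f' x₀ (x - y)‖ ≤ K * max ‖x - x₀‖ ‖y - x₀‖ * ‖x - y‖ := by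
  set m := max ‖x - x₀‖ ‖y - x₀‖
  have hconv : Convex ℝ (S ∩ closedBall x₀ m) := hS.inter (convex_closedBall _ _)
  have hsub : S ∩ closedBall x₀ m ⊆ D := inter_subset_left.trans hSD
  refine hconv.norm_image_sub_le_of_norm_hasFDerivWithin_le' (f' := f')
    (fun z hz => (hf z (hsub hz)).mono hsub) (fun z hz => ?_)
    ⟨hy, by rw [mem_closedBall, dist_eq_norm]; exact le_max_right _ _⟩
    ⟨hx, by rw [mem_closedBall, dist_eq_norm]; exact le_max_left _ _⟩
  refine (hK.norm_sub_le (hsub hz) (hSD hx₀)).trans ?_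
  have := hz.2
  rw [mem_closedBall, dist_eq_norm] at this
  gcongr

end QuadAt

/-! ### Radial retraction. -/

section Retraction

variable {E : Type*} [NormedAddCommGroup E] [NormedSpace ℝ E]

/-- The radial retraction onto the closed ball of radius `r`. -/
noncomputable def radialRetract (r : ℝ) (x : E) : E := (r / max r ‖x‖) • x

lemma radialRetract_of_le {r : ℝ} (hr : 0 < r) {x : E} (hx : ‖x‖ ≤ r) : radialRetract r x = x := by
  rw [radialRetract, max_eq_left hx, div_self hr.ne', one_smul]

lemma norm_radialRetract_le {r : ℝ} (hr : 0 < r) (x : E) : ‖radialRetract r x‖ ≤ min r ‖x‖ := by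
  have hm : 0 < max r ‖x‖ := lt_max_of_lt_left hr
  rw [radialRetract, norm_smul, Real.norm_of_nonneg (by positivity)]
  refine le_min ?_ ?_
  · rw [div_mul_eq_mul_div, div_le_iff₀ hm]
    gcongr; exact le_max_right _ _
  · have : r / max r ‖x‖ ≤ 1 := by rw [div_le_one hm]; exact le_max_left _ _
    nlinarith [norm_nonneg x]

/-- Changing the vector and changing the scaling factor each cost at most ‖x - y‖. The argument uses
no inner product. -/
lemma norm_radialRetract_sub_le {r : ℝ} (hr : 0 < r) (x y : E) :
    ‖radialRetract r x - radialRetract r y‖ ≤ 2 * ‖x - y‖ := by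
  set a := max r ‖x‖ with ha
  set b := max r ‖y‖ with hb
  have ha0 : 0 < a := lt_max_of_lt_left hr
  have hb0 : 0 < b := lt_max_of_lt_left hr
  have hab : |b - a| ≤ ‖x - y‖ := by
    have h1 : |max r ‖y‖ - max r ‖x‖| ≤ |‖y‖ - ‖x‖| := by
      have := abs_max_sub_max_le_abs ‖y‖ ‖x‖ r
      rwa [max_comm ‖y‖, max_comm ‖x‖] at this
    refine h1.trans ?_
    rw [norm_sub_rev x y]
    exact abs_norm_sub_norm_le y x
  have e : radialRetract r x - radialRetract r y =
      (r / a) • (x - y) + ((r / a) * ((b - a) / b)) • y := by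
    rw [radialRetract, radialRetract, ← ha, ← hb]
    have : r / b = r / a - (r / a) * ((b - a) / b) := by field_simp; ring
    rw [this]; module
  have hra : |r / a| ≤ 1 := by
    rw [abs_of_pos (by positivity), div_le_one ha0]; exact le_max_left _ _
  have hy : ‖y‖ / b ≤ 1 := by rw [div_le_one hb0]; exact le_max_right _ _
  rw [e]
  refine (norm_add_le _ _).trans ?_
  rw [norm_smul, norm_smul, Real.norm_eq_abs, Real.norm_eq_abs, abs_mul, abs_div (b - a) b, abs_of_pos hb0]
  have h2 : |r / a| * (|b - a| / b) * ‖y‖ = |r / a| * (|b - a| * (‖y‖ / b)) := by ring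
  have h3 : |b - a| * (‖y‖ / b) ≤ ‖x - y‖ * 1 := by gcongr
  have h4 : |r / a| * (|b - a| * (‖y‖ / b)) ≤ 1 * (‖x - y‖ * 1) := by gcongr
  have h5 : |r / a| * ‖x - y‖ ≤ 1 * ‖x - y‖ := by gcongr
  linarith

end Retraction

/-! ### Cone calculus for saddle maps. -/

/-- A map of `ℝ × F` that fixes the origin, expands the first coordinate by about `μ > 1` and
contracts the second one, up to errors with small Lipschitz constant. -/
structure SaddleMap {F : Type*} [NormedAddCommGroup F] (P : ℝ × F → ℝ × F) (μ θ α C : ℝ) :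
    Prop where
  map_zero : P 0 = 0
  θ_nonneg : 0 ≤ θ
  α_nonneg : 0 ≤ α
  C_nonneg : 0 ≤ C
  one_lt : 1 < μ - θ
  α_lt : α < 1
  fst_le : ∀ x y, |(P x).1 - (P y).1 - μ * (x.1 - y.1)| ≤ θ * ‖x - y‖
  fst_quad : ∀ x y, |(P x).1 - (P y).1 - μ * (x.1 - y.1)| ≤ C * max ‖x‖ ‖y‖ * ‖x - y‖
  snd_le : ∀ x y, ‖(P x).2 - (P y).2‖ ≤ α * ‖x - y‖

namespace SaddleMap

variable {F : Type*} [NormedAddCommGroup F] {P : ℝ × F → ℝ × F} {μ θ α C : ℝ}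

lemma norm_sub_of_le {x y : ℝ × F} (h : ‖x.2 - y.2‖ ≤ |x.1 - y.1|) : ‖x - y‖ = |x.1 - y.1| := by
  rw [Prod.norm_def]; exact max_eq_left h

lemma norm_sub_of_ge {x y : ℝ × F} (h : |x.1 - y.1| ≤ ‖x.2 - y.2‖) : ‖x - y‖ = ‖x.2 - y.2‖ := by
  rw [Prod.norm_def]; exact max_eq_right h

lemma lipschitz (h : SaddleMap P μ θ α C) (x y : ℝ × F) : ‖P x - P y‖ ≤ (μ + θ) * ‖x - y‖ := by
  have h0 := h.θ_nonneg
  have h1 := h.one_lt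
  have h2 : |x.1 - y.1| ≤ ‖x - y‖ := norm_fst_le (x - y)
  rw [Prod.norm_def]
  refine max_le ?_ ((h.snd_le x y).trans ?_)
  · have h3 := h.fst_le x y
    have h4 : |(P x).1 - (P y).1| ≤ |(P x).1 - (P y).1 - μ * (x.1 - y.1)| + |μ * (x.1 - y.1)| := by
      simpa using abs_add_le ((P x).1 - (P y).1 - μ * (x.1 - y.1)) (μ * (x.1 - y.1))
    rw [abs_mul, abs_of_pos (by linarith : 0 < μ)] at h4
    have h5 : μ * |x.1 - y.1| ≤ μ * ‖x - y‖ := by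
      apply mul_le_mul_of_nonneg_left h2; linarith
    change |(P x).1 - (P y).1| ≤ _
    linarith
  · have := h.α_lt
    gcongr; linarith

lemma continuous (h : SaddleMap P μ θ α C) : Continuous P := by
  have h0 := h.θ_nonneg
  have h1 := h.one_lt
  refine (LipschitzWith.of_dist_le_mul (K := ⟨μ + θ, by linarith⟩) fun x y => ?_).continuous
  rw [dist_eq_norm, dist_eq_norm]
  exact h.lipschitz x y

lemma iterate_zero_point (h : SaddleMap P μ θ α C) (k : ℕ) : P^[k] 0 = 0 :=
  Function.iterate_fixed h.map_zero k

/-- One step for two points whose difference lies in the unstable cone. -/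
lemma unstable_step (h : SaddleMap P μ θ α C) {σ : ℝ} (hσ : |σ| = 1) {x y : ℝ × F}
    (hxy : ‖x.2 - y.2‖ ≤ σ * (x.1 - y.1)) :
    ‖(P x).2 - (P y).2‖ ≤ α * (σ * (x.1 - y.1)) ∧
    |σ * ((P x).1 - (P y).1) - μ * (σ * (x.1 - y.1))| ≤ θ * (σ * (x.1 - y.1)) ∧
    |σ * ((P x).1 - (P y).1) - μ * (σ * (x.1 - y.1))| ≤
      C * max ‖x‖ ‖y‖ * (σ * (x.1 - y.1)) := by
  have hd : 0 ≤ σ * (x.1 - y.1) := (norm_nonneg _).trans hxy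
  have e : σ * (x.1 - y.1) = |x.1 - y.1| := by
    rw [← abs_of_nonneg hd, abs_mul, hσ, one_mul]
  have hn : ‖x - y‖ = σ * (x.1 - y.1) := by
    rw [e]; exact norm_sub_of_le (e ▸ hxy)
  have e2 : |σ * ((P x).1 - (P y).1) - μ * (σ * (x.1 - y.1))| =
      |(P x).1 - (P y).1 - μ * (x.1 - y.1)| := by
    rw [show σ * ((P x).1 - (P y).1) - μ * (σ * (x.1 - y.1)) =
      σ * ((P x).1 - (P y).1 - μ * (x.1 - y.1)) by ring, abs_mul, hσ, one_mul]
  rw [e2, ← hn]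
  exact ⟨h.snd_le x y, h.fst_le x y, h.fst_quad x y⟩

lemma unstable_step' (h : SaddleMap P μ θ α C) {σ : ℝ} (hσ : |σ| = 1) {x y : ℝ × F}
    (hxy : ‖x.2 - y.2‖ ≤ σ * (x.1 - y.1)) :
    ‖(P x).2 - (P y).2‖ ≤ α * (σ * (x.1 - y.1)) ∧
    (μ - θ) * (σ * (x.1 - y.1)) ≤ σ * ((P x).1 - (P y).1) ∧
    σ * ((P x).1 - (P y).1) ≤ (μ + θ) * (σ * (x.1 - y.1)) := by
  obtain ⟨h1, h2, -⟩ := h.unstable_step hσ hxy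
  rw [abs_le] at h2
  exact ⟨h1, by linarith [h2.1], by linarith [h2.2]⟩

/-- The sign `σ` selects one half of the unstable cone. Each half is invariant because the second
component of the difference shrinks by α < 1 < μ - θ relative to the first. -/
lemma unstable_iterate (h : SaddleMap P μ θ α C) {σ : ℝ} (hσ : |σ| = 1) {x y : ℝ × F}
    (hxy : ‖x.2 - y.2‖ ≤ σ * (x.1 - y.1)) (k : ℕ) :
    ‖(P^[k] x).2 - (P^[k] y).2‖ ≤ σ * ((P^[k] x).1 - (P^[k] y).1) ∧
    (μ - θ) ^ k * (σ * (x.1 - y.1)) ≤ σ * ((P^[k] x).1 - (P^[k] y).1) ∧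
    σ * ((P^[k] x).1 - (P^[k] y).1) ≤ (μ + θ) ^ k * (σ * (x.1 - y.1)) := by
  have h1 := h.one_lt
  have h2 := h.α_lt
  have h3 := h.θ_nonneg
  induction k with
  | zero => simpa using hxy
  | succ k ih =>
    obtain ⟨i1, i2, i3⟩ := ih
    rw [Function.iterate_succ_apply', Function.iterate_succ_apply']
    obtain ⟨s1, s2, s3⟩ := h.unstable_step' hσ i1
    set d := σ * ((P^[k] x).1 - (P^[k] y).1)
    have hd : 0 ≤ d := (norm_nonneg _).trans i1
    refine ⟨s1.trans (le_trans ?_ s2), le_trans ?_ s2, s3.trans ?_⟩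
    · gcongr; linarith
    · rw [pow_succ', mul_assoc]
      apply mul_le_mul_of_nonneg_left i2; linarith
    · rw [pow_succ', mul_assoc]
      apply mul_le_mul_of_nonneg_left i3; linarith

lemma exists_sign (a : ℝ) : ∃ σ : ℝ, |σ| = 1 ∧ σ * a = |a| := by
  rcases le_total 0 a with h | h
  · exact ⟨1, by simp, by rw [abs_of_nonneg h, one_mul]⟩
  · exact ⟨-1, by simp, by rw [abs_of_nonpos h]; ring⟩

/-- A difference strictly inside the unstable cone stays there. -/
lemma unstable_strict (h : SaddleMap P μ θ α C) {x y : ℝ × F}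
    (hxy : ‖x.2 - y.2‖ < |x.1 - y.1|) : ‖(P x).2 - (P y).2‖ < |(P x).1 - (P y).1| := by
  obtain ⟨σ, hσ, e⟩ := exists_sign (x.1 - y.1)
  obtain ⟨s1, s2, s3⟩ := h.unstable_step' hσ (e ▸ hxy.le)
  rw [e] at s1 s2
  have hd : 0 < |x.1 - y.1| := (norm_nonneg _).trans_lt hxy
  have h1 := h.one_lt
  have h2 := h.α_lt
  have h4 : σ * ((P x).1 - (P y).1) ≤ |(P x).1 - (P y).1| := by
    refine (le_abs_self _).trans ?_
    rw [abs_mul, hσ, one_mul]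
  nlinarith

lemma stable_of_stable (h : SaddleMap P μ θ α C) {x y : ℝ × F}
    (hxy : |(P x).1 - (P y).1| ≤ ‖(P x).2 - (P y).2‖) : |x.1 - y.1| ≤ ‖x.2 - y.2‖ := by
  by_contra hc
  exact absurd (h.unstable_strict (not_le.1 hc)) (not_lt.2 hxy)

/-- Backward invariance of the stable cone puts all earlier differences into it. There the sup norm
is carried by the second component, which contracts. -/
lemma stable_iterate (h : SaddleMap P μ θ α C) {x y : ℝ × F} (k : ℕ)
    (hxy : |(P^[k] x).1 - (P^[k] y).1| ≤ ‖(P^[k] x).2 - (P^[k] y).2‖) :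
    ‖P^[k] x - P^[k] y‖ ≤ α ^ k * ‖x - y‖ := by
  induction k with
  | zero => simp
  | succ k ih =>
    rw [Function.iterate_succ_apply', Function.iterate_succ_apply'] at *
    rw [norm_sub_of_ge hxy, pow_succ', mul_assoc]
    refine (h.snd_le _ _).trans ?_
    exact mul_le_mul_of_nonneg_left (ih (h.stable_of_stable hxy)) h.α_nonneg

lemma norm_iterate_le_of_stable (h : SaddleMap P μ θ α C) {x : ℝ × F} {k : ℕ}
    (hx : |(P^[k] x).1| ≤ ‖(P^[k] x).2‖) : ‖P^[k] x‖ ≤ α ^ k * ‖x‖ := by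
  have := h.stable_iterate (x := x) (y := 0) k (by simpa [h.iterate_zero_point] using hx)
  simpa [h.iterate_zero_point] using this

/-- Through every value `a` of the expanding coordinate passes a backward orbit that decays. -/
lemma exists_backward_orbit [CompleteSpace F] (h : SaddleMap P μ θ α C) (a : ℝ) :
    ∃ V : ℕ → ℝ × F, (V 0).1 = a ∧ (∀ j, P (V (j + 1)) = V j) ∧
      ∀ j, (μ - θ) ^ j * ‖V j‖ ≤ |a| := by
  have h1 := h.one_lt
  have h2 := h.α_lt
  have h3 := h.θ_nonneg
  have h4 := h.α_nonneg
  have hμ : 0 < μ := by linarith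
  -- the operator on bounded sequences
  let S : (ℕ → ℝ × F) → ℕ → ℝ × F := fun V j =>
    (Nat.casesOn j a fun i => (V (i + 1)).1 + μ⁻¹ * ((V i).1 - (P (V (i + 1))).1),
      (P (V (j + 1))).2)
  -- The expanding coordinate is solved backwards, at the rate μ⁻¹(1+θ), which is below 1 since 1 <
  -- μ - θ; the other one is pushed forwards at the rate α.
  set q : ℝ := max (μ⁻¹ * (1 + θ)) α with hq
  have hq1 : q < 1 := by
    refine max_lt ?_ h2
    rw [inv_mul_lt_iff₀ hμ]; linarith
  have hq0 : 0 ≤ q := h4.trans (le_max_right _ _)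
  have key : ∀ (V W : ℕ → ℝ × F) (B : ℝ), (∀ j, ‖V j - W j‖ ≤ B) →
      ∀ j, ‖S V j - S W j‖ ≤ q * B := by
    intro V W B hB j
    have hB0 : 0 ≤ B := (norm_nonneg _).trans (hB 0)
    rw [Prod.norm_def]
    refine max_le ?_ ?_
    · cases j with
      | zero => simpa [S] using mul_nonneg hq0 hB0
      | succ i =>
        have e : (S V (i + 1) - S W (i + 1)).1 = μ⁻¹ * (((V i).1 - (W i).1) -
            ((P (V (i + 1))).1 - (P (W (i + 1))).1 - μ * ((V (i + 1)).1 - (W (i + 1)).1))) := by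
          simp only [S, Prod.fst_sub]
          field_simp; ring
        have b1 : |(V i).1 - (W i).1| ≤ B := (norm_fst_le (V i - W i)).trans (hB i)
        have b2 := (h.fst_le (V (i + 1)) (W (i + 1))).trans
          (mul_le_mul_of_nonneg_left (hB (i + 1)) h3)
        rw [e, norm_mul, Real.norm_eq_abs, Real.norm_eq_abs, abs_of_pos (inv_pos.2 hμ)]
        calc μ⁻¹ * _ ≤ μ⁻¹ * (B + θ * B) := by
              gcongr; exact (abs_sub _ _).trans (add_le_add b1 b2)
          _ = (μ⁻¹ * (1 + θ)) * B := by ring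
          _ ≤ q * B := by gcongr; exact le_max_left _ _
    · refine (h.snd_le _ _).trans ?_
      exact mul_le_mul (le_max_right _ _) (hB _) (norm_nonneg _) hq0
  have hS0 : ∀ j, ‖S 0 j‖ ≤ |a| := by
    intro j
    rw [Prod.norm_def]
    cases j <;> simp [S, h.map_zero]
  have hSV : ∀ V : BoundedContinuousFunction ℕ (ℝ × F), ∀ j, ‖S V j‖ ≤ q * ‖V‖ + |a| := by
    intro V j
    have := key V 0 ‖V‖ (fun j => by simpa using V.norm_coe_le_norm j) j
    calc ‖S V j‖ = ‖(S V j - S 0 j) + S 0 j‖ := by simp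
      _ ≤ _ := (norm_add_le _ _).trans (add_le_add this (hS0 j))
  let Φ : BoundedContinuousFunction ℕ (ℝ × F) → BoundedContinuousFunction ℕ (ℝ × F) := fun V =>
    BoundedContinuousFunction.ofNormedAddCommGroupDiscrete (S V) _ (hSV V)
  have hΦ : ContractingWith ⟨q, hq0⟩ Φ := by
    refine ⟨by exact_mod_cast hq1, LipschitzWith.of_dist_le_mul fun V W => ?_⟩
    rw [BoundedContinuousFunction.dist_le (by positivity)]
    intro j
    rw [dist_eq_norm]
    refine key V W (dist V W) (fun j => ?_) j
    rw [← dist_eq_norm]; exact BoundedContinuousFunction.dist_coe_le_dist j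
  set V := hΦ.fixedPoint
  have hV : ∀ j, S V j = V j := fun j => by
    have : Φ V = V := hΦ.fixedPoint_isFixedPt
    exact congrArg (fun f : BoundedContinuousFunction ℕ (ℝ × F) => f j) this
  have hPV : ∀ j, P (V (j + 1)) = V j := by
    intro j
    refine Prod.ext ?_ (show (S V j).2 = (V j).2 from congrArg Prod.snd (hV j))
    have := congrArg Prod.fst (hV (j + 1))
    simp only [S] at this
    have h5 : μ⁻¹ * ((V j).1 - (P (V (j + 1))).1) = 0 := by linarith
    rcases mul_eq_zero.1 h5 with h6 | h6
    · exact absurd h6 (inv_pos.2 hμ).ne'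
    · linarith
  have hV0 : (V 0).1 = a := (congrArg Prod.fst (hV 0)).symm
  have hiter : ∀ k j, P^[k] (V (j + k)) = V j := by
    intro k
    induction k with
    | zero => simp
    | succ k ih => intro j; rw [Function.iterate_succ_apply, ← add_assoc, hPV, ih]
  -- a bounded backward orbit lies in the unstable cone
  have hcone : ∀ j, ‖(V j).2‖ ≤ |(V j).1| := by
    intro j
    -- A point outside the cone would have been contracted by αᵏ from the bounded point V (j + k),
    -- for every k, and would therefore vanish.
    by_contra hc
    have hs : ∀ k, ‖V j‖ ≤ α ^ k * ‖V‖ := fun k => by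
      have := h.norm_iterate_le_of_stable (x := V (j + k)) (k := k) (by rw [hiter]; linarith)
      rw [hiter] at this
      refine this.trans ?_
      gcongr
      exact V.norm_coe_le_norm _
    have hlim : Tendsto (fun k : ℕ => α ^ k * ‖V‖) atTop (𝓝 0) := by
      simpa using (tendsto_pow_atTop_nhds_zero_of_lt_one h4 h2).mul_const ‖V‖
    have h0 : ‖V j‖ ≤ 0 := ge_of_tendsto' hlim hs
    have h7 : V j = 0 := norm_le_zero_iff.1 h0
    rw [h7] at hc
    simp at hc
  refine ⟨V, hV0, hPV, fun j => ?_⟩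
  obtain ⟨σ, hσ, e⟩ := exists_sign (V j).1
  have hu := (h.unstable_iterate hσ (x := V j) (y := 0) (by simpa [e] using hcone j) j).2.1
  have hj : P^[j] (V j) = V 0 := by simpa using hiter j 0
  rw [hj, h.iterate_zero_point] at hu
  simp only [Prod.fst_zero, sub_zero, hV0, e] at hu
  have hn : ‖V j‖ = |(V j).1| := by
    rw [Prod.norm_def]; exact max_eq_left (hcone j)
  rw [hn]
  refine hu.trans ((le_abs_self _).trans ?_)
  rw [abs_mul, hσ, one_mul]

end SaddleMap

/-! ### Passage of orbits past the saddle. -/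

namespace SaddleMap

variable {F : Type*} [NormedAddCommGroup F] {P : ℝ × F → ℝ × F} {μ θ α C : ℝ}

/-- If the difference of two orbits starts in the unstable cone and the second orbit decays, then
the first coordinates separate to a distance in `(D / (μ + θ), D]` after some number `k` of steps,
and up to that moment the growth is `μ ^ k` up to a uniform factor. -/
lemma exists_exit (h : SaddleMap P μ θ α C) {σ : ℝ} (hσ : |σ| = 1) {x y : ℝ × F} {b D : ℝ}
    (hb : 0 ≤ b) (hy : ∀ j, ‖P^[j] y‖ ≤ α ^ j * b) (hxy : ‖x.2 - y.2‖ ≤ σ * (x.1 - y.1))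
    (hd : 0 < σ * (x.1 - y.1)) (hD : σ * (x.1 - y.1) ≤ D) :
    ∃ k, D < (μ + θ) ^ (k + 1) * (σ * (x.1 - y.1)) ∧
      D < (μ + θ) * (σ * ((P^[k] x).1 - (P^[k] y).1)) ∧
      σ * ((P^[k] x).1 - (P^[k] y).1) ≤ D ∧
      (∀ j ≤ k, ‖P^[j] x‖ ≤ b + D) ∧
      (∑ j ∈ Finset.range k, max ‖P^[j] x‖ ‖P^[j] y‖ ≤ b * (1 - α)⁻¹ + D * (μ - θ - 1)⁻¹) ∧
      |Real.log (σ * ((P^[k] x).1 - (P^[k] y).1)) - Real.log (σ * (x.1 - y.1)) -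
        k * Real.log μ| ≤ C * (b * (1 - α)⁻¹ + D * (μ - θ - 1)⁻¹) := by
  have h1 := h.one_lt
  have h2 := h.α_lt
  have h3 := h.θ_nonneg
  have h4 := h.α_nonneg
  set d : ℕ → ℝ := fun j => σ * ((P^[j] x).1 - (P^[j] y).1) with hdd
  have hd0 : d 0 = σ * (x.1 - y.1) := rfl
  have hcone : ∀ j, ‖(P^[j] x).2 - (P^[j] y).2‖ ≤ d j := fun j => (h.unstable_iterate hσ hxy j).1
  have hgrow : ∀ j i, (μ - θ) ^ i * d j ≤ d (i + j) := fun j i => by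
    have := (h.unstable_iterate hσ (hcone j) i).2.1
    rwa [← Function.iterate_add_apply, ← Function.iterate_add_apply] at this
  have hpos : ∀ j, 0 < d j := fun j =>
    lt_of_lt_of_le (mul_pos (pow_pos (by linarith) j) hd) (hgrow 0 j)
  have hex : ∃ j, D < d j := by
    obtain ⟨j, hj⟩ := ((tendsto_pow_atTop_atTop_of_one_lt h1).atTop_mul_const hd).eventually_gt_atTop
      D |>.exists
    exact ⟨j, hj.trans_le (hgrow 0 j)⟩
  classical
  -- The exit index is the last one with separation at most `D`, one before the first excess; it
  -- exists because the separation starts below `D`.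
  obtain ⟨k, hk⟩ : ∃ k, Nat.find hex = k + 1 := by
    refine Nat.exists_eq_succ_of_ne_zero fun h0 => ?_
    have := Nat.find_spec hex
    rw [h0, hd0] at this
    linarith
  have hk1 : D < d (k + 1) := hk ▸ Nat.find_spec hex
  have hkle : ∀ j ≤ k, d j ≤ D := fun j hj => not_lt.1 (Nat.find_min hex (by omega))
  have hstep : ∀ j, d (j + 1) ≤ (μ + θ) * d j := fun j => by
    have := (h.unstable_step' hσ (hcone j)).2.2
    rwa [← Function.iterate_succ_apply' P, ← Function.iterate_succ_apply' P] at this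
  have hx : ∀ j, ‖P^[j] x‖ ≤ α ^ j * b + d j := fun j => by
    have e : ‖P^[j] x - P^[j] y‖ = d j := by
      have : d j = |(P^[j] x).1 - (P^[j] y).1| := by
        rw [← abs_of_pos (hpos j), hdd]
        simp only [abs_mul, hσ, one_mul]
      rw [this]; exact norm_sub_of_le (this ▸ hcone j)
    have := norm_add_le (P^[j] x - P^[j] y) (P^[j] y)
    rw [sub_add_cancel, e] at this
    linarith [hy j]
  have hmax : ∀ j, max ‖P^[j] x‖ ‖P^[j] y‖ ≤ α ^ j * b + d j := fun j =>
    max_le (hx j) ((hy j).trans (by linarith [hpos j]))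
  -- Two geometric series, one decaying from j = 0 and one decaying backwards from j = k, give a
  -- bound independent of `k`.
  have hsum : ∑ j ∈ Finset.range k, max ‖P^[j] x‖ ‖P^[j] y‖ ≤
      b * (1 - α)⁻¹ + D * (μ - θ - 1)⁻¹ := by
    set r := (μ - θ)⁻¹ with hr
    have hr0 : 0 < r := inv_pos.2 (by linarith)
    have hr1 : r < 1 := inv_lt_one_of_one_lt₀ h1
    have hD0 : 0 < D := (hpos k).trans_le (hkle k le_rfl)
    have b1 : ∀ j ∈ Finset.range k, max ‖P^[j] x‖ ‖P^[j] y‖ ≤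
        b * α ^ j + D * r * r ^ (k - 1 - j) := by
      intro j hj
      have hj := Finset.mem_range.1 hj
      refine (hmax j).trans ?_
      have g := hgrow j (k - j)
      rw [Nat.sub_add_cancel hj.le] at g
      have g2 := g.trans (hkle k le_rfl)
      have e : r * r ^ (k - 1 - j) = ((μ - θ) ^ (k - j))⁻¹ := by
        rw [← pow_succ', hr, inv_pow]; congr 2; omega
      rw [mul_assoc, e, mul_comm b]
      have : 0 < (μ - θ) ^ (k - j) := pow_pos (by linarith) _
      have : d j ≤ D * ((μ - θ) ^ (k - j))⁻¹ := by
        rw [← div_eq_mul_inv, le_div_iff₀ this]; linarith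
      linarith
    refine (Finset.sum_le_sum b1).trans ?_
    rw [Finset.sum_add_distrib, ← Finset.mul_sum, ← Finset.mul_sum,
      Finset.sum_range_reflect (fun i => r ^ i)]
    have geo : ∀ q : ℝ, 0 ≤ q → q < 1 → ∑ i ∈ Finset.range k, q ^ i ≤ (1 - q)⁻¹ := by
      intro q hq0 hq1
      rw [← tsum_geometric_of_lt_one hq0 hq1]
      exact (summable_geometric_of_lt_one hq0 hq1).sum_le_tsum _ (fun i _ => by positivity)
    have e2 : r * (1 - r)⁻¹ = (μ - θ - 1)⁻¹ := by
      have : μ - θ ≠ 0 := by linarith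
      have h6 : μ - θ - 1 ≠ 0 := by linarith
      rw [hr, eq_comm, inv_eq_iff_eq_inv, mul_inv, inv_inv, inv_inv]
      field_simp
    refine add_le_add (mul_le_mul_of_nonneg_left (geo α h4 h2) hb) ?_
    rw [← e2, mul_assoc]
    have := geo r hr0.le hr1
    gcongr
  refine ⟨k, ?_, hk1.trans_le (hstep k), hkle k le_rfl, fun j hj => (hx j).trans ?_, hsum, ?_⟩
  · exact hk1.trans_le (h.unstable_iterate hσ hxy (k + 1)).2.2
  · have : α ^ j ≤ 1 := pow_le_one₀ h4 h2.le
    have := hkle j hj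
    nlinarith
  -- The quadratic estimate bounds the relative error of one expansion. The two elementary bounds of
  -- log z by z - 1 and 1 - 1/z turn it into an additive error of the logarithm.
  · have hlog : ∀ j, |Real.log (d (j + 1)) - Real.log (d j) - Real.log μ| ≤
        C * max ‖P^[j] x‖ ‖P^[j] y‖ := by
      intro j
      have hq := (h.unstable_step hσ (hcone j)).2.2
      rw [← Function.iterate_succ_apply' P, ← Function.iterate_succ_apply' P] at hq
      change |d (j + 1) - μ * d j| ≤ C * max ‖P^[j] x‖ ‖P^[j] y‖ * d j at hq
      set w := C * max ‖P^[j] x‖ ‖P^[j] y‖ with hw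
      have hw0 : 0 ≤ w := mul_nonneg h.C_nonneg ((norm_nonneg _).trans (le_max_left _ _))
      have hμ : 1 < μ := by linarith
      have hdj := hpos j
      have hdj1 := hpos (j + 1)
      have hle : d j ≤ d (j + 1) := by
        have := hgrow j 1
        rw [pow_one, add_comm] at this
        nlinarith
      rw [← Real.log_div hdj1.ne' hdj.ne', ← Real.log_div (by positivity) (by positivity)]
      set z := d (j + 1) / d j / μ with hz
      have hz0 : 0 < z := by positivity
      rw [abs_le] at hq ⊢
      constructor
      · refine le_trans ?_ (Real.one_sub_inv_le_log_of_pos hz0)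
        have : z⁻¹ - 1 = (μ * d j - d (j + 1)) / d (j + 1) := by rw [hz]; field_simp
        have h8 : (μ * d j - d (j + 1)) / d (j + 1) ≤ w := by
          rw [div_le_iff₀ hdj1]; nlinarith
        linarith
      · refine (Real.log_le_sub_one_of_pos hz0).trans ?_
        have : z - 1 = (d (j + 1) - μ * d j) / (μ * d j) := by rw [hz]; field_simp
        rw [this, div_le_iff₀ (by positivity)]
        nlinarith [mul_nonneg hw0 hdj.le]
    have htel : Real.log (d k) - Real.log (d 0) - k * Real.log μ =
        ∑ j ∈ Finset.range k, (Real.log (d (j + 1)) - Real.log (d j) - Real.log μ) := by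
      rw [Finset.sum_sub_distrib, Finset.sum_range_sub (fun j => Real.log (d j))]
      simp
    change |Real.log (d k) - Real.log (d 0) - k * Real.log μ| ≤ _
    rw [htel]
    refine (Finset.abs_sum_le_sum_abs _ _).trans ((Finset.sum_le_sum fun j _ => hlog j).trans ?_)
    rw [← Finset.mul_sum]
    exact mul_le_mul_of_nonneg_left hsum h.C_nonneg

/-- An orbit either stays in the stable cone forever, or it enters the unstable cone before it can
grow. -/
lemma stable_or_enters (h : SaddleMap P μ θ α C) (x : ℝ × F) :
    (∀ k, |(P^[k] x).1| ≤ ‖(P^[k] x).2‖) ∨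
    ∃ i, ‖(P^[i] x).2‖ < |(P^[i] x).1| ∧ ∀ j ≤ i, ‖P^[j] x‖ ≤ (μ + θ) * ‖x‖ := by
  classical
  by_cases hs : ∀ k, |(P^[k] x).1| ≤ ‖(P^[k] x).2‖
  · exact Or.inl hs
  push Not at hs
  right
  have h1 := h.one_lt
  have h3 := h.θ_nonneg
  -- Before the first entrance the orbit is contracted; only the entering step itself can cost the
  -- Lipschitz constant μ + θ.
  refine ⟨Nat.find hs, Nat.find_spec hs, fun j hj => ?_⟩
  have hst : ∀ i < Nat.find hs, ‖P^[i] x‖ ≤ ‖x‖ := fun i hi => by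
    refine (h.norm_iterate_le_of_stable (not_lt.1 (Nat.find_min hs hi))).trans ?_
    have : α ^ i ≤ 1 := pow_le_one₀ h.α_nonneg h.α_lt.le
    nlinarith [norm_nonneg x]
  cases j with
  | zero => simp only [Function.iterate_zero, id]; nlinarith [norm_nonneg x]
  | succ j =>
    rw [Function.iterate_succ_apply']
    have h5 := h.lipschitz (P^[j] x) 0
    rw [h.map_zero, sub_zero, sub_zero] at h5
    refine h5.trans ?_
    have := hst j (by omega)
    apply mul_le_mul_of_nonneg_left this; linarith

/-- A curve that crosses from one side of the unstable cone to the other contains a point whose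
orbit stays in the stable cone. -/
lemma exists_stable_of_crossing (h : SaddleMap P μ θ α C) {I : Set ℝ} (hI : IsPreconnected I)
    {γ : ℝ → ℝ × F} (hγ : ContinuousOn γ I) {t₀ t₁ : ℝ} (ht₀ : t₀ ∈ I) (ht₁ : t₁ ∈ I)
    (h₀ : ‖(γ t₀).2‖ < (γ t₀).1) (h₁ : ‖(γ t₁).2‖ < -(γ t₁).1) :
    ∃ t ∈ I, ∀ k, |(P^[k] (γ t)).1| ≤ ‖(P^[k] (γ t)).2‖ := by
  by_contra hc
  push Not at hc
  have hcont : ∀ k, Continuous P^[k] := fun k => h.continuous.iterate k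
  -- Points that ever enter the σ-half of the cone. Both sets are open and, as the sign of the first
  -- coordinate persists, disjoint; a connected curve meeting both is not covered by them.
  let U : ℝ → Set (ℝ × F) := fun σ => ⋃ k, {z | ‖(P^[k] z).2‖ < σ * (P^[k] z).1}
  have hU : ∀ σ, IsOpen (U σ) := fun σ => isOpen_iUnion fun k =>
    isOpen_lt (hcont k).snd.norm (continuous_const.mul (hcont k).fst)
  have hpers : ∀ σ, |σ| = 1 → ∀ z ∈ U σ, ∃ k₀, ∀ k ≥ k₀, 0 < σ * (P^[k] z).1 := by
    intro σ hσ z hz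
    obtain ⟨k₀, hk₀⟩ := mem_iUnion.1 hz
    have hk₀ : ‖(P^[k₀] z).2‖ < σ * (P^[k₀] z).1 := hk₀
    refine ⟨k₀, fun k hk => ?_⟩
    have := (h.unstable_iterate hσ (x := P^[k₀] z) (y := 0) (by simpa using hk₀.le) (k - k₀)).2.1
    rw [← Function.iterate_add_apply, Nat.sub_add_cancel hk, h.iterate_zero_point] at this
    simp only [Prod.fst_zero, sub_zero] at this
    refine lt_of_lt_of_le (mul_pos (pow_pos ?_ _) ((norm_nonneg _).trans_lt hk₀)) this
    linarith [h.one_lt]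
  have hpre := hI.image γ hγ
  obtain ⟨z, -, hz1, hz2⟩ := hpre (U 1) (U (-1)) (hU 1) (hU (-1))
    (by
      rintro _ ⟨t, ht, rfl⟩
      obtain ⟨k, hk⟩ := hc t ht
      rcases lt_abs.1 hk with hk | hk
      · exact Or.inl (mem_iUnion.2 ⟨k, by simpa using hk⟩)
      · exact Or.inr (mem_iUnion.2 ⟨k, by simpa using hk⟩))
    ⟨γ t₀, mem_image_of_mem _ ht₀, mem_iUnion.2 ⟨0, by simpa using h₀⟩⟩
    ⟨γ t₁, mem_image_of_mem _ ht₁, mem_iUnion.2 ⟨0, by simpa using h₁⟩⟩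
  obtain ⟨k₁, hk₁⟩ := hpers 1 (by simp) z hz1
  obtain ⟨k₂, hk₂⟩ := hpers (-1) (by simp) z hz2
  have := hk₁ (max k₁ k₂) (le_max_left _ _)
  have := hk₂ (max k₁ k₂) (le_max_right _ _)
  linarith

/-- Orbit points with a long past near the origin are close to the end of a decaying backward
orbit with the same expanding coordinate. -/
lemma exists_backward_orbit_near [CompleteSpace F] (h : SaddleMap P μ θ α C) (x : ℝ × F) (k : ℕ) :
    ∃ V : ℕ → ℝ × F, (∀ j, P (V (j + 1)) = V j) ∧
      (∀ j, (μ - θ) ^ j * ‖V j‖ ≤ |(P^[k] x).1|) ∧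
      ‖P^[k] x - V 0‖ ≤ α ^ k * (‖x‖ + |(P^[k] x).1|) := by
  obtain ⟨V, h0, hV, hb⟩ := h.exists_backward_orbit (P^[k] x).1
  refine ⟨V, hV, hb, ?_⟩
  have hiter : ∀ k, P^[k] (V k) = V 0 := by
    intro k
    induction k with
    | zero => simp
    | succ k ih => rw [Function.iterate_succ_apply, hV, ih]
  -- The k-th images have equal first coordinates, so their difference lies trivially in the stable
  -- cone and has shrunk by αᵏ.
  have hs := h.stable_iterate (x := x) (y := V k) k (by rw [hiter, h0]; simp)
  rw [hiter] at hs
  refine hs.trans (mul_le_mul_of_nonneg_left ?_ (pow_nonneg h.α_nonneg k))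
  refine (norm_sub_le _ _).trans ?_
  have h1 := h.one_lt
  have : 1 ≤ (μ - θ) ^ k := one_le_pow₀ h1.le
  nlinarith [hb k, norm_nonneg (V k)]

end SaddleMap

/-! ### The flow near the limit cycle for short times. -/

namespace RGFlow

variable {Γ : Type*} [NormedAddCommGroup Γ] [NormedSpace ℝ Γ] {n : ℕ} {R : RGFlow Γ n}

lemma Alive.mono {s t : ℝ} {U : Γ} (h : R.Alive t U) (hs : 0 ≤ s) (hst : s ≤ t) :
    R.Alive s U := by
  have := (R.alive_add s (t - s) U hs (sub_nonneg.2 hst)).1 (by rwa [add_sub_cancel])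
  exact this.1

lemma Alive.add {s t : ℝ} {U : Γ} (hs : R.Alive s U) (ht : R.Alive t (R.map s U)) :
    R.Alive (s + t) U :=
  (R.alive_add s t U (R.alive_nonneg _ _ hs) (R.alive_nonneg _ _ ht)).2 ⟨hs, ht⟩

lemma Alive.map_add {s t : ℝ} {U : Γ} (hs : R.Alive s U) (ht : R.Alive t (R.map s U)) :
    R.map (s + t) U = R.map t (R.map s U) :=
  R.map_add s t U (R.alive_nonneg _ _ hs) (R.alive_nonneg _ _ ht) (hs.add ht)

lemma tangentMap_zero (R : RGFlow Γ n) (U : Γ) : R.tangentMap 0 U = ContinuousLinearMap.id ℝ Γ := by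
  have : R.map 0 = id := funext R.map_zero
  rw [tangentMap, this]; exact fderiv_id

end RGFlow

namespace LimitCycle

variable {Γ : Type*} [NormedAddCommGroup Γ] [NormedSpace ℝ Γ] {n : ℕ} {R : RGFlow Γ n}
  {c : LimitCycle R}

lemma alive_nat_mul (c : LimitCycle R) (k : ℕ) :
    R.Alive (k * c.period) c.base ∧ R.map (k * c.period) c.base = c.base := by
  induction k with
  | zero => simp [R.alive_zero, R.map_zero]
  | succ k ih =>
    have h1 : R.Alive c.period (R.map (k * c.period) c.base) := by rw [ih.2]; exact c.alive
    have e : ((k + 1 : ℕ) : ℝ) * c.period = k * c.period + c.period := by push_cast; ring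
    rw [e]
    exact ⟨ih.1.add h1, by rw [ih.1.map_add h1, ih.2, c.periodic]⟩

lemma alive_base (c : LimitCycle R) {s : ℝ} (hs : 0 ≤ s) : R.Alive s c.base := by
  obtain ⟨k, hk⟩ := exists_nat_ge (s / c.period)
  rw [div_le_iff₀ c.period_pos] at hk
  exact (c.alive_nat_mul k).1.mono hs hk

lemma point_zero (c : LimitCycle R) : c.point 0 = c.base := R.map_zero _

lemma point_period (c : LimitCycle R) : c.point c.period = c.base := c.periodic

lemma alive_point (c : LimitCycle R) {s t : ℝ} (hs : 0 ≤ s) (ht : 0 ≤ t) :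
    R.Alive t (c.point s) :=
  ((R.alive_add s t c.base hs ht).1 (c.alive_base (by positivity))).2

lemma map_point (c : LimitCycle R) {s t : ℝ} (hs : 0 ≤ s) (ht : 0 ≤ t) :
    R.map t (c.point s) = c.point (s + t) :=
  ((c.alive_base hs).map_add (c.alive_point hs ht)).symm

lemma point_add_nat_mul (c : LimitCycle R) {s : ℝ} (hs : 0 ≤ s) (k : ℕ) :
    c.point (k * c.period + s) = c.point s := by
  have h := c.period_pos.le
  rw [← c.map_point (by positivity) hs]
  change R.map s (R.map _ _) = _
  rw [(c.alive_nat_mul k).2]; rfl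

lemma point_period_add (c : LimitCycle R) {s : ℝ} (hs : 0 ≤ s) :
    c.point (c.period + s) = c.point s := by
  simpa using c.point_add_nat_mul hs 1

lemma point_mem_orbit (c : LimitCycle R) {s : ℝ} (hs : 0 ≤ s) : c.point s ∈ c.orbit := by
  have hp := c.period_pos
  set k := ⌊s / c.period⌋₊
  have h1 : (k : ℝ) ≤ s / c.period := Nat.floor_le (by positivity)
  have h2 : s / c.period < k + 1 := Nat.lt_floor_add_one _
  rw [le_div_iff₀ hp] at h1
  rw [div_lt_iff₀ hp] at h2
  refine ⟨s - k * c.period, ⟨by linarith, by linarith⟩, ?_⟩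
  rw [← c.point_add_nat_mul (by linarith) k]; congr 1; ring

lemma orbit_nonempty (c : LimitCycle R) : c.orbit.Nonempty := ⟨_, c.point_mem_orbit le_rfl⟩

lemma distTo_le (c : LimitCycle R) {q : Γ} (hq : q ∈ c.orbit) (U : Γ) : c.distTo U ≤ ‖U - q‖ := by
  rw [← dist_eq_norm]; exact infDist_le_dist_of_mem hq

lemma distTo_of_mem (c : LimitCycle R) {q : Γ} (hq : q ∈ c.orbit) : c.distTo q = 0 :=
  infDist_zero_of_mem hq

lemma distTo_nonneg (c : LimitCycle R) (U : Γ) : 0 ≤ c.distTo U := infDist_nonneg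

lemma exists_near_of_distTo_lt (c : LimitCycle R) {U : Γ} {r : ℝ} (h : c.distTo U < r) :
    ∃ s ∈ Icc 0 c.period, ‖U - c.point s‖ < r := by
  obtain ⟨q, ⟨s, hs, rfl⟩, hq⟩ := (infDist_lt_iff c.orbit_nonempty).1 h
  exact ⟨s, hs, by rwa [← dist_eq_norm]⟩

lemma isOpen_tube (c : LimitCycle R) (δ : ℝ) : IsOpen {U | c.distTo U < δ} :=
  isOpen_lt (continuous_infDist_pt _) continuous_const

lemma ball_subset_tube (c : LimitCycle R) (δ : ℝ) {q : Γ} (hq : q ∈ c.orbit) :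
    ball q δ ⊆ {U | c.distTo U < δ} := fun U hU =>
  (c.distTo_le hq U).trans_lt (by rwa [← dist_eq_norm])

/-- The data of `SmoothNear`. -/
structure SmoothData (c : LimitCycle R) (δ : ℝ) (f' : ℝ × Γ → ℝ × Γ →L[ℝ] Γ) (K : NNReal) :
    Prop where
  pos : 0 < δ
  alive : ∀ U, c.distTo U < δ → ∀ s ∈ Icc 0 δ, R.Alive s U
  hasDeriv : ∀ x ∈ Icc 0 δ ×ˢ {U | c.distTo U < δ},
    HasFDerivWithinAt (fun p : ℝ × Γ => R.map p.1 p.2) (f' x) (Icc 0 δ ×ˢ {U | c.distTo U < δ}) x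
  lipschitz : LipschitzOnWith K f' (Icc 0 δ ×ˢ {U | c.distTo U < δ})

lemma SmoothNear.exists_data (h : c.SmoothNear) : ∃ δ f' K, c.SmoothData δ f' K := by
  obtain ⟨δ, hδ, ha, f', hf, K, hK⟩ := h
  exact ⟨δ, f', K, hδ, ha, hf, hK⟩

namespace SmoothData

variable {δ : ℝ} {f' : ℝ × Γ → ℝ × Γ →L[ℝ] Γ} {K : NNReal} (H : c.SmoothData δ f' K)

include H

lemma mem_tube {q : Γ} (hq : q ∈ c.orbit) : c.distTo q < δ := by
  rw [c.distTo_of_mem hq]; exact H.pos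

lemma hasFDerivAt_map {s : ℝ} (hs : s ∈ Icc 0 δ) {U : Γ} (hU : c.distTo U < δ) :
    HasFDerivAt (R.map s) ((f' (s, U)).comp (ContinuousLinearMap.inr ℝ ℝ Γ)) U := by
  have h1 := H.hasDeriv (s, U) ⟨hs, hU⟩
  have h2 : HasFDerivWithinAt (fun V : Γ => (s, V)) (ContinuousLinearMap.inr ℝ ℝ Γ)
      {U | c.distTo U < δ} U := (hasFDerivAt_prodMk_right s U).hasFDerivWithinAt
  exact (h1.comp U h2 fun V hV => ⟨hs, hV⟩).hasFDerivAt ((c.isOpen_tube δ).mem_nhds hU)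

lemma tangentMap_eq {s : ℝ} (hs : s ∈ Icc 0 δ) {U : Γ} (hU : c.distTo U < δ) :
    R.tangentMap s U = (f' (s, U)).comp (ContinuousLinearMap.inr ℝ ℝ Γ) :=
  (H.hasFDerivAt_map hs hU).fderiv

lemma tangentMap_apply {s : ℝ} (hs : s ∈ Icc 0 δ) {U : Γ} (hU : c.distTo U < δ) (F : Γ) :
    R.tangentMap s U F = f' (s, U) (0, F) := by
  rw [H.tangentMap_eq hs hU]; rfl

lemma hasDerivWithinAt_time {s : ℝ} (hs : s ∈ Icc 0 δ) {U : Γ} (hU : c.distTo U < δ) :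
    HasDerivWithinAt (fun t => R.map t U) (f' (s, U) (1, 0)) (Icc 0 δ) s := by
  have h1 := H.hasDeriv (s, U) ⟨hs, hU⟩
  have h2 : HasFDerivWithinAt (fun t : ℝ => (t, U)) (ContinuousLinearMap.inl ℝ ℝ Γ)
      (Icc 0 δ) s := (hasFDerivAt_prodMk_left s U).hasFDerivWithinAt
  have hm : MapsTo (fun t : ℝ => (t, U)) (Icc 0 δ) (Icc 0 δ ×ˢ {U | c.distTo U < δ}) :=
    fun t ht => ⟨ht, hU⟩
  exact (HasFDerivWithinAt.comp (f := fun t : ℝ => (t, U)) s h1 h2 hm).hasDerivWithinAt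

/-- Regularity in time is available only for times in [0, δ]. Restarting from a cycle point about
δ/2 earlier covers a neighbourhood of `s` in [0, ∞). -/
lemma continuousOn_point : ContinuousOn c.point (Ici 0) := by
  have hδ := H.pos
  intro s hs
  have hs : 0 ≤ s := hs
  set a := max (s - δ / 2) 0 with ha
  have ha0 : 0 ≤ a := le_max_right _ _
  have has : a ≤ s := max_le (by linarith) hs
  have hsa : s - δ / 2 ≤ a := le_max_left _ _
  have h1 := (H.hasDerivWithinAt_time (s := s - a) (U := c.point a) ⟨by linarith, by linarith⟩
    (H.mem_tube (c.point_mem_orbit ha0))).continuousWithinAt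
  have h2 : ContinuousWithinAt (fun u => R.map (u - a) (c.point a)) (Icc a (a + δ)) s :=
    h1.comp (f := fun u => u - a) (by fun_prop)
      fun u hu => ⟨by linarith [hu.1], by linarith [hu.2]⟩
  have h3 : ContinuousWithinAt c.point (Icc a (a + δ)) s := by
    refine h2.congr (fun u hu => ?_) ?_
    · rw [c.map_point ha0 (by linarith [hu.1])]; congr 1; ring
    · rw [c.map_point ha0 (by linarith)]; congr 1; ring
  refine h3.mono_of_mem_nhdsWithin ?_
  rcases le_total (s - δ / 2) 0 with h | h
  · have e : a = 0 := max_eq_right h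
    filter_upwards [self_mem_nhdsWithin,
      nhdsWithin_le_nhds (Iio_mem_nhds (show s < a + δ by linarith))] with u hu hu2
    exact ⟨e ▸ hu, hu2.le⟩
  · have e : a = s - δ / 2 := max_eq_left h
    refine nhdsWithin_le_nhds (Icc_mem_nhds (by linarith) (by linarith))

lemma isCompact_orbit : IsCompact c.orbit :=
  isCompact_Icc.image_of_continuousOn (H.continuousOn_point.mono fun _ h => h.1)

/-- Compactness of the cycle, with the Lipschitz continuity of `f'`, makes all later constants
uniform along the orbit. -/
lemma exists_bound : ∃ B : ℝ, ∀ s ∈ Icc 0 δ, ∀ q ∈ c.orbit, ‖f' (s, q)‖ ≤ B := by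
  have hsub : Icc 0 δ ×ˢ c.orbit ⊆ Icc 0 δ ×ˢ {U | c.distTo U < δ} :=
    prod_mono le_rfl fun q hq => H.mem_tube hq
  obtain ⟨B, hB⟩ := (isCompact_Icc.prod H.isCompact_orbit).exists_bound_of_continuousOn
    (H.lipschitz.continuousOn.mono hsub)
  exact ⟨B, fun s hs q hq => hB (s, q) ⟨hs, hq⟩⟩

lemma quad {s t t' : ℝ} (hs : s ∈ Icc 0 δ) (ht : t ∈ Icc 0 δ) (ht' : t' ∈ Icc 0 δ) {q : Γ}
    (hq : q ∈ c.orbit) {U U' : Γ} (hU : U ∈ ball q δ) (hU' : U' ∈ ball q δ) :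
    ‖R.map t U - R.map t' U' - f' (s, q) (t - t', U - U')‖ ≤
      K * max ‖(t - s, U - q)‖ ‖(t' - s, U' - q)‖ * ‖(t - t', U - U')‖ := by
  have hsub : Icc 0 δ ×ˢ ball q δ ⊆ Icc 0 δ ×ˢ {U | c.distTo U < δ} :=
    prod_mono le_rfl (c.ball_subset_tube δ hq)
  exact QuadAt.of_isC11On (x₀ := (s, q)) (x := (t, U)) (y := (t', U')) H.hasDeriv H.lipschitz
    ((convex_Icc _ _).prod (convex_ball _ _)) hsub ⟨hs, mem_ball_self H.pos⟩ ⟨ht, hU⟩ ⟨ht', hU'⟩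

/-- Uniform regularity for short times along the orbit. -/
lemma exists_quadAt_short : ∃ C : ℝ, ∀ s ∈ Icc 0 δ, ∀ q ∈ c.orbit,
    (∀ U, ‖U - q‖ ≤ C⁻¹ → c.distTo U < δ) ∧ QuadAt (R.map s) (R.tangentMap s q) q C := by
  obtain ⟨B, hB⟩ := H.exists_bound
  have hδ := H.pos
  set C := max (max 1 B) (max K (2 / δ))
  have h1 : 1 ≤ C := (le_max_left _ _).trans (le_max_left _ _)
  have h2 : B ≤ C := (le_max_right _ _).trans (le_max_left _ _)
  have h3 : (K : ℝ) ≤ C := (le_max_left _ _).trans (le_max_right _ _)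
  have h4 : 2 / δ ≤ C := (le_max_right _ _).trans (le_max_right _ _)
  have h5 : C⁻¹ < δ := by
    have : C⁻¹ ≤ (2 / δ)⁻¹ := inv_anti₀ (by positivity) h4
    rw [inv_div] at this
    linarith
  have hball : ∀ q U : Γ, ‖U - q‖ ≤ C⁻¹ → U ∈ ball q δ := fun q U hU => by
    rw [mem_ball, dist_eq_norm]; linarith
  refine ⟨C, fun s hs q hq => ⟨fun U hU => c.ball_subset_tube δ hq (hball q U hU), h1, ?_, ?_⟩⟩
  · refine ContinuousLinearMap.opNorm_le_bound _ (by linarith) fun F => ?_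
    rw [H.tangentMap_apply hs (H.mem_tube hq)]
    refine ((f' (s, q)).le_opNorm _).trans ?_
    have : ‖((0 : ℝ), F)‖ = ‖F‖ := by simp [Prod.norm_def]
    rw [this]
    gcongr
    exact (hB s hs q hq).trans h2
  · intro U U' hU hU'
    have := H.quad hs hs hs hq (hball q U hU) (hball q U' hU')
    rw [H.tangentMap_apply hs (H.mem_tube hq)]
    simp only [sub_self, Prod.norm_def, norm_zero, norm_nonneg, sup_of_le_right] at this
    refine this.trans ?_
    gcongr

/-- The tangent map is the identity at s = 0 and moves by at most K s, so a Neumann series inverts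
it. Surjectivity is used in `exists_section` to write displacements as images of the tangent map. -/
lemma exists_surjective_short [CompleteSpace Γ] : ∃ δ₁ > 0, δ₁ ≤ δ ∧ ∀ s ∈ Icc 0 δ₁, ∀ q ∈ c.orbit,
    Function.Surjective (R.tangentMap s q) := by
  have hδ := H.pos
  have hK : (0 : ℝ) ≤ K := K.2
  refine ⟨min δ (2 * (K + 1))⁻¹, by positivity, min_le_left _ _, fun s hs q hq => ?_⟩
  have hs' : s ∈ Icc 0 δ := ⟨hs.1, hs.2.trans (min_le_left _ _)⟩
  have hs2 : s ≤ (2 * (K + 1 : ℝ))⁻¹ := hs.2.trans (min_le_right _ _)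
  have hlt : ‖(1 : Γ →L[ℝ] Γ) - R.tangentMap s q‖ < 1 := by
    refine lt_of_le_of_lt (b := (K : ℝ) * s) ?_ ?_
    · refine ContinuousLinearMap.opNorm_le_bound _ (mul_nonneg hK hs.1) fun F => ?_
      have h0 : (0 : ℝ) ∈ Icc 0 δ := ⟨le_rfl, hδ.le⟩
      have e : ((1 : Γ →L[ℝ] Γ) - R.tangentMap s q) F = (f' (0, q) - f' (s, q)) (0, F) := by
        have h1 := H.tangentMap_apply h0 (H.mem_tube hq) F
        rw [R.tangentMap_zero] at h1
        have h2 := H.tangentMap_apply hs' (H.mem_tube hq) F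
        simp only [FunLike.coe_sub, Pi.sub_apply, one_apply_eq_self]
        rw [← h1, ← h2]; rfl
      rw [e]
      refine ((f' (0, q) - f' (s, q)).le_opNorm _).trans ?_
      have h3 : ‖((0 : ℝ), F)‖ = ‖F‖ := by simp [Prod.norm_def]
      rw [h3]
      have h4 := H.lipschitz.norm_sub_le (x := (0, q)) ⟨h0, H.mem_tube hq⟩ (y := (s, q))
        ⟨hs', H.mem_tube hq⟩
      have h5 : ‖((0 : ℝ), q) - (s, q)‖ = s := by
        simp [Prod.norm_def, abs_of_nonneg hs.1, hs.1]
      rw [h5] at h4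
      gcongr
    · have : (K : ℝ) * s ≤ K * (2 * (K + 1 : ℝ))⁻¹ := by gcongr
      refine this.trans_lt ?_
      rw [← div_eq_mul_inv, div_lt_one (by positivity)]
      linarith
  have hu := isUnit_one_sub_of_norm_lt_one hlt
  rw [sub_sub_cancel] at hu
  obtain ⟨u, hu⟩ := hu
  intro F
  refine ⟨(↑u⁻¹ : Γ →L[ℝ] Γ) F, ?_⟩
  rw [← hu, ← mul_apply_eq_comp, Units.mul_inv]; rfl

end SmoothData

end LimitCycle

/-! ### Uniform regularity over bounded times. -/

namespace LimitCycle

variable {Γ : Type*} [NormedAddCommGroup Γ] [NormedSpace ℝ Γ] {n : ℕ} {R : RGFlow Γ n}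
  {c : LimitCycle R}

lemma map_mem_orbit (c : LimitCycle R) {q : Γ} (hq : q ∈ c.orbit) {t : ℝ} (ht : 0 ≤ t) :
    R.map t q ∈ c.orbit := by
  obtain ⟨s, hs, rfl⟩ := hq
  rw [c.map_point hs.1 ht]
  exact c.point_mem_orbit (add_nonneg hs.1 ht)

/-- Regularity of `R_s` at the points of the limit cycle, with a constant uniform for
`s ∈ [0, S]`. -/
def UniformQuad (c : LimitCycle R) (S C : ℝ) : Prop :=
  ∀ s ∈ Icc 0 S, ∀ q ∈ c.orbit, (∀ U, ‖U - q‖ ≤ C⁻¹ → R.Alive s U) ∧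
    QuadAt (R.map s) (R.tangentMap s q) q C ∧ Function.Surjective (R.tangentMap s q)

lemma UniformQuad.one_le {S C : ℝ} (h : c.UniformQuad S C) (hS : 0 ≤ S) : 1 ≤ C :=
  (h 0 ⟨le_rfl, hS⟩ c.base (c.point_zero ▸ c.point_mem_orbit le_rfl)).2.1.one_le

lemma UniformQuad.mono {S C S' C' : ℝ} (h : c.UniformQuad S C) (hS : S' ≤ S) (hC : C ≤ C') :
    c.UniformQuad S' C' := by
  intro s hs q hq
  have hs' : s ∈ Icc 0 S := ⟨hs.1, hs.2.trans hS⟩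
  obtain ⟨h1, h2, h3⟩ := h s hs' q hq
  have := h2.one_le
  exact ⟨fun U hU => h1 U (hU.trans (inv_anti₀ (by linarith) hC)), h2.mono hC, h3⟩

lemma UniformQuad.add {S S' C : ℝ} (h : c.UniformQuad S C) (h' : c.UniformQuad S' C)
    (hS : 0 ≤ S) (hS' : 0 ≤ S') : c.UniformQuad (S + S') (QuadAt.compConst C) := by
  intro u hu q hq
  obtain ⟨s, t, hs, ht, rfl⟩ : ∃ s t, s ∈ Icc 0 S ∧ t ∈ Icc 0 S' ∧ s + t = u := by
    rcases le_total u S with hle | hle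
    · exact ⟨u, 0, ⟨hu.1, hle⟩, ⟨le_rfl, hS'⟩, add_zero u⟩
    · exact ⟨S, u - S, ⟨hS, le_rfl⟩, ⟨by linarith, by linarith [hu.2]⟩, by ring⟩
  obtain ⟨a1, a2, a3⟩ := h s hs q hq
  obtain ⟨b1, b2, b3⟩ := h' t ht (R.map s q) (c.map_mem_orbit hq hs.1)
  have hal : ∀ U, ‖U - q‖ ≤ (QuadAt.compConst C)⁻¹ → R.Alive s U ∧ R.Alive t (R.map s U) := by
    intro U hU
    obtain ⟨e1, e2⟩ := a2.comp_ball hU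
    exact ⟨a1 U e1, b1 _ e2⟩
  have hQ := (b2.comp a2).congr (g := R.map (s + t)) fun U hU =>
    (hal U hU).1.map_add (hal U hU).2
  have e : R.tangentMap (s + t) q = (R.tangentMap t (R.map s q)).comp (R.tangentMap s q) :=
    hQ.hasFDerivAt.fderiv
  refine ⟨fun U hU => (hal U hU).1.add (hal U hU).2, e ▸ hQ, ?_⟩
  rw [e]
  exact b3.comp a3

namespace SmoothData

variable {δ : ℝ} {f' : ℝ × Γ → ℝ × Γ →L[ℝ] Γ} {K : NNReal}

/-- Finitely many short steps of length δ₁ are concatenated by the semigroup property. Each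
preserves the cycle, so the short-time estimate applies again after every step. -/
lemma exists_uniformQuad [CompleteSpace Γ] (H : c.SmoothData δ f' K) (S : ℝ) :
    ∃ C, c.UniformQuad S C := by
  obtain ⟨C₀, hC₀⟩ := H.exists_quadAt_short
  obtain ⟨δ₁, hδ₁, hδ₁δ, hsurj⟩ := H.exists_surjective_short
  have hbase : c.UniformQuad δ₁ C₀ := fun s hs q hq => by
    have hs' : s ∈ Icc 0 δ := ⟨hs.1, hs.2.trans hδ₁δ⟩
    exact ⟨fun U hU => H.alive U ((hC₀ s hs' q hq).1 U hU) s hs', (hC₀ s hs' q hq).2,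
      hsurj s hs q hq⟩
  have hn : ∀ k : ℕ, ∃ C, c.UniformQuad ((k + 1) * δ₁) C := by
    intro k
    induction k with
    | zero => exact ⟨C₀, by simpa using hbase⟩
    | succ k ih =>
      obtain ⟨C, hC⟩ := ih
      have hk : 0 ≤ ((k : ℝ) + 1) * δ₁ := by positivity
      refine ⟨QuadAt.compConst (max C C₀), ?_⟩
      have := (hC.mono le_rfl (le_max_left C C₀)).add (hbase.mono le_rfl (le_max_right C C₀))
        hk hδ₁.le
      convert this using 1
      push_cast; ring
  obtain ⟨k, hk⟩ := exists_nat_ge (S / δ₁)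
  rw [div_le_iff₀ hδ₁] at hk
  obtain ⟨C, hC⟩ := hn k
  exact ⟨C, hC.mono (by nlinarith) le_rfl⟩

lemma hasDerivWithinAt_point_zero (H : c.SmoothData δ f' K) : HasDerivWithinAt c.point c.tangent (Ici 0) 0 := by
  have h := H.hasDerivWithinAt_time (s := 0) ⟨le_rfl, H.pos.le⟩ (H.mem_tube (c.point_mem_orbit le_rfl))
  rw [c.point_zero] at h
  have h2 : HasDerivWithinAt c.point _ (Ici 0) 0 :=
    HasDerivWithinAt.mono_of_mem_nhdsWithin h (Icc_mem_nhdsGE H.pos)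
  exact h2.differentiableWithinAt.hasDerivWithinAt

variable [CompleteSpace Γ] (H : c.SmoothData δ f' K)

include H

lemma tangentMap_add {s t : ℝ} (hs : 0 ≤ s) (ht : 0 ≤ t) {q : Γ} (hq : q ∈ c.orbit) :
    R.tangentMap (s + t) q = (R.tangentMap t (R.map s q)).comp (R.tangentMap s q) := by
  obtain ⟨C, hC⟩ := H.exists_uniformQuad (s + t)
  obtain ⟨a1, a2, a3⟩ := hC s ⟨hs, by linarith⟩ q hq
  obtain ⟨b1, b2, b3⟩ := hC t ⟨ht, by linarith⟩ (R.map s q) (c.map_mem_orbit hq hs)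
  refine ((b2.comp a2).congr (g := R.map (s + t)) fun U hU => ?_).hasFDerivAt.fderiv
  obtain ⟨e1, e2⟩ := a2.comp_ball hU
  exact (a1 U e1).map_add (b1 _ e2)

lemma tangentMap_surjective {s : ℝ} (hs : 0 ≤ s) {q : Γ} (hq : q ∈ c.orbit) :
    Function.Surjective (R.tangentMap s q) := by
  obtain ⟨C, hC⟩ := H.exists_uniformQuad s
  exact (hC s ⟨hs, le_rfl⟩ q hq).2.2

/-- The velocity along the limit cycle is transported by the tangent maps. -/
lemma hasDerivWithinAt_point {s : ℝ} (hs : 0 ≤ s) :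
    HasDerivWithinAt c.point (R.tangentMap s c.base c.tangent) (Ici s) s := by
  obtain ⟨C, hC⟩ := H.exists_uniformQuad s
  have hb : c.base ∈ c.orbit := c.point_zero ▸ c.point_mem_orbit le_rfl
  have h1 := (hC s ⟨hs, le_rfl⟩ c.base hb).2.1.hasFDerivAt
  rw [← c.point_zero] at h1
  have h2 := h1.comp_hasDerivWithinAt (0 : ℝ) H.hasDerivWithinAt_point_zero
  have h3 : HasDerivWithinAt c.point (R.tangentMap s (c.point 0) c.tangent) (Ici s) s := by
    have h4 : HasDerivWithinAt (fun u => u - s) 1 (Ici s) s :=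
      ((hasDerivAt_id s).sub_const s).hasDerivWithinAt
    have h5 : HasDerivWithinAt (R.map s ∘ c.point) (R.tangentMap s (c.point 0) c.tangent)
        (Ici 0) (s - s) := by rwa [sub_self]
    have hm : MapsTo (fun u => u - s) (Ici s) (Ici 0) := fun u hu => by
      have : s ≤ u := hu
      simpa using this
    have h6 := HasDerivWithinAt.scomp (h := fun u => u - s) s h5 h4 hm
    rw [one_smul] at h6
    refine h6.congr (fun u hu => ?_) ?_
    · simp only [Function.comp]
      rw [c.map_point (sub_nonneg.2 hu) hs, sub_add_cancel]
    · simp [point, R.map_zero]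
  rwa [c.point_zero] at h3

/-- Both sides are one-sided velocities of the cycle at time a + s, and one-sided derivatives are
unique. -/
lemma time_derivative {a s : ℝ} (ha : 0 ≤ a) (hs : s ∈ Ico 0 δ) :
    f' (s, c.point a) (1, 0) = R.tangentMap (a + s) c.base c.tangent := by
  have h1 := H.hasDerivWithinAt_time (s := s) ⟨hs.1, hs.2.le⟩ (H.mem_tube (c.point_mem_orbit ha))
  have h2 : HasDerivWithinAt (fun t => R.map t (c.point a)) (f' (s, c.point a) (1, 0)) (Icc s δ) s :=
    h1.mono (Icc_subset_Icc_left hs.1)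
  have h3 := H.hasDerivWithinAt_point (add_nonneg ha hs.1)
  have h4 : HasDerivWithinAt (fun u => a + u) 1 (Icc s δ) s :=
    ((hasDerivAt_id s).const_add a).hasDerivWithinAt
  have hm : MapsTo (fun u => a + u) (Icc s δ) (Ici (a + s)) := fun u hu =>
    add_le_add_right hu.1 a
  have h5 := HasDerivWithinAt.scomp (h := fun u => a + u) s h3 h4 hm
  rw [one_smul] at h5
  have h6 : HasDerivWithinAt (fun t => R.map t (c.point a))
      (R.tangentMap (a + s) c.base c.tangent) (Icc s δ) s := by
    refine h5.congr (fun u hu => ?_) ?_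
    · exact c.map_point ha (hs.1.trans hu.1)
    · exact c.map_point ha hs.1
  exact (uniqueDiffOn_Icc hs.2 s ⟨le_rfl, hs.2.le⟩).eq_deriv _ h2 h6

/-- Stationary points keep a distance from the limit cycle. -/
lemma exists_dist_stationary : ∃ η > 0, ∀ V, (∀ s ∈ Icc 0 δ, R.map s V = V) → η ≤ c.distTo V := by
  have hδ := H.pos
  have hp := c.period_pos
  set h := min δ c.period / 2 with hh
  have h0 : 0 < h := by positivity
  have h1 : h < δ := by have := min_le_left δ c.period; linarith
  have h2 : h < c.period := by have := min_le_right δ c.period; linarith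
  have hmove : ∀ s ∈ Icc 0 c.period, 0 < ‖c.point (s + h) - c.point s‖ := by
    intro s hs
    rw [norm_pos_iff, sub_ne_zero]
    intro e
    have e2 := congrArg (R.map (c.period - s)) e
    rw [c.map_point (by linarith [hs.1]) (by linarith [hs.2]),
      c.map_point hs.1 (by linarith [hs.2]),
      show s + h + (c.period - s) = c.period + h by ring, add_sub_cancel, c.point_period_add h0.le,
      c.point_period] at e2
    exact c.fundamental h ⟨h0, h2⟩ e2
  have hcont : ContinuousOn (fun s => ‖c.point (s + h) - c.point s‖) (Icc 0 c.period) := by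
    refine ContinuousOn.norm (ContinuousOn.sub ?_ (H.continuousOn_point.mono fun s hs => hs.1))
    exact H.continuousOn_point.comp (f := fun s => s + h) (by fun_prop)
      fun s hs => add_nonneg hs.1 h0.le
  obtain ⟨s₀, hs₀, hmin⟩ := isCompact_Icc.exists_isMinOn ⟨0, le_rfl, hp.le⟩ hcont
  set m := ‖c.point (s₀ + h) - c.point s₀‖
  have hm : 0 < m := hmove s₀ hs₀
  obtain ⟨C, hC⟩ := H.exists_uniformQuad h
  have hC1 := hC.one_le h0.le
  -- A stationary `V` near `c.point s` is within (C+1)‖V - c.point s‖ of the point reached a time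
  -- `h` later, while the cycle itself moves by at least `m`; the triangle inequality gives C + 2.
  refine ⟨min C⁻¹ (m / (C + 2)), by positivity, fun V hV => ?_⟩
  by_contra hlt
  obtain ⟨s, hs, hs2⟩ := c.exists_near_of_distTo_lt (not_le.1 hlt)
  have hq := (hC h ⟨h0.le, le_rfl⟩ (c.point s) (c.point_mem_orbit hs.1)).2.1.lipschitz_center
    (hs2.le.trans (min_le_left _ _))
  rw [hV h ⟨h0.le, h1.le⟩, c.map_point hs.1 h0.le] at hq
  have h3 : m ≤ ‖c.point (s + h) - c.point s‖ := hmin hs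
  have h4 : ‖c.point (s + h) - c.point s‖ ≤ ‖V - c.point (s + h)‖ + ‖V - c.point s‖ := by
    rw [norm_sub_rev V (c.point (s + h))]
    simpa using norm_add_le (c.point (s + h) - V) (V - c.point s)
  have h5 := hs2.trans_le (min_le_right _ _)
  rw [lt_div_iff₀ (by positivity)] at h5
  nlinarith

end SmoothData

end LimitCycle

/-! ### Linear coordinates from the hyperbolic splitting. -/

namespace LimitCycle

variable {Γ : Type*} [NormedAddCommGroup Γ] [NormedSpace ℝ Γ] {n : ℕ} {R : RGFlow Γ n}
  {c : LimitCycle R}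

/-- The inclusion `(a, v) ↦ a F₁ / ‖F₁‖ + v` of the linearized section. -/
noncomputable def chart (Es : Submodule ℝ Γ) (F₁ : Γ) : ℝ × Es →L[ℝ] Γ :=
  (ContinuousLinearMap.fst ℝ ℝ Es).smulRight (‖F₁‖⁻¹ • F₁) +
    Es.subtypeL.comp (ContinuousLinearMap.snd ℝ ℝ Es)

lemma chart_apply (Es : Submodule ℝ Γ) (F₁ : Γ) (x : ℝ × Es) :
    chart Es F₁ x = x.1 • (‖F₁‖⁻¹ • F₁) + x.2 := rfl

lemma norm_chart_le (Es : Submodule ℝ Γ) {F₁ : Γ} (hF : F₁ ≠ 0) (x : ℝ × Es) :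
    ‖chart Es F₁ x‖ ≤ 2 * ‖x‖ := by
  rw [chart_apply]
  refine (norm_add_le _ _).trans ?_
  have h1 : ‖x.1 • (‖F₁‖⁻¹ • F₁)‖ = ‖x.1‖ := by
    rw [norm_smul, norm_smul, norm_inv, norm_norm, inv_mul_cancel₀ (norm_ne_zero_iff.2 hF), mul_one]
  have h2 : ‖(x.2 : Γ)‖ ≤ ‖x‖ := norm_snd_le x
  have h3 := norm_fst_le x
  linarith

/-- Linear coordinates adapted to the hyperbolic splitting in the case of one relevant mode: `pr`
gives the components along `F₁` and in `Eˢ`, and `ℓ` the component along `F₀`. -/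
structure Coordinates (c : LimitCycle R) (Eu Es : Submodule ℝ Γ) (F₁ : Γ) (μ lam : ℝ)
    (pr : Γ →L[ℝ] ℝ × Es) (ℓ : Γ →L[ℝ] ℝ) : Prop where
  ne_zero : F₁ ≠ 0
  one_lt : 1 < μ
  lam_nonneg : 0 ≤ lam
  lam_lt : lam < 1
  decomp : ∀ W, W = chart Es F₁ (pr W) + ℓ W • c.tangent
  pr_chart : ∀ x, pr (chart Es F₁ x) = x
  ℓ_chart : ∀ x, ℓ (chart Es F₁ x) = 0
  pr_tangent : pr c.tangent = 0
  ℓ_tangent : ℓ c.tangent = 1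
  mem_iff : ∀ W, W ∈ Eu ⊔ Es ↔ ℓ W = 0
  ℓ_monodromy : ∀ W, ℓ (c.monodromy W) = ℓ W
  monodromy_tangent : c.monodromy c.tangent = c.tangent
  monodromy_mode : c.monodromy F₁ = μ • F₁
  fst_monodromy : ∀ x, (pr (c.monodromy (chart Es F₁ x))).1 = μ * x.1
  snd_monodromy : ∀ x, ‖(pr (c.monodromy (chart Es F₁ x))).2‖ ≤ lam * ‖x.2‖

/-- The splitting is only algebraic, so continuity of the projections has to be shown. Contraction
persists on the closure of Eˢ and excludes components along F₁ and F₀; hence Eˢ is closed and the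
open mapping theorem applies. Positivity of κ comes from the unstable rate tested on F₁. -/
lemma exists_coordinates [CompleteSpace Γ] {Eu Es : Submodule ℝ Γ} {N : ℕ} {F₁ : Γ} {κ : ℝ}
    (hsplit : c.HyperbolicSplitting Eu Es N) (hrel : c.UniqueRelevantMode Eu N F₁ κ) :
    0 < κ ∧ ∃ lam pr ℓ, c.Coordinates Eu Es F₁ (Real.exp (κ * c.period)) lam pr ℓ := by
  obtain ⟨κb, hκb, hu, hs⟩ := hsplit.rates
  have hp := c.period_pos
  set T := c.monodromy with hT
  set μ := Real.exp (κ * c.period) with hμdef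
  set lam := Real.exp (-κb * c.period) with hlam
  have hF1 := hrel.ne_zero
  have hF0 := hsplit.tangent_ne_zero
  have hlam0 : 0 < lam := Real.exp_pos _
  have hlam1 : lam < 1 := by rw [hlam, Real.exp_lt_one_iff]; nlinarith
  have hF1u : F₁ ∈ Eu := by rw [hrel.span_eq]; exact Submodule.mem_span_singleton_self _
  have hκ : κb ≤ κ := by
    have h1 := hu F₁ hF1u
    rw [hrel.map_eq, norm_smul, Real.norm_of_nonneg (Real.exp_pos _).le] at h1
    have h2 := le_of_mul_le_mul_right h1 (norm_pos_iff.2 hF1)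
    have h3 := Real.exp_le_exp.1 h2
    exact le_of_mul_le_mul_right h3 hp
  have hκ0 : 0 < κ := hκb.trans_le hκ
  have hμ1 : 1 < μ := Real.one_lt_exp_iff.2 (by positivity)
  -- independence and spanning
  obtain ⟨hind, htop⟩ :=
    (DirectSum.isInternal_submodule_iff_iSupIndep_and_iSup_eq_top _).1 hsplit.isInternal
  have hd0 : Disjoint Eu (Submodule.span ℝ {c.tangent} ⊔ Es) := by
    refine (hind 0).mono_right (sup_le ?_ ?_)
    · exact le_iSup₂_of_le (f := fun (j : Fin 3) (_ : j ≠ 0) =>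
        (![Eu, Submodule.span ℝ {c.tangent}, Es] j)) 1 (by decide) le_rfl
    · exact le_iSup₂_of_le (f := fun (j : Fin 3) (_ : j ≠ 0) =>
        (![Eu, Submodule.span ℝ {c.tangent}, Es] j)) 2 (by decide) le_rfl
  have hd1 : Disjoint (Submodule.span ℝ {c.tangent}) Es := by
    refine (hind 1).mono_right ?_
    exact le_iSup₂_of_le (f := fun (j : Fin 3) (_ : j ≠ 1) =>
        (![Eu, Submodule.span ℝ {c.tangent}, Es] j)) 2 (by decide) le_rfl
  have hsup : ∀ W : Γ, ∃ (a t : ℝ), ∃ v ∈ Es, W = a • F₁ + t • c.tangent + v := by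
    have hle : (⊤ : Submodule ℝ Γ) ≤ Eu ⊔ (Submodule.span ℝ {c.tangent} ⊔ Es) := by
      rw [← htop]
      refine iSup_le fun i => ?_
      fin_cases i
      · exact le_sup_left
      · exact le_sup_left.trans le_sup_right
      · exact le_sup_right.trans le_sup_right
    intro W
    obtain ⟨u, hu, w, hw, rfl⟩ := Submodule.mem_sup.1 (hle (Submodule.mem_top : W ∈ ⊤))
    obtain ⟨t, ht, v, hv, rfl⟩ := Submodule.mem_sup.1 hw
    rw [hrel.span_eq] at hu
    obtain ⟨a, rfl⟩ := Submodule.mem_span_singleton.1 hu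
    obtain ⟨t, rfl⟩ := Submodule.mem_span_singleton.1 ht
    exact ⟨a, t, v, hv, by abel⟩
  have huniq : ∀ (a t : ℝ), ∀ v ∈ Es, a • F₁ + v + t • c.tangent = 0 → a = 0 ∧ v = 0 ∧ t = 0 := by
    intro a t v hv h
    have h1 : a • F₁ ∈ Eu := Eu.smul_mem _ hF1u
    have h2 : a • F₁ = (-t) • c.tangent + -v := by
      rw [← sub_eq_zero, ← h]; module
    have h3 : a • F₁ ∈ Submodule.span ℝ {c.tangent} ⊔ Es := by
      rw [h2]
      exact Submodule.add_mem_sup (Submodule.smul_mem _ _ (Submodule.mem_span_singleton_self _))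
        (Es.neg_mem hv)
    have h4 := Submodule.disjoint_def.1 hd0 _ h1 h3
    have h5 : v = (-t) • c.tangent := by
      rw [h4] at h2
      rw [← sub_eq_zero, ← neg_eq_zero, h2]; abel
    have h6 : v ∈ Submodule.span ℝ {c.tangent} := by
      rw [h5]; exact Submodule.smul_mem _ _ (Submodule.mem_span_singleton_self _)
    have h7 := Submodule.disjoint_def.1 hd1 _ h6 hv
    rw [h7, eq_comm, smul_eq_zero] at h5
    exact ⟨(smul_eq_zero.1 h4).resolve_right hF1, h7, neg_eq_zero.1 (h5.resolve_right hF0)⟩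
  -- the stable subspace is closed
  have hclosed : IsClosed (Es : Set Γ) := by
    have hTc : ∀ y ∈ Es.topologicalClosure, T y ∈ Es.topologicalClosure ∧ ‖T y‖ ≤ lam * ‖y‖ := by
      intro y hy
      have hy' : y ∈ closure (Es : Set Γ) := hy
      constructor
      · exact map_mem_closure T.continuous hy' fun v hv => hsplit.map_stable v hv
      · exact closure_minimal (s := (Es : Set Γ)) (t := {y | ‖T y‖ ≤ lam * ‖y‖}) (fun v hv => hs v hv)
          (isClosed_le T.continuous.norm (continuous_const.mul continuous_norm)) hy'
    refine isClosed_of_closure_subset fun y hy => ?_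
    obtain ⟨a, t, v, hv, rfl⟩ := hsup y
    have h1 : a • F₁ + t • c.tangent ∈ Es.topologicalClosure := by
      have := Es.topologicalClosure.sub_mem hy (Es.le_topologicalClosure hv)
      simpa using this
    -- Subtracting the vector from its image under `T` removes the fixed F₀ component.
    have h2 : (a * (μ - 1)) • F₁ ∈ Es.topologicalClosure := by
      have := Es.topologicalClosure.sub_mem (hTc _ h1).1 h1
      rw [map_add, map_smul, map_smul, hrel.map_eq, hsplit.map_tangent] at this
      convert this using 1
      module
    have ha : a = 0 := by
      by_contra ha
      have hne : a * (μ - 1) ≠ 0 := mul_ne_zero ha (by linarith)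
      have h3 : F₁ ∈ Es.topologicalClosure := by
        have := Es.topologicalClosure.smul_mem (a * (μ - 1))⁻¹ h2
        rwa [smul_smul, inv_mul_cancel₀ hne, one_smul] at this
      have h4 := (hTc _ h3).2
      rw [hrel.map_eq, norm_smul, Real.norm_of_nonneg (Real.exp_pos _).le] at h4
      have := le_of_mul_le_mul_right h4 (norm_pos_iff.2 hF1)
      linarith
    have ht : t = 0 := by
      by_contra ht
      have h4 := (hTc _ h1).2
      rw [ha, zero_smul, zero_add, map_smul, hsplit.map_tangent] at h4
      have : 0 < ‖t • c.tangent‖ := norm_pos_iff.2 (smul_ne_zero ht hF0)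
      nlinarith
    simpa [ha, ht] using hv
  have : CompleteSpace Es := hclosed.completeSpace_coe
  -- the coordinates
  let ψ : (ℝ × Es) × ℝ →L[ℝ] Γ := (chart Es F₁).comp (ContinuousLinearMap.fst ℝ (ℝ × Es) ℝ) +
    (ContinuousLinearMap.snd ℝ (ℝ × Es) ℝ).smulRight c.tangent
  have hψ : ∀ x t, ψ (x, t) = chart Es F₁ x + t • c.tangent := fun x t => rfl
  have hn : ‖F₁‖ ≠ 0 := norm_ne_zero_iff.2 hF1
  have hinj : LinearMap.ker (ψ : (ℝ × Es) × ℝ →ₗ[ℝ] Γ) = ⊥ := by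
    rw [LinearMap.ker_eq_bot']
    rintro ⟨⟨a, v⟩, t⟩ h
    have h : ψ ((a, v), t) = 0 := h
    rw [hψ, chart_apply, smul_smul] at h
    obtain ⟨h1, h2, h3⟩ := huniq _ _ _ v.2 h
    have h4 : a = 0 := (mul_eq_zero.1 h1).resolve_right (inv_ne_zero hn)
    have h5 : v = 0 := Subtype.ext h2
    rw [h3, h4, h5]; rfl
  have hsurj : LinearMap.range (ψ : (ℝ × Es) × ℝ →ₗ[ℝ] Γ) = ⊤ := by
    rw [LinearMap.range_eq_top]
    intro W
    obtain ⟨a, t, v, hv, rfl⟩ := hsup W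
    refine ⟨((a * ‖F₁‖, ⟨v, hv⟩), t), ?_⟩
    change ψ _ = _
    rw [hψ, chart_apply, smul_smul, mul_assoc, mul_inv_cancel₀ hn, mul_one]
    abel
  let e := ContinuousLinearEquiv.ofBijective ψ hinj hsurj
  have he : ∀ x t, e (x, t) = chart Es F₁ x + t • c.tangent := fun x t => rfl
  have hes : ∀ x t, e.symm (chart Es F₁ x + t • c.tangent) = (x, t) := fun x t => by
    rw [← he, e.symm_apply_apply]
  have hes1 : ∀ x, e.symm (chart Es F₁ x) = (x, 0) := fun x => by simpa using hes x 0
  let pr : Γ →L[ℝ] ℝ × Es :=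
    (ContinuousLinearMap.fst ℝ (ℝ × Es) ℝ).comp (e.symm : Γ →L[ℝ] (ℝ × Es) × ℝ)
  let ℓ : Γ →L[ℝ] ℝ :=
    (ContinuousLinearMap.snd ℝ (ℝ × Es) ℝ).comp (e.symm : Γ →L[ℝ] (ℝ × Es) × ℝ)
  have hpr : ∀ W, pr W = (e.symm W).1 := fun W => rfl
  have hℓ : ∀ W, ℓ W = (e.symm W).2 := fun W => rfl
  have hdec : ∀ W, W = chart Es F₁ (pr W) + ℓ W • c.tangent := fun W =>
    (e.apply_symm_apply W).symm
  have htan : e.symm c.tangent = (0, 1) := by simpa using hes 0 1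
  have hTch : ∀ x, T (chart Es F₁ x) =
      chart Es F₁ (μ * x.1, ⟨T x.2, hsplit.map_stable _ x.2.2⟩) := by
    intro x
    rw [chart_apply, chart_apply, map_add, map_smul, map_smul, hrel.map_eq]
    module
  have hT1 : ∀ x, e.symm (T (chart Es F₁ x)) =
      ((μ * x.1, ⟨T x.2, hsplit.map_stable _ x.2.2⟩), 0) := fun x => by rw [hTch, hes1]
  refine ⟨hκ0, lam, pr, ℓ, ⟨hF1, hμ1, hlam0.le, hlam1, hdec, ?_, ?_, ?_, ?_, ?_, ?_,
    hsplit.map_tangent, hrel.map_eq, ?_, ?_⟩⟩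
  · intro x; rw [hpr, hes1]
  · intro x; rw [hℓ, hes1]
  · rw [hpr, htan]
  · rw [hℓ, htan]
  · intro W
    constructor
    · intro hW
      obtain ⟨u, hu, v, hv, rfl⟩ := Submodule.mem_sup.1 hW
      rw [hrel.span_eq] at hu
      obtain ⟨a, rfl⟩ := Submodule.mem_span_singleton.1 hu
      have : a • F₁ + v = chart Es F₁ (a * ‖F₁‖, ⟨v, hv⟩) := by
        rw [chart_apply, smul_smul, mul_assoc, mul_inv_cancel₀ hn, mul_one]
      rw [this, hℓ, hes1]
    · intro hW
      rw [hdec W, hW, zero_smul, add_zero, chart_apply]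
      exact Submodule.add_mem_sup (Eu.smul_mem _ (Eu.smul_mem _ hF1u)) (pr W).2.2
  · intro W
    change ℓ (T W) = ℓ W
    conv_lhs => rw [hdec W]
    rw [map_add, map_smul, hsplit.map_tangent, map_add, map_smul, hℓ (T _), hT1, hℓ c.tangent, htan]
    simp
  · intro x
    change (pr (T _)).1 = _
    rw [hpr, hT1]
  · intro x
    change ‖(pr (T _)).2‖ ≤ _
    rw [hpr, hT1]
    exact hs _ x.2.2

end LimitCycle

/-! ### Return maps to the Poincaré section. -/

namespace LimitCycle

variable {Γ : Type*} [NormedAddCommGroup Γ] [NormedSpace ℝ Γ] {n : ℕ} {R : RGFlow Γ n}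
  {c : LimitCycle R}

/-- `Q` maps a neighbourhood of `q` along the flow into the Poincaré section, where `x` stands for
`U_lc^{(0)} + chart x`, in a time close to `σ`. -/
structure ReturnMap (c : LimitCycle R) (Es : Submodule ℝ Γ) (F₁ : Γ) (q : Γ) (σ C : ℝ)
    (L : Γ →L[ℝ] ℝ × Es) (Q : Γ → ℝ × Es) (τ : Γ → ℝ) : Prop where
  quad : QuadAt Q L q C
  center : Q q = 0
  alive : ∀ U, ‖U - q‖ ≤ C⁻¹ → R.Alive (τ U) U
  map_eq : ∀ U, ‖U - q‖ ≤ C⁻¹ → R.map (τ U) U = c.base + chart Es F₁ (Q U)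
  time_le : ∀ U, ‖U - q‖ ≤ C⁻¹ → |τ U - σ| ≤ C * ‖U - q‖

namespace SmoothData

variable {δ : ℝ} {f' : ℝ × Γ → ℝ × Γ →L[ℝ] Γ} {K : NNReal} {Eu Es : Submodule ℝ Γ} {F₁ : Γ}
  {μ lam : ℝ} {pr : Γ →L[ℝ] ℝ × Es} {ℓ : Γ →L[ℝ] ℝ}

/-- The implicit function theorem for the time at which the flow meets the section. -/
lemma exists_returnMap_short [CompleteSpace Γ] (H : c.SmoothData δ f' K)
    (co : c.Coordinates Eu Es F₁ μ lam pr ℓ) : ∃ h, 0 < h ∧ h < c.period ∧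
    ∃ C Q τ, c.ReturnMap Es F₁ (c.point (c.period - h)) h C
      (pr.comp (R.tangentMap h (c.point (c.period - h)))) Q τ := by
  have hδ := H.pos
  have hp := c.period_pos
  -- Starting at `c.point (c.period - h)` makes the hitting time `h` interior to [0, δ], so that it
  -- can be varied in both directions.
  set h := min δ c.period / 2 with hh
  have h0 : 0 < h := by positivity
  have h1 : 2 * h ≤ δ := by have := min_le_left δ c.period; linarith
  have h2 : h < c.period := by have := min_le_right δ c.period; linarith
  refine ⟨h, h0, h2, ?_⟩
  have hph : 0 ≤ c.period - h := by linarith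
  set q := c.point (c.period - h) with hq
  have hqo : q ∈ c.orbit := c.point_mem_orbit hph
  set B := R.tangentMap h q with hB
  have hmq : R.map h q = c.base := by
    rw [hq, c.map_point hph h0.le, sub_add_cancel, c.point_period]
  have hhm : h ∈ Icc 0 δ := ⟨h0.le, by linarith⟩
  have hA : ∀ t F, f' (h, q) (t, F) = t • c.tangent + B F := by
    intro t F
    have e1 : ((t, F) : ℝ × Γ) = t • ((1 : ℝ), (0 : Γ)) + ((0 : ℝ), F) := by simp
    rw [e1, map_add, map_smul, hq, H.time_derivative hph ⟨h0.le, by linarith⟩, sub_add_cancel, ← hq,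
      hB, H.tangentMap_apply hhm (H.mem_tube hqo)]
    change t • (c.monodromy c.tangent) + _ = _
    rw [co.monodromy_tangent]
  set M := 1 + ‖ℓ‖ * K + ‖pr‖ * K + ‖ℓ.comp B‖ + ‖pr.comp B‖ with hM
  have n1 : 0 ≤ ‖ℓ‖ * K := by positivity
  have n2 : 0 ≤ ‖pr‖ * K := by positivity
  have n3 := norm_nonneg (ℓ.comp B)
  have n4 := norm_nonneg (pr.comp B)
  have n5 : 0 ≤ ‖pr‖ := norm_nonneg pr
  have hM1 : 1 ≤ M := by linarith
  -- On this scale the nonlinear error of the section equation has Lipschitz constant at most 1/4,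
  -- while its slope in time is 1.
  set r := min h (4 * M)⁻¹ with hr
  have hr0 : 0 < r := by positivity
  have hrh : r ≤ h := min_le_left _ _
  have hrM : M * r ≤ 1 / 4 := by
    have : r ≤ (4 * M)⁻¹ := min_le_right _ _
    calc M * r ≤ M * (4 * M)⁻¹ := by gcongr
      _ = 1 / 4 := by field_simp
  have hball : ∀ U, ‖U - q‖ ≤ r → U ∈ ball q δ := fun U hU => by
    rw [mem_ball, dist_eq_norm]; linarith
  have htime : ∀ t, |t| ≤ r → h + t ∈ Icc 0 δ := fun t ht => by
    rw [abs_le] at ht; exact ⟨by linarith [ht.1], by linarith [ht.2]⟩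
  -- first order expansion in time and datum
  have key : ∀ t t' U U', |t| ≤ r → |t'| ≤ r → ‖U - q‖ ≤ r → ‖U' - q‖ ≤ r →
      ‖R.map (h + t) U - R.map (h + t') U' - ((t - t') • c.tangent + B (U - U'))‖ ≤
        K * max (max |t| ‖U - q‖) (max |t'| ‖U' - q‖) * max |t - t'| ‖U - U'‖ := by
    intro t t' U U' ht ht' hU hU'
    have := H.quad hhm (htime t ht) (htime t' ht') hqo (hball U hU) (hball U' hU')
    rw [hA] at this
    simpa only [add_sub_cancel_left, add_sub_add_left_eq_sub, Prod.norm_def,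
      Real.norm_eq_abs] using this
  have keyℓ : ∀ t t' U U', |t| ≤ r → |t'| ≤ r → ‖U - q‖ ≤ r → ‖U' - q‖ ≤ r →
      |ℓ (R.map (h + t) U - c.base) - ℓ (R.map (h + t') U' - c.base) -
        ((t - t') + ℓ (B (U - U')))| ≤ 1 / 4 * max |t - t'| ‖U - U'‖ := by
    intro t t' U U' ht ht' hU hU'
    have e : ℓ (R.map (h + t) U - c.base) - ℓ (R.map (h + t') U' - c.base) -
        ((t - t') + ℓ (B (U - U'))) =
        ℓ (R.map (h + t) U - R.map (h + t') U' - ((t - t') • c.tangent + B (U - U'))) := by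
      simp only [map_sub, map_add, map_smul, co.ℓ_tangent, smul_eq_mul, mul_one]; ring
    rw [e, ← Real.norm_eq_abs]
    refine (ℓ.le_opNorm _).trans ?_
    have b := key t t' U U' ht ht' hU hU'
    calc ‖ℓ‖ * _ ≤ ‖ℓ‖ * (K * r * max |t - t'| ‖U - U'‖) := by
          refine mul_le_mul_of_nonneg_left (b.trans ?_) (norm_nonneg _)
          gcongr
          exact max_le (max_le ht hU) (max_le ht' hU')
      _ = (‖ℓ‖ * K * r) * max |t - t'| ‖U - U'‖ := by ring
      _ ≤ (M * r) * max |t - t'| ‖U - U'‖ := by gcongr; linarith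
      _ ≤ _ := by gcongr
  have hℓB : ∀ U, |ℓ (B U)| ≤ M * ‖U‖ := fun U => by
    have := (ℓ.comp B).le_opNorm U
    rw [← Real.norm_eq_abs]
    refine this.trans ?_
    gcongr; linarith
  have hrr : r / (4 * M) ≤ r := div_le_self hr0.le (by linarith)
  -- The value at t = 0 is at most (M + 1/4)‖U - q‖, less than what a time shift of 4M‖U - q‖
  -- changes; hence a sign change and a root.
  have hroot : ∀ U, ‖U - q‖ ≤ r / (4 * M) → ∃ t, |t| ≤ 4 * M * ‖U - q‖ ∧
      ℓ (R.map (h + t) U - c.base) = 0 := by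
    intro U hU
    have hUr := hU.trans hrr
    set s := 4 * M * ‖U - q‖ with hs
    have hs0 : 0 ≤ s := by positivity
    have hsr : s ≤ r := by
      rw [le_div_iff₀ (by positivity)] at hU; linarith
    have z0 : |(0 : ℝ)| ≤ r := by simpa using hr0.le
    have hq0 : ‖q - q‖ ≤ r := by simpa using hr0.le
    have b0 := keyℓ 0 0 U q z0 z0 hUr hq0
    rw [add_zero, hmq] at b0
    simp only [sub_self, map_zero, sub_zero, zero_add, abs_zero, norm_nonneg, sup_of_le_right] at b0
    have b1 := keyℓ s 0 U U (by rwa [abs_of_nonneg hs0]) z0 hUr hUr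
    have b2 := keyℓ (-s) 0 U U (by rwa [abs_neg, abs_of_nonneg hs0]) z0 hUr hUr
    simp only [sub_self, map_zero, sub_zero, add_zero, norm_zero, abs_neg, abs_of_nonneg hs0,
      sup_of_le_left hs0] at b1 b2
    have b3 := hℓB (U - q)
    rw [abs_le] at b0 b1 b2 b3
    have hMU : ‖U - q‖ ≤ M * ‖U - q‖ := le_mul_of_one_le_left (norm_nonneg _) hM1
    have hcont : ContinuousOn (fun t => ℓ (R.map (h + t) U - c.base)) (Icc (-s) s) := by
      refine ℓ.continuous.comp_continuousOn (ContinuousOn.sub ?_ continuousOn_const)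
      have hc : ContinuousOn (fun t => R.map t U) (Icc 0 δ) := fun t ht =>
        (H.hasDerivWithinAt_time ht (c.ball_subset_tube δ hqo (hball U hUr))).continuousWithinAt
      exact hc.comp (f := fun t => h + t) (by fun_prop)
        fun t ht => htime t ((abs_le.2 ht).trans hsr)
    have hI := intermediate_value_Icc (by linarith : -s ≤ s) hcont
    obtain ⟨t, ht, hz⟩ := hI (show (0 : ℝ) ∈ _ from ⟨by linarith, by linarith⟩)
    exact ⟨t, abs_le.2 ht, hz⟩
  -- Any choice of roots will do: `keyℓ` compares two roots directly and yields their Lipschitz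
  -- dependence.
  choose! t ht hz using hroot
  set C := max (max (8 * M ^ 3) (4 * M)) (r / (4 * M))⁻¹ with hC
  have hC1 : 8 * M ^ 3 ≤ C := (le_max_left _ _).trans (le_max_left _ _)
  have hC2 : 4 * M ≤ C := (le_max_right _ _).trans (le_max_left _ _)
  have hC3 : C⁻¹ ≤ r / (4 * M) := by
    rw [← inv_inv (r / (4 * M))]
    exact inv_anti₀ (by positivity) (le_max_right _ _)
  have htr : ∀ U, ‖U - q‖ ≤ C⁻¹ → |t U| ≤ r := fun U hU => by
    have hU' := hU.trans hC3
    refine (ht U hU').trans ?_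
    rw [le_div_iff₀ (by positivity)] at hU'; linarith
  have hdec : ∀ U, ‖U - q‖ ≤ C⁻¹ →
      R.map (h + t U) U = c.base + chart Es F₁ (pr (R.map (h + t U) U - c.base)) := by
    intro U hU
    have := co.decomp (R.map (h + t U) U - c.base)
    rw [hz U (hU.trans hC3), zero_smul, add_zero] at this
    rw [← this]; abel
  refine ⟨C, fun U => pr (R.map (h + t U) U - c.base), fun U => h + t U,
    ⟨by linarith, ?_, ?_⟩, ?_, ?_, hdec, ?_⟩
  · linarith
  · intro U U' hU hU'
    have hU1 := hU.trans hC3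
    have hU1' := hU'.trans hC3
    have hUr := hU1.trans hrr
    have hUr' := hU1'.trans hrr
    set m := max ‖U - q‖ ‖U' - q‖
    have hm0 : 0 ≤ m := (norm_nonneg _).trans (le_max_left _ _)
    have hmU : ‖U - q‖ ≤ m := le_max_left _ _
    have hmU' : ‖U' - q‖ ≤ m := le_max_right _ _
    have b := keyℓ (t U) (t U') U U' (htr U hU) (htr U' hU') hUr hUr'
    rw [hz U hU1, hz U' hU1'] at b
    have b3 := hℓB (U - U')
    have hMd : ‖U - U'‖ ≤ M * ‖U - U'‖ := le_mul_of_one_le_left (norm_nonneg _) hM1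
    have hlip : |t U - t U'| ≤ 2 * M * ‖U - U'‖ := by
      have e4 : max |t U - t U'| ‖U - U'‖ ≤ |t U - t U'| + ‖U - U'‖ :=
        max_le (by linarith [norm_nonneg (U - U')]) (by linarith [abs_nonneg (t U - t U')])
      have b' := abs_le.1 b
      have b3' := abs_le.1 b3
      have e5 : |t U - t U'| ≤ M * ‖U - U'‖ + 1 / 4 * max |t U - t U'| ‖U - U'‖ :=
        abs_le.2 ⟨by linarith [b'.2, b3'.2], by linarith [b'.1, b3'.1]⟩
      linarith
    have hmax : max |t U - t U'| ‖U - U'‖ ≤ 2 * M * ‖U - U'‖ :=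
      max_le hlip (by linarith [norm_nonneg (U - U')])
    have hmm : ∀ W, ‖W - q‖ ≤ C⁻¹ → ‖W - q‖ ≤ m → max |t W| ‖W - q‖ ≤ 4 * M * m := by
      intro W hW hWm
      refine max_le ((ht W (hW.trans hC3)).trans (by gcongr)) (hWm.trans ?_)
      have : m ≤ M * m := le_mul_of_one_le_left hm0 hM1
      linarith
    -- Since `pr` annihilates F₀, the variation of the hitting time contributes only at second
    -- order.
    have e : pr (R.map (h + t U) U - c.base) - pr (R.map (h + t U') U' - c.base) -
        (pr.comp B) (U - U') = pr (R.map (h + t U) U - R.map (h + t U') U' -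
          ((t U - t U') • c.tangent + B (U - U'))) := by
      simp only [map_sub, map_add, map_smul, co.pr_tangent, smul_zero, zero_add,
        ContinuousLinearMap.comp_apply]
      abel
    rw [e]
    refine (pr.le_opNorm _).trans ?_
    have bb := key (t U) (t U') U U' (htr U hU) (htr U' hU') hUr hUr'
    calc ‖pr‖ * _ ≤ ‖pr‖ * (K * (4 * M * m) * (2 * M * ‖U - U'‖)) := by
          refine mul_le_mul_of_nonneg_left (bb.trans ?_) n5
          gcongr
          exact max_le (hmm U hU hmU) (hmm U' hU' hmU')
      _ = (‖pr‖ * K) * (8 * M ^ 2 * m * ‖U - U'‖) := by ring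
      _ ≤ M * (8 * M ^ 2 * m * ‖U - U'‖) := by gcongr; linarith
      _ = 8 * M ^ 3 * m * ‖U - U'‖ := by ring
      _ ≤ _ := by gcongr
  · have hq0 : ‖q - q‖ ≤ r / (4 * M) := by simp; positivity
    have e := ht q hq0
    simp only [sub_self, norm_zero, mul_zero, abs_nonpos_iff] at e
    simp [e, hmq]
  · intro U hU
    exact H.alive U (c.ball_subset_tube δ hqo (hball U ((hU.trans hC3).trans hrr))) _
      (htime _ (htr U hU))
  · intro U hU
    rw [add_sub_cancel_left]
    refine (ht U (hU.trans hC3)).trans ?_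
    gcongr

/-- Return maps to the Poincaré section from all points of the limit cycle, with a uniform
constant. -/
lemma exists_returnMap [CompleteSpace Γ] (H : c.SmoothData δ f' K)
    (co : c.Coordinates Eu Es F₁ μ lam pr ℓ) : ∃ C, ∀ s ∈ Icc 0 c.period, ∃ Q τ,
      c.ReturnMap Es F₁ (c.point s) (2 * c.period - s) C
        (pr.comp (R.tangentMap (2 * c.period - s) (c.point s))) Q τ := by
  have hp := c.period_pos
  obtain ⟨h, h0, h1, C₁, Q, τ, hQ⟩ := H.exists_returnMap_short co
  obtain ⟨C₂, hC₂⟩ := H.exists_uniformQuad (2 * c.period)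
  set C := max C₁ C₂
  have hQq := hQ.quad.mono (le_max_left C₁ C₂)
  have hC := hC₂.mono le_rfl (le_max_right C₁ C₂)
  have hC1 := hQq.one_le
  have hinv : C⁻¹ ≤ C₁⁻¹ := inv_anti₀ (by linarith [hQ.quad.one_le]) (le_max_left _ _)
  refine ⟨QuadAt.compConst C, fun s hs => ?_⟩
  have hs1 := hs.1
  have hs2 := hs.2
  -- The extra period keeps this time nonnegative also when s is close to the period.
  set σ := 2 * c.period - s - h with hσ
  have hσ0 : 0 ≤ σ := by linarith
  have hso := c.point_mem_orbit hs.1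
  obtain ⟨a1, a2, -⟩ := hC σ ⟨hσ0, by linarith⟩ (c.point s) hso
  have hmap : R.map σ (c.point s) = c.point (c.period - h) := by
    rw [c.map_point hs1 hσ0, ← c.point_period_add (s := c.period - h) (by linarith)]
    congr 1; ring
  have hQq' : QuadAt Q (pr.comp (R.tangentMap h (R.map σ (c.point s)))) (R.map σ (c.point s)) C := by
    rw [hmap]; exact hQq
  have hcomp := hQq'.comp a2
  rw [ContinuousLinearMap.comp_assoc, ← H.tangentMap_add hσ0 h0.le hso,
    show σ + h = 2 * c.period - s by ring] at hcomp
  have hin : ∀ U, ‖U - c.point s‖ ≤ (QuadAt.compConst C)⁻¹ → ‖U - c.point s‖ ≤ C⁻¹ ∧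
      ‖R.map σ U - c.point (c.period - h)‖ ≤ C₁⁻¹ := fun U hU => by
    have := a2.comp_ball hU
    rw [hmap] at this
    exact ⟨this.1, this.2.trans hinv⟩
  refine ⟨Q ∘ R.map σ, fun U => σ + τ (R.map σ U), hcomp, ?_, ?_, ?_, ?_⟩
  · rw [Function.comp, hmap, hQ.center]
  · intro U hU
    exact (a1 U (hin U hU).1).add (hQ.alive _ (hin U hU).2)
  · intro U hU
    rw [(a1 U (hin U hU).1).map_add (hQ.alive _ (hin U hU).2)]
    exact hQ.map_eq _ (hin U hU).2
  · intro U hU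
    have e1 := hQ.time_le _ (hin U hU).2
    have e2 := a2.lipschitz_center (hin U hU).1
    rw [hmap] at e2
    rw [show σ + τ (R.map σ U) - (2 * c.period - s) = τ (R.map σ U) - h by ring]
    refine e1.trans ?_
    calc C₁ * _ ≤ C * ((C + 1) * ‖U - c.point s‖) := by gcongr; exact le_max_left _ _
      _ = (C * (C + 1)) * ‖U - c.point s‖ := by ring
      _ ≤ _ := by gcongr; exact QuadAt.le_compConst hC1

end SmoothData

end LimitCycle

/-! ### The moving sections along the cycle. -/

namespace LimitCycle

variable {Γ : Type*} [NormedAddCommGroup Γ] [NormedSpace ℝ Γ] {n : ℕ} {R : RGFlow Γ n}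
  {c : LimitCycle R}

lemma base_mem_orbit (c : LimitCycle R) : c.base ∈ c.orbit :=
  c.point_zero ▸ c.point_mem_orbit le_rfl

namespace SmoothData

variable {δ : ℝ} {f' : ℝ × Γ → ℝ × Γ →L[ℝ] Γ} {K : NNReal} {Eu Es : Submodule ℝ Γ} {F₁ : Γ}
  {μ lam : ℝ} {pr : Γ →L[ℝ] ℝ × Es} {ℓ : Γ →L[ℝ] ℝ} [CompleteSpace Γ]

lemma tangentMap_two_period (H : c.SmoothData δ f' K) {s : ℝ} (hs : 0 ≤ s)
    (hs2 : s ≤ 2 * c.period) (F : Γ) :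
    R.tangentMap (2 * c.period - s) (c.point s) (R.tangentMap s c.base F) =
      c.monodromy (c.monodromy F) := by
  have hp := c.period_pos
  have h1 := H.tangentMap_add hs (sub_nonneg.2 hs2) c.base_mem_orbit
  have h2 := H.tangentMap_add hp.le hp.le c.base_mem_orbit
  rw [c.periodic, ← two_mul] at h2
  rw [add_sub_cancel, h2] at h1
  exact (congrArg (fun L : Γ →L[ℝ] Γ => L F) h1).symm

/-- Taylor expansion of the limit cycle. -/
lemma point_taylor (H : c.SmoothData δ f' K) {a s t : ℝ} (ha : 0 ≤ a) (hs : s ∈ Ico a (a + δ))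
    (ht : t ∈ Icc a (a + δ)) :
    ‖c.point t - c.point s - (t - s) • R.tangentMap s c.base c.tangent‖ ≤ K * |t - s| ^ 2 := by
  have hq := c.point_mem_orbit ha
  have hs' : s - a ∈ Ico 0 δ := ⟨by linarith [hs.1], by linarith [hs.2]⟩
  have ht' : t - a ∈ Icc 0 δ := ⟨by linarith [ht.1], by linarith [ht.2]⟩
  have hs'' : s - a ∈ Icc 0 δ := ⟨hs'.1, hs'.2.le⟩
  have hb : c.point a ∈ ball (c.point a) δ := mem_ball_self H.pos
  have h := H.quad hs'' ht' hs'' hq hb hb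
  have e : f' (s - a, c.point a) (t - a - (s - a), c.point a - c.point a) =
      (t - s) • R.tangentMap s c.base c.tangent := by
    have e1 : (t - a - (s - a), c.point a - c.point a) = (t - s) • ((1 : ℝ), (0 : Γ)) := by
      simp
    rw [e1, map_smul, H.time_derivative ha hs', add_sub_cancel]
  rw [e, c.map_point ha ht'.1, c.map_point ha hs'.1, add_sub_cancel, add_sub_cancel] at h
  simpa [Prod.norm_def, sq, mul_assoc] using h

/-- Every datum near the limit cycle lies on one of the sections `S^{(s₀)}`. -/
lemma exists_section (H : c.SmoothData δ f' K) (co : c.Coordinates Eu Es F₁ μ lam pr ℓ)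
    {r : ℝ} (hr : 0 < r) : ∃ δ' > 0, ∀ U, c.distTo U < δ' →
      ∃ s₀ ∈ Ico 0 c.period, U ∈ c.sectionAt Eu Es s₀ ∧ ‖U - c.point s₀‖ ≤ r := by
  have hδ := H.pos
  have hp := c.period_pos
  obtain ⟨C, hC⟩ := H.exists_uniformQuad (2 * c.period)
  have hC1 := hC.one_le (by positivity)
  have hK : (0 : ℝ) ≤ K := K.2
  set M := ‖ℓ‖ * C
  have hM : 0 ≤ M := by positivity
  set h := min (min (δ / 4) (c.period / 4)) (min (4 * (M * K + 1))⁻¹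
    (min 1 (r / 2 / (K + C * ‖c.tangent‖ + 1)))) with hh
  have h0 : 0 < h := by positivity
  have h1 : h ≤ δ / 4 := (min_le_left _ _).trans (min_le_left _ _)
  have h2 : h ≤ c.period / 4 := (min_le_left _ _).trans (min_le_right _ _)
  have h3 : h ≤ (4 * (M * K + 1))⁻¹ := (min_le_right _ _).trans (min_le_left _ _)
  have h4 : h ≤ 1 := (min_le_right _ _).trans ((min_le_right _ _).trans (min_le_left _ _))
  have h5 : h ≤ r / 2 / (K + C * ‖c.tangent‖ + 1) :=
    (min_le_right _ _).trans ((min_le_right _ _).trans (min_le_right _ _))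
  have h3' : M * K * h ≤ 1 / 4 := by
    rw [← one_div, le_div_iff₀ (by positivity)] at h3
    linarith
  have h5' : (K + C * ‖c.tangent‖) * h ≤ r / 2 := by
    rw [le_div_iff₀ (by positivity)] at h5
    linarith
  refine ⟨min (r / 2) (h / (4 * (M + 1))), by positivity, fun U hU => ?_⟩
  -- Shifting by a period if necessary keeps [u - h, u + h] inside [0, 2Δ], where two-sided motion
  -- along the cycle is possible.
  obtain ⟨u, hu1, hu2, hu⟩ : ∃ u, c.period / 2 ≤ u ∧ u ≤ 3 * c.period / 2 ∧
      ‖U - c.point u‖ < min (r / 2) (h / (4 * (M + 1))) := by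
    obtain ⟨u, hu, hlt⟩ := c.exists_near_of_distTo_lt hU
    rcases le_total (c.period / 2) u with hle | hle
    · exact ⟨u, hle, by linarith [hu.2], hlt⟩
    · exact ⟨c.period + u, by linarith [hu.1], by linarith, by rwa [c.point_period_add hu.1]⟩
  have hur := hu.trans_le (min_le_left _ _)
  have huM : M * ‖U - c.point u‖ ≤ h / 4 := by
    have := hu.trans_le (min_le_right _ _)
    rw [lt_div_iff₀ (by positivity)] at this
    nlinarith [norm_nonneg (U - c.point u)]
  set a := u - h
  set b := u + h
  have ha : 0 ≤ a := by linarith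
  have hb : b ≤ 2 * c.period := by linarith
  have htaylor : ∀ s ∈ Icc a b,
      ‖c.point u - c.point s - (u - s) • R.tangentMap s c.base c.tangent‖ ≤ K * |u - s| ^ 2 :=
    fun s hs => H.point_taylor ha ⟨hs.1, by linarith [hs.2]⟩ ⟨by linarith, by linarith⟩
  have hMs : ∀ s ∈ Icc a b, ∀ F,
      |ℓ (R.tangentMap (2 * c.period - s) (c.point s) F)| ≤ M * ‖F‖ := by
    intro s hs F
    have hl := (hC (2 * c.period - s) ⟨by linarith [hs.2], by linarith [hs.1]⟩ (c.point s)
      (c.point_mem_orbit (ha.trans hs.1))).2.1.norm_le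
    rw [← Real.norm_eq_abs]
    refine (ℓ.le_opNorm _).trans ?_
    rw [mul_assoc]
    gcongr
    exact ((R.tangentMap _ _).le_opNorm F).trans (by gcongr)
  have hℓT : ∀ s ∈ Icc a b, ∀ F, ℓ (R.tangentMap (2 * c.period - s) (c.point s)
      (R.tangentMap s c.base F)) = ℓ F := fun s hs F => by
    rw [H.tangentMap_two_period (ha.trans hs.1) (hs.2.trans hb), co.ℓ_monodromy, co.ℓ_monodromy]
  -- Transport to the base after a total of two periods preserves ℓ (`hℓT`), so a zero of ψ
  -- characterizes the section S^{(s)}. By Taylor expansion ψ(s) is u - s up to a small error, which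
  -- forces a sign change.
  set ψ : ℝ → ℝ := fun s => ℓ (R.tangentMap (2 * c.period - s) (c.point s) (U - c.point s)) with hψ
  have hψs : ∀ s ∈ Icc a b, |ψ s - (u - s)| ≤ h / 4 + M * K * |u - s| ^ 2 := by
    intro s hs
    set W := c.point u - c.point s - (u - s) • R.tangentMap s c.base c.tangent with hW
    have e : U - c.point s = (U - c.point u) + W +
        R.tangentMap s c.base ((u - s) • c.tangent) := by
      rw [hW, map_smul]; abel
    have e2 : ψ s - (u - s) = ℓ (R.tangentMap (2 * c.period - s) (c.point s) (U - c.point u)) +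
        ℓ (R.tangentMap (2 * c.period - s) (c.point s) W) := by
      rw [hψ]
      simp only
      rw [e, map_add, map_add, map_add, map_add, hℓT s hs, map_smul, co.ℓ_tangent]
      simp
    rw [e2]
    refine (abs_add_le _ _).trans (add_le_add ((hMs s hs _).trans huM) ((hMs s hs _).trans ?_))
    calc M * ‖W‖ ≤ M * (K * |u - s| ^ 2) := mul_le_mul_of_nonneg_left (htaylor s hs) hM
      _ = _ := by ring
  -- The long transport is split at the fixed time `b`; only a short transport, governed by the
  -- continuous `f'`, depends on s.
  have hcont : ContinuousOn ψ (Icc a b) := by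
    have hpt : ContinuousOn c.point (Icc a b) :=
      H.continuousOn_point.mono fun s hs => ha.trans hs.1
    have hmem : ∀ s ∈ Icc a b, b - s ∈ Icc 0 δ := fun s hs =>
      ⟨by linarith [hs.2], by linarith [hs.1]⟩
    have hf : ContinuousOn (fun s => f' (b - s, c.point s)) (Icc a b) :=
      H.lipschitz.continuousOn.comp (f := fun s => (b - s, c.point s))
        ((continuousOn_const.sub continuousOn_id).prodMk hpt)
        fun s hs => ⟨hmem s hs, H.mem_tube (c.point_mem_orbit (ha.trans hs.1))⟩
    have hg : ContinuousOn (fun s => f' (b - s, c.point s) (0, U - c.point s)) (Icc a b) :=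
      hf.clm_apply (continuousOn_const.prodMk (continuousOn_const.sub hpt))
    have hk : ContinuousOn (fun s => ℓ (R.tangentMap (2 * c.period - b) (c.point b)
        (f' (b - s, c.point s) (0, U - c.point s)))) (Icc a b) :=
      (ℓ.comp (R.tangentMap (2 * c.period - b) (c.point b))).continuous.comp_continuousOn hg
    refine hk.congr fun s hs => ?_
    have hs0 := ha.trans hs.1
    have hT := H.tangentMap_add (s := b - s) (t := 2 * c.period - b) (by linarith [hs.2])
      (by linarith) (c.point_mem_orbit hs0)
    rw [c.map_point hs0 (by linarith [hs.2]), add_sub_cancel,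
      show b - s + (2 * c.period - b) = 2 * c.period - s by ring] at hT
    rw [hψ]
    simp only
    rw [hT, ContinuousLinearMap.comp_apply,
      H.tangentMap_apply (hmem s hs) (H.mem_tube (c.point_mem_orbit hs0))]
  have hquad : M * K * |h| ^ 2 ≤ h / 4 := by
    rw [abs_of_pos h0, sq, ← mul_assoc]
    nlinarith
  have hψa := hψs a ⟨le_rfl, by linarith⟩
  have hψb := hψs b ⟨by linarith, le_rfl⟩
  rw [show u - a = h by ring, abs_le] at hψa
  rw [show u - b = -h by ring, abs_neg, abs_le] at hψb
  obtain ⟨s, hs, hz⟩ := intermediate_value_Icc' (by linarith : a ≤ b) hcont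
    (show (0 : ℝ) ∈ Icc (ψ b) (ψ a) from ⟨by linarith [hψb.2], by linarith [hψa.1]⟩)
  have hs0 : 0 ≤ s := ha.trans hs.1
  have hdist : ‖U - c.point s‖ ≤ r := by
    have hus : |u - s| ≤ h := abs_le.2 ⟨by linarith [hs.2], by linarith [hs.1]⟩
    have hT : ‖R.tangentMap s c.base c.tangent‖ ≤ C * ‖c.tangent‖ := by
      have := (hC s ⟨hs0, by linarith [hs.2]⟩ c.base c.base_mem_orbit).2.1.norm_le
      exact ((R.tangentMap _ _).le_opNorm _).trans (by gcongr)
    have b1 : ‖c.point u - c.point s‖ ≤ K * |u - s| ^ 2 + |u - s| * (C * ‖c.tangent‖) := by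
      have := norm_add_le (c.point u - c.point s - (u - s) • R.tangentMap s c.base c.tangent)
        ((u - s) • R.tangentMap s c.base c.tangent)
      rw [sub_add_cancel] at this
      refine this.trans (add_le_add (htaylor s hs) ?_)
      rw [norm_smul, Real.norm_eq_abs]
      gcongr
    have b2 : ‖U - c.point s‖ ≤ ‖U - c.point u‖ + ‖c.point u - c.point s‖ := by
      simpa using norm_add_le (U - c.point u) (c.point u - c.point s)
    have b3 : (K : ℝ) * |u - s| ^ 2 ≤ K * h := by
      have : |u - s| ^ 2 ≤ h := by nlinarith [abs_nonneg (u - s)]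
      gcongr
    have b4 : |u - s| * (C * ‖c.tangent‖) ≤ h * (C * ‖c.tangent‖) := by gcongr
    linarith
  obtain ⟨F, hF⟩ := H.tangentMap_surjective hs0 c.base_mem_orbit (U - c.point s)
  have hFℓ : ℓ F = 0 := by
    rw [← hℓT s hs F, hF]; exact hz
  -- A parameter beyond the period is lowered by Δ, with `F` replaced by its image under the
  -- monodromy.
  rcases lt_or_ge s c.period with hlt | hge
  · exact ⟨s, ⟨hs0, hlt⟩, ⟨F, (co.mem_iff F).2 hFℓ, by rw [hF]; abel⟩, hdist⟩
  · have hs1 : 0 ≤ s - c.period := sub_nonneg.2 hge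
    have hpt : c.point (s - c.period) = c.point s := by
      rw [← c.point_period_add hs1, add_sub_cancel]
    have hT := H.tangentMap_add hp.le hs1 c.base_mem_orbit
    rw [add_sub_cancel, c.periodic] at hT
    refine ⟨s - c.period, ⟨hs1, by linarith [hs.2]⟩, ⟨c.monodromy F, ?_, ?_⟩, by rwa [hpt]⟩
    · rw [co.mem_iff, co.ℓ_monodromy, hFℓ]
    · rw [hpt]
      have : R.tangentMap (s - c.period) c.base (c.monodromy F) = U - c.point s := by
        rw [← hF, hT]; rfl
      rw [this]; abel

end SmoothData

end LimitCycle

/-! ### Global extension of a local saddle. -/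

/-- A map with a saddle at the origin, modified away from the origin. -/
lemma exists_saddleMap {F : Type*} [NormedAddCommGroup F] [NormedSpace ℝ F] {P₀ : ℝ × F → ℝ × F}
    {L : ℝ × F →L[ℝ] ℝ × F} {C μ lam r : ℝ} (hP : QuadAt P₀ L 0 C) (h0 : P₀ 0 = 0)
    (h1 : ∀ x, (L x).1 = μ * x.1) (h2 : ∀ x, ‖(L x).2‖ ≤ lam * ‖x.2‖) (hlam : 0 ≤ lam)
    (hr : 0 < r) (hrC : r ≤ C⁻¹) (hμ : 1 < μ - 2 * C * r) (hα : lam + 2 * C * r < 1) :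
    ∃ P, SaddleMap P μ (2 * C * r) (lam + 2 * C * r) (2 * C) ∧ ∀ x, ‖x‖ ≤ r → P x = P₀ x := by
  have hC := hP.one_le
  -- Only the nonlinear part is cut off. The factor 2 in its constants is the Lipschitz constant of
  -- the retraction.
  let N : ℝ × F → ℝ × F := fun x => P₀ (radialRetract r x) - L (radialRetract r x)
  have hN : ∀ x y, ‖N x - N y‖ ≤ 2 * C * min r (max ‖x‖ ‖y‖) * ‖x - y‖ := by
    intro x y
    have hx := norm_radialRetract_le hr x
    have hy := norm_radialRetract_le hr y
    have h3 := hP.est (radialRetract r x) (radialRetract r y)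
      (by simpa using (hx.trans (min_le_left _ _)).trans hrC)
      (by simpa using (hy.trans (min_le_left _ _)).trans hrC)
    have e : N x - N y = P₀ (radialRetract r x) - P₀ (radialRetract r y) -
        L (radialRetract r x - radialRetract r y) := by
      simp only [N, map_sub]; abel
    rw [e]
    refine h3.trans ?_
    rw [sub_zero, sub_zero]
    have h4 : max ‖radialRetract r x‖ ‖radialRetract r y‖ ≤ min r (max ‖x‖ ‖y‖) :=
      max_le (hx.trans (min_le_min_left _ (le_max_left _ _)))
        (hy.trans (min_le_min_left _ (le_max_right _ _)))
    calc _ ≤ C * min r (max ‖x‖ ‖y‖) * (2 * ‖x - y‖) := by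
          gcongr
          exact norm_radialRetract_sub_le hr x y
      _ = _ := by ring
  have hN1 : ∀ x y, ‖N x - N y‖ ≤ 2 * C * r * ‖x - y‖ := fun x y =>
    (hN x y).trans (by gcongr; exact min_le_left _ _)
  have hN2 : ∀ x y, ‖N x - N y‖ ≤ 2 * C * max ‖x‖ ‖y‖ * ‖x - y‖ := fun x y =>
    (hN x y).trans (by gcongr; exact min_le_right _ _)
  have hfst : ∀ x y, (L x + N x).1 - (L y + N y).1 - μ * (x.1 - y.1) = (N x - N y).1 := by
    intro x y
    simp only [Prod.fst_add, Prod.fst_sub, h1]; ring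
  refine ⟨fun x => L x + N x, ⟨?_, by positivity, by positivity, by positivity, hμ, hα, ?_, ?_, ?_⟩,
    fun x hx => ?_⟩
  · simp [N, radialRetract, h0]
  · intro x y
    rw [hfst]
    exact (norm_fst_le _).trans (hN1 x y)
  · intro x y
    rw [hfst]
    exact (norm_fst_le _).trans (hN2 x y)
  · intro x y
    have e : (L x + N x).2 - (L y + N y).2 = (L (x - y)).2 + (N x - N y).2 := by
      simp only [map_sub, Prod.snd_add, Prod.snd_sub]; abel
    rw [e, add_mul]
    refine (norm_add_le _ _).trans (add_le_add ((h2 _).trans ?_) ((norm_snd_le _).trans (hN1 x y)))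
    gcongr
    exact norm_snd_le (x - y)
  · simp [N, radialRetract_of_le hr hx]

/-! ### Time shift of the final fates. -/

namespace RGFlow

variable {Γ : Type*} [NormedAddCommGroup Γ] [NormedSpace ℝ Γ] {n : ℕ} {R : RGFlow Γ n}

lemma TendsToFlat.of_map {Flat : Set Γ} {T : ℝ} {U : Γ} (hT : R.Alive T U)
    (h : R.TendsToFlat Flat (R.map T U)) : R.TendsToFlat Flat U := by
  obtain ⟨h1, V, hV, h2⟩ := h
  have hT0 := R.alive_nonneg _ _ hT
  refine ⟨fun s hs => (hT.add (h1 s hs)).mono hs (by linarith), V, hV, ?_⟩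
  have h3 : Tendsto (fun s => R.map (s - T) (R.map T U)) atTop (𝓝 V) :=
    h2.comp (tendsto_atTop_add_const_right _ (-T) tendsto_id)
  refine h3.congr' ?_
  filter_upwards [eventually_ge_atTop T] with s hs
  rw [← hT.map_add (h1 _ (sub_nonneg.2 hs)), add_sub_cancel]

/-- Both evolutions have the same end: the left neighbourhood filter at T + s is the translate of
the one at s. An equivalence is needed so that the outermost blow-up radius is also preserved. -/
lemma blowUpPoint_map_iff {T s : ℝ} {U : Γ} (hT : R.Alive T U) (hs : 0 < s) (ξ : Ioi (0 : ℝ)) :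
    R.BlowUpPoint U (T + s) ξ ↔ R.BlowUpPoint (R.map T U) s ξ := by
  have hT0 := R.alive_nonneg _ _ hT
  have hal : ∀ t, 0 ≤ t → (R.Alive (T + t) U ↔ R.Alive t (R.map T U)) := fun t ht => by
    rw [R.alive_add T t U hT0 ht, and_iff_right hT]
  have h1 : (∀ s' ∈ Ico 0 (T + s), R.Alive s' U) ↔ ∀ s' ∈ Ico 0 s, R.Alive s' (R.map T U) := by
    constructor
    · intro h s' hs'
      exact (hal s' hs'.1).1 (h _ ⟨by linarith [hs'.1], by linarith [hs'.2]⟩)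
    · intro h s' hs'
      rcases le_total s' T with hle | hle
      · exact hT.mono hs'.1 hle
      · have := (hal (s' - T) (by linarith)).2 (h _ ⟨by linarith, by linarith [hs'.2]⟩)
        rwa [add_sub_cancel] at this
  unfold BlowUpPoint
  rw [h1, hal s hs.le, and_iff_right hs, and_iff_right (by positivity : 0 < T + s)]
  refine and_congr_right fun h2 => and_congr_right fun _ => forall_congr' fun M => ?_
  have hnhds : 𝓝[<] (T + s) = Filter.map (fun t => T + t) (𝓝[<] s) :=
    Filter.map_add_left_nhdsLT.symm
  have hfil : 𝓝[<] (T + s) ×ˢ 𝓝 ξ = Filter.map (fun q : ℝ × Ioi (0 : ℝ) => (T + q.1, q.2))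
      (𝓝[<] s ×ˢ 𝓝 ξ) := by
    rw [hnhds]
    have := Filter.prod_map_map_eq' (fun t : ℝ => T + t) (id : Ioi (0 : ℝ) → Ioi (0 : ℝ))
      (𝓝[<] s) (𝓝 ξ)
    rw [Filter.map_id] at this
    rw [this]; rfl
  rw [hfil, frequently_map]
  refine frequently_congr ?_
  have hev : ∀ᶠ t in 𝓝[<] s, 0 ≤ t ∧ t < s := by
    filter_upwards [self_mem_nhdsWithin, nhdsWithin_le_nhds (Ioi_mem_nhds hs)] with t h3 h4
    exact ⟨(mem_Ioi.1 h4).le, h3⟩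
  filter_upwards [hev.prod_inl (𝓝 ξ)] with q hq
  rw [hT.map_add (h2 q.1 ⟨hq.1, hq.2⟩)]

lemma HorizonAt.of_map {T s : ℝ} {U : Γ} {ξ : Ioi (0 : ℝ)} (hT : R.Alive T U)
    (h : R.HorizonAt (R.map T U) s ξ) : R.HorizonAt U (T + s) ξ := by
  have hs : 0 < s := h.1.1
  have e : {ξ' | R.BlowUpPoint U (T + s) ξ'} = {ξ' | R.BlowUpPoint (R.map T U) s ξ'} :=
    Set.ext fun ξ' => blowUpPoint_map_iff hT hs ξ'
  unfold HorizonAt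
  rwa [e]

end RGFlow

/-! ### Stable manifold and final deviation. -/

namespace LimitCycle

variable {Γ : Type*} [NormedAddCommGroup Γ] [NormedSpace ℝ Γ] {n : ℕ} {R : RGFlow Γ n}
  {c : LimitCycle R}

lemma mem_stableManifold_of_map {T : ℝ} {U : Γ} (hT : R.Alive T U)
    (h : R.map T U ∈ c.stableManifold) : U ∈ c.stableManifold := by
  obtain ⟨h1, h2⟩ := h
  have hT0 := R.alive_nonneg _ _ hT
  refine ⟨fun s hs => (hT.add (h1 s hs)).mono hs (by linarith), ?_⟩
  have h3 : Tendsto (fun s => c.distTo (R.map (s - T) (R.map T U))) atTop (𝓝 0) :=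
    h2.comp (tendsto_atTop_add_const_right _ (-T) tendsto_id)
  refine h3.congr' ?_
  filter_upwards [eventually_ge_atTop T] with s hs
  rw [← hT.map_add (h1 _ (sub_nonneg.2 hs)), add_sub_cancel]

lemma map_mem_stableManifold {T : ℝ} (hT : 0 ≤ T) {U : Γ} (h : U ∈ c.stableManifold) :
    R.map T U ∈ c.stableManifold := by
  obtain ⟨h1, h2⟩ := h
  have hal : ∀ s, 0 ≤ s → R.Alive s (R.map T U) := fun s hs =>
    ((R.alive_add T s U hT hs).1 (h1 _ (by positivity))).2
  refine ⟨hal, ?_⟩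
  have h3 : Tendsto (fun s => c.distTo (R.map (s + T) U)) atTop (𝓝 0) :=
    h2.comp (tendsto_atTop_add_const_right _ T tendsto_id)
  refine h3.congr' ?_
  filter_upwards [eventually_ge_atTop 0] with s hs
  rw [add_comm, (h1 T hT).map_add (hal s hs)]

lemma FinallyDeviates.mono {η η' : ℝ} {U : Γ} (h : c.FinallyDeviates η U) (hη : η' ≤ η) :
    c.FinallyDeviates η' U := by
  obtain ⟨s₁, h1, h2⟩ := h
  exact ⟨s₁, h1, fun s hs ha => hη.trans (h2 s hs ha)⟩

lemma FinallyDeviates.notMem {η : ℝ} (hη : 0 < η) {U : Γ} (h : c.FinallyDeviates η U) :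
    U ∉ c.stableManifold := by
  rintro ⟨h1, h2⟩
  obtain ⟨s₁, -, h3⟩ := h
  obtain ⟨s, hs1, hs2, hs3⟩ := ((h2.eventually_lt_const hη).and
    ((eventually_ge_atTop s₁).and (eventually_ge_atTop 0))).exists
  exact absurd (h3 s hs2 (h1 s hs3)) (not_le.2 hs1)

namespace SmoothData

variable {δ : ℝ} {f' : ℝ × Γ → ℝ × Γ →L[ℝ] Γ} {K : NNReal}

/-- From any point of the tube the evolution exists for a further time δ, so the tube cannot be
visited during the last δ/2 before the blow-up. -/
lemma finallyDeviates_of_horizon (H : c.SmoothData δ f' K) {U : Γ} {s : ℝ} {ξ : Ioi (0 : ℝ)}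
    (h : R.HorizonAt U s ξ) : c.FinallyDeviates δ U := by
  have hδ := H.pos
  obtain ⟨hs, hal, hna, -⟩ := h.1
  refine ⟨max 0 (s - δ / 2), hal _ ⟨le_max_left _ _, max_lt hs (by linarith)⟩, fun t ht hat => ?_⟩
  by_contra hlt
  have h1 := H.alive _ (not_le.1 hlt) δ ⟨hδ.le, le_rfl⟩
  have h2 : s - δ / 2 ≤ t := (le_max_right _ _).trans ht
  exact hna ((hat.add h1).mono hs.le (by linarith))

/-- A limit inside the tube is stationary by continuity of R_s there, and stationary points keep a
distance from a nontrivial cycle. The bound depends neither on `Flat` nor on the datum. -/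
lemma exists_finallyDeviates_of_flat [CompleteSpace Γ] (H : c.SmoothData δ f' K) :
    ∃ η > 0, ∀ Flat U, R.TendsToFlat Flat U → c.FinallyDeviates η U := by
  have hδ := H.pos
  obtain ⟨η, hη, hst⟩ := H.exists_dist_stationary
  refine ⟨min η δ / 2, by positivity, fun Flat U hU => ?_⟩
  obtain ⟨hal, V, -, hV⟩ := hU
  have hle : min η δ ≤ c.distTo V := by
    by_contra hlt
    have hlt := not_le.1 hlt
    have hVδ : c.distTo V < δ := hlt.trans_le (min_le_right _ _)
    refine absurd (hst V fun s hs => ?_) (not_le.2 (hlt.trans_le (min_le_left _ _)))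
    have h1 : Tendsto (fun t => R.map s (R.map t U)) atTop (𝓝 (R.map s V)) :=
      (H.hasFDerivAt_map hs hVδ).continuousAt.tendsto.comp hV
    have h2 : Tendsto (fun t => R.map (t + s) U) atTop (𝓝 V) :=
      hV.comp (tendsto_atTop_add_const_right _ s tendsto_id)
    refine tendsto_nhds_unique (h1.congr' ?_) h2
    filter_upwards [eventually_ge_atTop 0] with t ht
    have h3 := (R.alive_add t s U ht hs.1).1 (hal _ (add_nonneg ht hs.1))
    exact (h3.1.map_add h3.2).symm
  have hcont : Tendsto (fun s => c.distTo (R.map s U)) atTop (𝓝 (c.distTo V)) :=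
    ((continuous_infDist_pt c.orbit).tendsto V).comp hV
  have hlt : min η δ / 2 < c.distTo V := by
    have : 0 < min η δ := by positivity
    linarith
  obtain ⟨s₁, hs₁⟩ := eventually_atTop.1 (hcont.eventually_const_lt hlt)
  exact ⟨max s₁ 0, hal _ (le_max_right _ _), fun s hs _ =>
    (hs₁ s ((le_max_left _ _).trans hs)).le⟩

end SmoothData

end LimitCycle

/-! ### The local Poincaré map. -/

namespace LimitCycle

variable {Γ : Type*} [NormedAddCommGroup Γ] [NormedSpace ℝ Γ] {n : ℕ} {R : RGFlow Γ n}
  {c : LimitCycle R}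

/-- In the chart of the Poincaré section, the flow induces the map `P` with return time `p` on the
ball of radius `r`. -/
structure LocalPoincare (c : LimitCycle R) (Es : Submodule ℝ Γ) (F₁ : Γ)
    (P : ℝ × Es → ℝ × Es) (p : ℝ × Es → ℝ) (r C : ℝ) : Prop where
  pos : 0 < r
  C_nonneg : 0 ≤ C
  alive : ∀ x, ‖x‖ ≤ r → R.Alive (p x) (c.base + chart Es F₁ x)
  map_eq : ∀ x, ‖x‖ ≤ r → R.map (p x) (c.base + chart Es F₁ x) = c.base + chart Es F₁ (P x)
  time_le : ∀ x, ‖x‖ ≤ r → |p x - c.period| ≤ C * ‖x‖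
  half_le : ∀ x, ‖x‖ ≤ r → c.period / 2 ≤ p x
  le_two : ∀ x, ‖x‖ ≤ r → p x ≤ 2 * c.period

namespace SmoothData

variable {δ : ℝ} {f' : ℝ × Γ → ℝ × Γ →L[ℝ] Γ} {K : NNReal} {Eu Es : Submodule ℝ Γ} {F₁ : Γ}
  {μ lam : ℝ} {pr : Γ →L[ℝ] ℝ × Es} {ℓ : Γ →L[ℝ] ℝ} [CompleteSpace Γ]

/-- The return map at parameter s = Δ, read in the chart and cut off. The inequality μ + θ < μ²
ensures that one step cannot jump over the amplitude range [ε μ⁻², ε] of the exit tubes. -/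
lemma exists_localPoincare (H : c.SmoothData δ f' K) (co : c.Coordinates Eu Es F₁ μ lam pr ℓ) :
    ∃ P p r C θ α C', SaddleMap P μ θ α C' ∧ μ + θ < μ ^ 2 ∧ c.LocalPoincare Es F₁ P p r C := by
  have hp := c.period_pos
  obtain ⟨C₀, h₀⟩ := H.exists_returnMap co
  obtain ⟨Q, τ, hQ⟩ := h₀ c.period ⟨hp.le, le_rfl⟩
  rw [c.point_period, show 2 * c.period - c.period = c.period by ring] at hQ
  set C₁ := max C₀ ‖chart Es F₁‖
  have hQ1 := hQ.quad.mono (le_max_left C₀ ‖chart Es F₁‖)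
  have hC1 : 1 ≤ C₁ := hQ1.one_le
  have hC0 := hQ.quad.one_le
  have haff : QuadAt (fun x => c.base + chart Es F₁ x) (chart Es F₁) 0 C₁ :=
    QuadAt.affine _ 0 hC1 (le_max_right _ _) _
  have hQ2 : QuadAt Q (pr.comp (R.tangentMap c.period c.base))
      ((fun x => c.base + chart Es F₁ x) 0) C₁ := by simpa using hQ1
  have hcomp := QuadAt.comp (f := fun x => c.base + chart Es F₁ x) hQ2 haff
  set C₂ := QuadAt.compConst C₁
  have hC2 : 1 ≤ C₂ := hcomp.one_le
  have hμ := co.one_lt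
  have hlam := co.lam_lt
  -- The three bounds make the expansion valid, keep the errors below half the spectral gaps, and
  -- keep return times within Δ/2 of Δ.
  set r := min (C₂⁻¹) (min ((2 * C₂)⁻¹ * min ((μ - 1) / 2) ((1 - lam) / 2))
    (c.period / (2 * (2 * C₀)))) with hr
  have m1 : 0 < (μ - 1) / 2 := by linarith
  have m2 : 0 < (1 - lam) / 2 := by linarith
  have hr0 : 0 < r := by positivity
  have hr1 : r ≤ C₂⁻¹ := min_le_left _ _
  have hr2 : r ≤ (2 * C₂)⁻¹ * min ((μ - 1) / 2) ((1 - lam) / 2) :=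
    (min_le_right _ _).trans (min_le_left _ _)
  have hr3 : r ≤ c.period / (2 * (2 * C₀)) := (min_le_right _ _).trans (min_le_right _ _)
  have hθ : 2 * C₂ * r ≤ min ((μ - 1) / 2) ((1 - lam) / 2) := by
    calc 2 * C₂ * r ≤ 2 * C₂ * ((2 * C₂)⁻¹ * min ((μ - 1) / 2) ((1 - lam) / 2)) := by gcongr
      _ = _ := by field_simp
  have hθ1 := hθ.trans (min_le_left _ _)
  have hθ2 := hθ.trans (min_le_right _ _)
  obtain ⟨P, hP, hPr⟩ := exists_saddleMap hcomp (by simp [hQ.center]) co.fst_monodromy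
    co.snd_monodromy co.lam_nonneg hr0 hr1 (by linarith) (by linarith)
  have hin : ∀ x : ℝ × Es, ‖x‖ ≤ r → ‖c.base + chart Es F₁ x - c.base‖ ≤ C₀⁻¹ := by
    intro x hx
    have h1 := haff.comp_ball (x := x) (by simpa using hx.trans hr1)
    have h2 := h1.2
    simp only [map_zero, add_zero] at h2
    exact h2.trans (inv_anti₀ (by linarith) (le_max_left _ _))
  have htime : ∀ x : ℝ × Es, ‖x‖ ≤ r → |τ (c.base + chart Es F₁ x) - c.period| ≤
      2 * C₀ * ‖x‖ := by
    intro x hx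
    refine (hQ.time_le _ (hin x hx)).trans ?_
    rw [add_sub_cancel_left, mul_comm 2, mul_assoc]
    gcongr
    exact norm_chart_le Es co.ne_zero x
  have hhalf : ∀ x : ℝ × Es, ‖x‖ ≤ r → 2 * C₀ * ‖x‖ ≤ c.period / 2 := by
    intro x hx
    have := hx.trans hr3
    rw [le_div_iff₀ (by positivity)] at this
    linarith
  refine ⟨P, fun x => τ (c.base + chart Es F₁ x), r, 2 * C₀, _, _, _, hP, by nlinarith,
    hr0, by positivity, fun x hx => hQ.alive _ (hin x hx), fun x hx => ?_, htime, ?_, ?_⟩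
  · rw [hQ.map_eq _ (hin x hx), hPr x hx]; rfl
  · intro x hx
    have := (abs_le.1 (htime x hx)).1
    linarith [hhalf x hx]
  · intro x hx
    have := (abs_le.1 (htime x hx)).2
    linarith [hhalf x hx]

end SmoothData

namespace LocalPoincare

variable {Es : Submodule ℝ Γ} {F₁ : Γ} {P : ℝ × Es → ℝ × Es} {p : ℝ × Es → ℝ} {r C : ℝ}

lemma iterate (h : c.LocalPoincare Es F₁ P p r C) {x : ℝ × Es} {k : ℕ}
    (hx : ∀ j < k, ‖P^[j] x‖ ≤ r) :
    R.Alive (∑ j ∈ Finset.range k, p (P^[j] x)) (c.base + chart Es F₁ x) ∧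
    R.map (∑ j ∈ Finset.range k, p (P^[j] x)) (c.base + chart Es F₁ x) =
      c.base + chart Es F₁ (P^[k] x) := by
  induction k with
  | zero => simp [R.alive_zero, R.map_zero]
  | succ k ih =>
    obtain ⟨h1, h2⟩ := ih fun j hj => hx j (by omega)
    have hk := hx k (by omega)
    have h3 := h.alive _ hk
    rw [← h2] at h3
    rw [Finset.sum_range_succ, Function.iterate_succ_apply', ← h.map_eq _ hk]
    exact ⟨h1.add h3, by rw [h1.map_add h3, h2]⟩

/-- Points of the section whose orbit under the Poincaré map stays in the stable cone lie on the
stable manifold. -/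
lemma mem_stableManifold [CompleteSpace Γ] {δ : ℝ} {f' : ℝ × Γ → ℝ × Γ →L[ℝ] Γ} {K : NNReal}
    (H : c.SmoothData δ f' K) (hF : F₁ ≠ 0) {μ θ α C' : ℝ}
    (h : c.LocalPoincare Es F₁ P p r C) (hP : SaddleMap P μ θ α C') {x : ℝ × Es} (hx : ‖x‖ ≤ r)
    (hs : ∀ k, |(P^[k] x).1| ≤ ‖(P^[k] x).2‖) :
    c.base + chart Es F₁ x ∈ c.stableManifold := by
  have hp := c.period_pos
  have hdecay : ∀ k, ‖P^[k] x‖ ≤ α ^ k * ‖x‖ := fun k => hP.norm_iterate_le_of_stable (hs k)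
  have hxr : ∀ k, ‖P^[k] x‖ ≤ r := fun k => by
    refine (hdecay k).trans (le_trans ?_ hx)
    exact mul_le_of_le_one_left (norm_nonneg _) (pow_le_one₀ hP.α_nonneg hP.α_lt.le)
  set T : ℕ → ℝ := fun k => ∑ j ∈ Finset.range k, p (P^[j] x) with hT
  have hTs : ∀ k, T (k + 1) = T k + p (P^[k] x) := fun k => Finset.sum_range_succ _ _
  have hTk : ∀ k, R.Alive (T k) (c.base + chart Es F₁ x) ∧
      R.map (T k) (c.base + chart Es F₁ x) = c.base + chart Es F₁ (P^[k] x) :=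
    fun k => h.iterate fun j _ => hxr j
  have hTlow : ∀ k : ℕ, k * (c.period / 2) ≤ T k := by
    intro k
    induction k with
    | zero => simp [hT]
    | succ k ih =>
      rw [hTs]; push_cast
      linarith [h.half_le _ (hxr k)]
  have hTmono : Monotone T := monotone_nat_of_le_succ fun k => by
    rw [hTs]; linarith [h.half_le _ (hxr k)]
  have hex : ∀ s : ℝ, ∃ k, s < T k := fun s => by
    obtain ⟨k, hk⟩ := exists_nat_gt (s / (c.period / 2))
    rw [div_lt_iff₀ (by positivity)] at hk
    exact ⟨k, hk.trans_le (hTlow k)⟩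
  obtain ⟨B, hB⟩ := H.exists_uniformQuad (2 * c.period)
  have hB1 := hB.one_le (by positivity)
  refine ⟨fun s hs => ?_, ?_⟩
  · obtain ⟨k, hk⟩ := hex s
    exact (hTk k).1.mono hs hk.le
  have hlim : Tendsto (fun k : ℕ => 2 * (α ^ k * ‖x‖)) atTop (𝓝 0) := by
    simpa using ((tendsto_pow_atTop_nhds_zero_of_lt_one hP.α_nonneg hP.α_lt).mul_const ‖x‖).const_mul 2
  rw [Metric.tendsto_atTop]
  intro e he
  obtain ⟨k₀, hk₀⟩ := eventually_atTop.1 (hlim.eventually_lt_const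
    (show (0 : ℝ) < min B⁻¹ (e / (B + 1)) by positivity))
  refine ⟨T k₀, fun s hsk => ?_⟩
  rw [Real.dist_eq, sub_zero, abs_of_nonneg (c.distTo_nonneg _)]
  classical
  -- The time s falls between two consecutive returns, at most 2Δ apart; uniform regularity carries
  -- the decay at the returns to intermediate times.
  obtain ⟨k, hk⟩ : ∃ k, Nat.find (hex s) = k + 1 := by
    refine Nat.exists_eq_succ_of_ne_zero fun h0 => ?_
    have h1 := Nat.find_spec (hex s)
    rw [h0] at h1
    have h2 := hTmono (Nat.zero_le k₀)
    linarith
  have h1 : s < T (k + 1) := hk ▸ Nat.find_spec (hex s)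
  have h2 : T k ≤ s := not_lt.1 (Nat.find_min (hex s) (by omega))
  have hkk : k₀ ≤ k := by
    by_contra hlt
    have := hTmono (show k + 1 ≤ k₀ by omega)
    linarith
  have h3 : ‖c.base + chart Es F₁ (P^[k] x) - c.base‖ < min B⁻¹ (e / (B + 1)) := by
    rw [add_sub_cancel_left]
    refine lt_of_le_of_lt ((norm_chart_le Es hF _).trans ?_) (hk₀ k hkk)
    have := hdecay k
    linarith
  have hst : s - T k ∈ Icc 0 (2 * c.period) := by
    refine ⟨by linarith, ?_⟩
    have := h.le_two _ (hxr k)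
    rw [hTs] at h1
    linarith
  obtain ⟨a1, a2, -⟩ := hB _ hst c.base c.base_mem_orbit
  have h4 := a2.lipschitz_center (h3.le.trans (min_le_left _ _))
  have h5 := a1 _ (h3.le.trans (min_le_left _ _))
  rw [← (hTk k).2] at h5
  have h6 : R.map s (c.base + chart Es F₁ x) =
      R.map (s - T k) (c.base + chart Es F₁ (P^[k] x)) := by
    rw [← (hTk k).2, ← (hTk k).1.map_add h5, add_sub_cancel]
  rw [h6]
  refine (c.distTo_le (c.map_mem_orbit c.base_mem_orbit hst.1) _).trans_lt (h4.trans_lt ?_)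
  have h7 := h3.trans_le (min_le_right _ _)
  rw [lt_div_iff₀ (by positivity)] at h7
  linarith

/-- The local unstable manifold contains the backward orbits of the Poincaré map that decay. -/
lemma mem_unstableManifold {Eu : Submodule ℝ Γ} {μ lam : ℝ} {pr : Γ →L[ℝ] ℝ × Es} {ℓ : Γ →L[ℝ] ℝ}
    (co : c.Coordinates Eu Es F₁ μ lam pr ℓ) (h : c.LocalPoincare Es F₁ P p r C) {ρ e q : ℝ}
    (hq : 1 < q) (her : e ≤ r) (heρ : 2 * e ≤ ρ) (hCρ : C * e ≤ ρ) {V : ℕ → ℝ × Es}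
    (hV : ∀ j, P (V (j + 1)) = V j) (hVe : ∀ j, q ^ j * ‖V j‖ ≤ e) :
    c.base + chart Es F₁ (V 0) ∈ c.unstableManifold Eu Es ρ := by
  have hle : ∀ j, ‖V j‖ ≤ e := fun j =>
    (le_mul_of_one_le_left (norm_nonneg _) (one_le_pow₀ hq.le)).trans (hVe j)
  have hsec : ∀ x, c.base + chart Es F₁ x ∈ c.poincareSection Eu Es := fun x => by
    change c.base + chart Es F₁ x - c.base ∈ Eu ⊔ Es
    rw [add_sub_cancel_left, co.mem_iff, co.ℓ_chart]
  refine ⟨fun j => c.base + chart Es F₁ (V j), rfl, fun k => ⟨?_, hsec _, hsec _,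
    p (V (k + 1)), ?_, h.alive _ ((hle _).trans her), ?_⟩, ?_⟩
  · rw [add_sub_cancel_left]
    refine (norm_chart_le Es co.ne_zero _).trans ?_
    linarith [hle k]
  · refine (h.time_le _ ((hle _).trans her)).trans (le_trans ?_ hCρ)
    exact mul_le_mul_of_nonneg_left (hle _) h.C_nonneg
  · rw [h.map_eq _ ((hle _).trans her), hV]
  · have h0 : Tendsto V atTop (𝓝 0) := by
      refine squeeze_zero_norm (a := fun j => e * q⁻¹ ^ j) (fun j => ?_) ?_
      · have := hVe j
        rw [inv_pow, ← div_eq_mul_inv, le_div_iff₀ (by positivity)]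
        linarith
      · simpa using (tendsto_pow_atTop_nhds_zero_of_lt_one (by positivity)
          (inv_lt_one_of_one_lt₀ hq)).const_mul e
    have h1 : Tendsto (fun j => c.base + chart Es F₁ (V j)) atTop
        (𝓝 (c.base + chart Es F₁ 0)) :=
      (((chart Es F₁).continuous.tendsto 0).comp h0).const_add _
    simpa using h1

end LocalPoincare

end LimitCycle

/-! ### Exit through the tubes. -/

namespace LimitCycle

variable {Γ : Type*} [NormedAddCommGroup Γ] [NormedSpace ℝ Γ] {n : ℕ} {R : RGFlow Γ n}
  {c : LimitCycle R} {Eu Es : Submodule ℝ Γ} {F₁ : Γ} {μ lam : ℝ} {pr : Γ →L[ℝ] ℝ × Es}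
  {ℓ : Γ →L[ℝ] ℝ}

lemma isClosed_stable_of_coordinates (co : c.Coordinates Eu Es F₁ μ lam pr ℓ) :
    IsClosed (Es : Set Γ) := by
  have e : (Es : Set Γ) = {W | ((pr W).2 : Γ) = W} := by
    ext W
    constructor
    · intro hW
      have := co.pr_chart (0, ⟨W, hW⟩)
      rw [chart_apply] at this
      simp only [zero_smul, zero_add] at this
      change ((pr W).2 : Γ) = W
      rw [this]
    · intro hW
      have hW : ((pr W).2 : Γ) = W := hW
      rw [← hW]; exact (pr W).2.2
  rw [e]
  exact isClosed_eq (continuous_subtype_val.comp pr.continuous.snd) continuous_id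

/-- Orbits that are separated in the unstable direction from an orbit on the stable manifold leave
through the exit tube of the corresponding side, at a time determined by the initial separation up
to a bounded error. -/
lemma LocalPoincare.exists_exitTube [CompleteSpace Γ] {κ : ℝ}
    (co : c.Coordinates Eu Es F₁ (Real.exp (κ * c.period)) lam pr ℓ) (hκ : 0 < κ)
    {P : ℝ × Es → ℝ × Es} {p : ℝ × Es → ℝ} {r C θ α C' : ℝ} (h : c.LocalPoincare Es F₁ P p r C)
    (hP : SaddleMap P (Real.exp (κ * c.period)) θ α C')
    (hθ : Real.exp (κ * c.period) + θ < Real.exp (κ * c.period) ^ 2)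
    {ρ ε δ₃ : ℝ} (hε : 0 < ε) (hεr : ε ≤ r) (hερ : 2 * ε ≤ ρ) (hCρ : C * ε ≤ ρ) (hδ₃ : 0 < δ₃) :
    ∃ δ₄ > 0, ∃ B, ∀ σ : ℝ, |σ| = 1 → ∀ x y : ℝ × Es, ‖x‖ ≤ δ₄ → ‖y‖ ≤ δ₄ →
      (∀ j, ‖P^[j] y‖ ≤ α ^ j * ‖y‖) → ‖x.2 - y.2‖ ≤ σ * (x.1 - y.1) → 0 < σ * (x.1 - y.1) →
      ∃ T, R.Alive T (c.base + chart Es F₁ x) ∧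
        R.map T (c.base + chart Es F₁ x) ∈ c.exitTube Eu Es F₁ κ ρ σ ε δ₃ ∧
        |Real.log (σ * (x.1 - y.1)) + κ * T| ≤ B := by
  have : CompleteSpace Es := (isClosed_stable_of_coordinates co).completeSpace_coe
  set μ := Real.exp (κ * c.period) with hμ
  have h1 := hP.one_lt
  have h2 := hP.α_lt
  have h3 := hP.θ_nonneg
  have h4 := hP.α_nonneg
  have hμ1 : 1 < μ := by linarith
  have hμθ : 1 < μ + θ := by linarith
  have hlogμ : Real.log μ = κ * c.period := Real.log_exp _
  -- With D = (1 - w)ε as separation threshold and wε bounding the reference orbit, the amplitude at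
  -- exit stays in [ε μ⁻², ε]; the lower end fits with equality in `hrange`.
  set w := (1 - (μ + θ) / μ ^ 2) / (1 + μ + θ) with hw
  have hfrac : (μ + θ) / μ ^ 2 < 1 := by rw [div_lt_one (by positivity)]; exact hθ
  have hw0 : 0 < w := div_pos (by linarith) (by linarith)
  have hwe : w * (1 + μ + θ) = 1 - (μ + θ) / μ ^ 2 := by
    rw [hw, div_mul_cancel₀]; linarith
  have hw1 : w < 1 := by
    have : 0 < (μ + θ) / μ ^ 2 := by positivity
    nlinarith
  set D := (1 - w) * ε with hD
  have hD0 : 0 < D := mul_pos (by linarith) hε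
  have hrange : ε * (μ ^ 2)⁻¹ + w * ε ≤ D / (μ + θ) := by
    rw [le_div_iff₀ (by linarith)]
    have : (μ ^ 2)⁻¹ * (μ + θ) = (μ + θ) / μ ^ 2 := by rw [div_eq_inv_mul]
    have e : (ε * (μ ^ 2)⁻¹ + w * ε) * (μ + θ) = ε * ((μ ^ 2)⁻¹ * (μ + θ) + w * (μ + θ)) := by ring
    rw [e, this, hD, mul_comm (1 - w) ε]
    gcongr
    linarith
  -- After `k₀` steps the distance to the local unstable manifold is below δ₃: the chart costs 2,
  -- and the initial distance is at most 2ε. The second term of `δ₄` below delays the exit at least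
  -- that long.
  obtain ⟨k₀, hk₀⟩ := ((tendsto_pow_atTop_nhds_zero_of_lt_one h4 h2).eventually_lt_const
    (show 0 < δ₃ / (4 * ε) by positivity)).exists
  set δ₄ := min (w * ε) (D / (2 * (μ + θ) ^ (k₀ + 1))) with hδ₄
  have hpk : 0 < (μ + θ) ^ (k₀ + 1) := by positivity
  have hδ₄0 : 0 < δ₄ := by positivity
  have hδw : δ₄ ≤ w * ε := min_le_left _ _
  have hwε : w * ε ≤ ε := by nlinarith
  have hδD : δ₄ * (2 * (μ + θ) ^ (k₀ + 1)) ≤ D := by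
    rw [← le_div_iff₀ (by positivity)]; exact min_le_right _ _
  set S := w * ε * (1 - α)⁻¹ + D * (μ - θ - 1)⁻¹ with hS
  refine ⟨δ₄, hδ₄0, C' * S + (|Real.log D| + Real.log (μ + θ)) + κ * (C * S),
    fun σ hσ x y hx hy hys hxy hd => ?_⟩
  have hσσ : σ * σ = 1 := by rw [← abs_mul_abs_self, hσ, one_mul]
  have hd2 : σ * (x.1 - y.1) ≤ 2 * δ₄ := by
    have e1 : σ * (x.1 - y.1) ≤ |x.1 - y.1| := by
      refine (le_abs_self _).trans ?_
      rw [abs_mul, hσ, one_mul]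
    have e2 : |x.1 - y.1| ≤ ‖x - y‖ := norm_fst_le (x - y)
    linarith [norm_sub_le x y]
  have hdD : σ * (x.1 - y.1) ≤ D := by
    have : δ₄ * 2 * 1 ≤ δ₄ * 2 * (μ + θ) ^ (k₀ + 1) := by gcongr; exact one_le_pow₀ hμθ.le
    linarith
  have hyb : ∀ j, ‖P^[j] y‖ ≤ α ^ j * (w * ε) := fun j =>
    (hys j).trans (mul_le_mul_of_nonneg_left (hy.trans hδw) (pow_nonneg h4 j))
  obtain ⟨k, g1, g2, g3, g4, g5, g6⟩ := hP.exists_exit hσ (b := w * ε) (D := D) (by positivity)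
    hyb hxy hd hdD
  have hbD : w * ε + D = ε := by rw [hD]; ring
  rw [hbD] at g4
  set d := σ * ((P^[k] x).1 - (P^[k] y).1) with hdk
  have hkk : k₀ ≤ k := by
    by_contra hlt
    have e1 : (μ + θ) ^ (k + 1) ≤ (μ + θ) ^ (k₀ + 1) := pow_le_pow_right₀ hμθ.le (by omega)
    have e2 : (μ + θ) ^ (k + 1) * (σ * (x.1 - y.1)) ≤ (μ + θ) ^ (k₀ + 1) * (2 * δ₄) := by gcongr
    linarith
  obtain ⟨f1, f2⟩ := h.iterate (x := x) (k := k) fun j hj => (g4 j hj.le).trans hεr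
  set T := ∑ j ∈ Finset.range k, p (P^[j] x) with hT
  have hd0 : 0 < d := by
    by_contra hle
    have := mul_nonpos_of_nonneg_of_nonpos (by linarith : 0 ≤ μ + θ) (not_lt.1 hle)
    linarith
  have hdlow : D / (μ + θ) ≤ d := by
    rw [div_le_iff₀ (by linarith)]; linarith
  -- the point lies in the exit tube
  have hyk : |σ * (P^[k] y).1| ≤ w * ε := by
    rw [abs_mul, hσ, one_mul]
    refine (norm_fst_le (P^[k] y)).trans ((hyb k).trans ?_)
    exact mul_le_of_le_one_left (by positivity) (pow_le_one₀ h4 h2.le)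
  have ha : σ * (P^[k] x).1 = d + σ * (P^[k] y).1 := by rw [hdk]; ring
  rw [abs_le] at hyk
  have hup : σ * (P^[k] x).1 ≤ ε := by linarith
  have hlow : ε * (μ ^ 2)⁻¹ ≤ σ * (P^[k] x).1 := by linarith
  have habs : |(P^[k] x).1| ≤ ε := by
    have : |(P^[k] x).1| = |σ * (P^[k] x).1| := by rw [abs_mul, hσ, one_mul]
    rw [this, abs_of_nonneg (le_trans (by positivity) hlow)]
    exact hup
  obtain ⟨V, v1, v2, v3⟩ := hP.exists_backward_orbit_near x k
  have hVmem := h.mem_unstableManifold co h1 hεr hερ hCρ v1 fun j => (v2 j).trans habs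
  have hexp : Real.exp (-2 * κ * c.period) = (μ ^ 2)⁻¹ := by
    rw [hμ, ← Real.exp_nat_mul, ← Real.exp_neg]; congr 1; push_cast; ring
  refine ⟨T, f1, ?_, ?_⟩
  · rw [f2]
    refine ⟨⟨σ * (P^[k] x).1, (P^[k] x).2, (P^[k] x).2.2, ?_, ?_, hup⟩, ?_⟩
    · rw [← mul_assoc, hσσ, one_mul, chart_apply, add_assoc]
    · rw [hexp]; exact hlow
    · refine (infDist_le_dist_of_mem hVmem).trans ?_
      rw [dist_eq_norm, add_sub_add_left_eq_sub, ← map_sub]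
      refine (norm_chart_le Es co.ne_zero _).trans ?_
      have e1 : α ^ k ≤ δ₃ / (4 * ε) := (pow_le_pow_of_le_one h4 h2.le hkk).trans hk₀.le
      have e2 : ‖x‖ + |(P^[k] x).1| ≤ 2 * ε := by linarith
      have e3 : α ^ k * (‖x‖ + |(P^[k] x).1|) ≤ δ₃ / (4 * ε) * (2 * ε) := by gcongr
      have e4 : δ₃ / (4 * ε) * (2 * ε) = δ₃ / 2 := by field_simp; ring
      linarith
  -- Return times differ from Δ by a multiple of the norm, and the norms up to the exit have a
  -- bounded sum.
  · have hTk : |T - k * c.period| ≤ C * S := by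
      have e : T - k * c.period = ∑ j ∈ Finset.range k, (p (P^[j] x) - c.period) := by
        rw [Finset.sum_sub_distrib, Finset.sum_const, Finset.card_range, nsmul_eq_mul]
      rw [e]
      refine (Finset.abs_sum_le_sum_abs _ _).trans ?_
      calc ∑ j ∈ Finset.range k, |p (P^[j] x) - c.period|
          ≤ ∑ j ∈ Finset.range k, C * max ‖P^[j] x‖ ‖P^[j] y‖ := by
            refine Finset.sum_le_sum fun j hj => ?_
            refine (h.time_le _ ((g4 j (Finset.mem_range.1 hj).le).trans hεr)).trans ?_
            exact mul_le_mul_of_nonneg_left (le_max_left _ _) h.C_nonneg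
        _ ≤ C * S := by
            rw [← Finset.mul_sum]
            exact mul_le_mul_of_nonneg_left g5 h.C_nonneg
    have hlogd : |Real.log d| ≤ |Real.log D| + Real.log (μ + θ) := by
      have e1 : Real.log d ≤ Real.log D := Real.log_le_log hd0 g3
      have e2 : Real.log D - Real.log (μ + θ) ≤ Real.log d := by
        rw [← Real.log_div hD0.ne' (by linarith)]
        exact Real.log_le_log (by positivity) hdlow
      have e3 := Real.log_pos hμθ
      rw [abs_le]
      constructor
      · linarith [neg_abs_le (Real.log D)]
      · linarith [le_abs_self (Real.log D)]
    have hκT : |κ * (T - k * c.period)| ≤ κ * (C * S) := by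
      rw [abs_mul, abs_of_pos hκ]; gcongr
    -- Since log μ = κΔ, the unbounded term k log μ cancels against κ k Δ.
    have e : Real.log (σ * (x.1 - y.1)) + κ * T =
        -(Real.log d - Real.log (σ * (x.1 - y.1)) - k * Real.log μ) + Real.log d +
          κ * (T - k * c.period) := by
      rw [hlogμ]; ring
    rw [e]
    refine (abs_add_le _ _).trans (add_le_add ((abs_add_le _ _).trans (add_le_add ?_ hlogd)) hκT)
    rw [abs_neg]; exact g6

/-! ### Transversality of the relevant mode. -/

/-- Near `U_lc^{(s)}` the flow maps the direction of the relevant mode into the unstable cone of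
the Poincaré section. -/
structure Transversal (c : LimitCycle R) (Es : Submodule ℝ Γ) (F₁ : Γ) (s C : ℝ)
    (Q : Γ → ℝ × Es) (τ : Γ → ℝ) : Prop where
  norm_mode : ‖c.relevantMode F₁ s‖ = 1
  alive : ∀ U, ‖U - c.point s‖ ≤ C⁻¹ → R.Alive (τ U) U
  map_eq : ∀ U, ‖U - c.point s‖ ≤ C⁻¹ → R.map (τ U) U = c.base + chart Es F₁ (Q U)
  time_le : ∀ U, ‖U - c.point s‖ ≤ C⁻¹ → |τ U| ≤ C
  norm_le : ∀ U, ‖U - c.point s‖ ≤ C⁻¹ → ‖Q U‖ ≤ C * ‖U - c.point s‖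
  continuousOn : ContinuousOn Q {U | ‖U - c.point s‖ ≤ C⁻¹}
  cone : ∀ U b σ, |σ| = 1 → σ * b = |b| → ‖U - c.point s‖ ≤ C⁻¹ →
    ‖U + b • c.relevantMode F₁ s - c.point s‖ ≤ C⁻¹ →
    C⁻¹ * |b| ≤ σ * ((Q (U + b • c.relevantMode F₁ s)).1 - (Q U).1) ∧
    σ * ((Q (U + b • c.relevantMode F₁ s)).1 - (Q U).1) ≤ C * |b| ∧
    2 * ‖(Q (U + b • c.relevantMode F₁ s)).2 - (Q U).2‖ ≤
      σ * ((Q (U + b • c.relevantMode F₁ s)).1 - (Q U).1)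

/-- Transport of F₁ to `c.point s` and on to the base yields μ² F₁, so the derivative of the return
map along the normalized mode is (g, 0), with g bounded above and below uniformly in s. On a small
ball the quadratic remainder is a quarter of the lower bound. -/
lemma SmoothData.exists_transversal [CompleteSpace Γ] {δ : ℝ} {f' : ℝ × Γ → ℝ × Γ →L[ℝ] Γ}
    {K : NNReal} (H : c.SmoothData δ f' K) (co : c.Coordinates Eu Es F₁ μ lam pr ℓ) :
    ∃ C, 1 ≤ C ∧ ∀ s ∈ Ico 0 c.period, ∃ Q τ, c.Transversal Es F₁ s C Q τ := by
  have hp := c.period_pos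
  have hμ := co.one_lt
  have hF : 0 < ‖F₁‖ := norm_pos_iff.2 co.ne_zero
  obtain ⟨C₁, hC₁⟩ := H.exists_returnMap co
  obtain ⟨C₂, hC₂⟩ := H.exists_uniformQuad (2 * c.period)
  set B := max C₁ C₂ with hB
  have hU := hC₂.mono le_rfl (le_max_right C₁ C₂)
  have hB1 : 1 ≤ B := hU.one_le (by positivity)
  -- The term 4B² makes the remainder B C⁻¹|b| at most (4B)⁻¹|b|; the term 2Δ accounts for the
  -- return time.
  set C := 4 * B ^ 2 + 2 * c.period + B + 1 with hC
  have hBB : B ≤ B ^ 2 := by nlinarith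
  have hC1 : 1 ≤ C := by nlinarith
  have hCB : B ≤ C := by nlinarith
  have hinv : C⁻¹ ≤ B⁻¹ := inv_anti₀ (by linarith) hCB
  have hBC : B * C⁻¹ ≤ (4 * B)⁻¹ := by
    rw [← div_eq_mul_inv, div_le_iff₀ (by linarith), inv_mul_eq_div, le_div_iff₀ (by positivity)]
    nlinarith
  have h4B : (4 * B)⁻¹ ≤ 1 := inv_le_one_of_one_le₀ (by linarith)
  refine ⟨C, hC1, fun s hs => ?_⟩
  obtain ⟨Q, τ, hQ⟩ := hC₁ s ⟨hs.1, hs.2.le⟩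
  have hquad := hQ.quad.mono (le_max_left C₁ C₂)
  have hC₁1 := hQ.quad.one_le
  have hinv₁ : C⁻¹ ≤ C₁⁻¹ := hinv.trans (inv_anti₀ (by linarith) (le_max_left _ _))
  set e := R.tangentMap s c.base F₁ with he
  have hTe : R.tangentMap (2 * c.period - s) (c.point s) e = (μ ^ 2) • F₁ := by
    rw [he, H.tangentMap_two_period hs.1 (by linarith [hs.2]), co.monodromy_mode, map_smul,
      co.monodromy_mode, smul_smul, sq]
  have hn1 : ‖e‖ ≤ B * ‖F₁‖ := by
    have := (hU s ⟨hs.1, by linarith [hs.2]⟩ c.base c.base_mem_orbit).2.1.norm_le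
    exact ((R.tangentMap _ _).le_opNorm _).trans (by gcongr)
  have hn2 : μ ^ 2 * ‖F₁‖ ≤ B * ‖e‖ := by
    have := (hU (2 * c.period - s) ⟨by linarith [hs.2], by linarith [hs.1]⟩ (c.point s)
      (c.point_mem_orbit hs.1)).2.1.norm_le
    have h1 : ‖R.tangentMap (2 * c.period - s) (c.point s) e‖ ≤ B * ‖e‖ :=
      ((R.tangentMap _ _).le_opNorm _).trans (by gcongr)
    rwa [hTe, norm_smul, Real.norm_of_nonneg (by positivity)] at h1
  have hn0 : 0 < ‖e‖ := by
    have : 0 < μ ^ 2 * ‖F₁‖ := by positivity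
    nlinarith [norm_nonneg e]
  set g := μ ^ 2 * ‖F₁‖ / ‖e‖ with hg
  have hg1 : B⁻¹ ≤ g := by
    rw [hg, le_div_iff₀ hn0]
    calc B⁻¹ * ‖e‖ ≤ B⁻¹ * (B * ‖F₁‖) := by gcongr
      _ = 1 * ‖F₁‖ := by field_simp
      _ ≤ μ ^ 2 * ‖F₁‖ := by gcongr; nlinarith
  have hg2 : g ≤ B := by rw [hg, div_le_iff₀ hn0]; exact hn2
  have hmode : c.relevantMode F₁ s = ‖e‖⁻¹ • e := rfl
  have hL : ∀ b : ℝ, (pr.comp (R.tangentMap (2 * c.period - s) (c.point s)))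
      (b • c.relevantMode F₁ s) = (b * g, 0) := by
    intro b
    have hF1 : F₁ = chart Es F₁ (‖F₁‖, 0) := by
      rw [chart_apply, smul_smul, mul_inv_cancel₀ hF.ne', one_smul]; simp
    have hprF : pr F₁ = (‖F₁‖, 0) := by
      conv_lhs => rw [hF1]
      exact co.pr_chart _
    rw [hmode, ContinuousLinearMap.comp_apply]
    simp only [map_smul, hTe, hprF]
    ext
    · simp only [Prod.smul_mk, smul_eq_mul, hg]
      field_simp
    · simp
  refine ⟨Q, τ, ?_, fun U hU => hQ.alive U (hU.trans hinv₁), fun U hU => hQ.map_eq U (hU.trans hinv₁),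
    ?_, ?_, ?_, ?_⟩
  · rw [hmode, norm_smul, norm_inv, norm_norm, inv_mul_cancel₀ hn0.ne']
  · intro U hU
    have h1 := hQ.time_le U (hU.trans hinv₁)
    have h2 : C₁ * ‖U - c.point s‖ ≤ B * C⁻¹ := by gcongr; exact le_max_left _ _
    have h3 := abs_le.1 (h1.trans h2)
    rw [abs_le]
    constructor <;> linarith [h3.1, h3.2, hs.1, hs.2, sq_nonneg B]
  · intro U hU
    have := hquad.lipschitz_center (hU.trans hinv)
    rw [hQ.center, sub_zero] at this
    refine this.trans ?_
    gcongr
    linarith [sq_nonneg B]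
  · refine (LipschitzOnWith.of_dist_le_mul (K := ⟨B + 1, by linarith⟩) fun U hU V hV => ?_).continuousOn
    rw [dist_eq_norm, dist_eq_norm]
    exact hquad.lipschitz (hU.trans hinv) (hV.trans hinv)
  · intro U b σ hσ hσb hU1 hU2
    set W := U + b • c.relevantMode F₁ s with hW
    have h1 := hquad.est W U (hU2.trans hinv) (hU1.trans hinv)
    have hWU : W - U = b • c.relevantMode F₁ s := by rw [hW]; abel
    have hnb : ‖W - U‖ = |b| := by
      rw [hWU, hmode, norm_smul, norm_smul, norm_inv, norm_norm, inv_mul_cancel₀ hn0.ne', mul_one,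
        Real.norm_eq_abs]
    rw [hnb, hWU, hL] at h1
    have h2 : ‖Q W - Q U - (b * g, 0)‖ ≤ (4 * B)⁻¹ * |b| := by
      refine h1.trans ?_
      gcongr
      refine le_trans ?_ hBC
      gcongr
      exact max_le hU2 hU1
    have h3 : |(Q W).1 - (Q U).1 - b * g| ≤ (4 * B)⁻¹ * |b| := (norm_fst_le _).trans h2
    have h4 : ‖(Q W).2 - (Q U).2‖ ≤ (4 * B)⁻¹ * |b| := by
      have := (norm_snd_le _).trans h2
      simpa using this
    have h5 : |σ * ((Q W).1 - (Q U).1) - g * (|b|)| ≤ (4 * B)⁻¹ * |b| := by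
      have : σ * ((Q W).1 - (Q U).1) - g * (|b|) = σ * ((Q W).1 - (Q U).1 - b * g) := by
        rw [← hσb]; ring
      rw [this, abs_mul, hσ, one_mul]; exact h3
    have h6 : 4 * (4 * B)⁻¹ = B⁻¹ := by field_simp
    have h7 : B⁻¹ * |b| ≤ g * |b| := by gcongr
    have h8 : g * |b| ≤ B * |b| := by gcongr
    have h9 : (4 * B)⁻¹ * |b| ≤ 1 * |b| := by gcongr
    have h10 : C⁻¹ * |b| ≤ (4 * B)⁻¹ * |b| := by
      gcongr
      nlinarith
    have h11 : (B + 1) * |b| ≤ C * |b| := by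
      gcongr
      linarith [sq_nonneg B]
    have h12 : B⁻¹ * |b| = 4 * ((4 * B)⁻¹ * |b|) := by rw [← h6]; ring
    have h13 : 0 ≤ (4 * B)⁻¹ * |b| := by positivity
    rw [abs_le] at h5
    refine ⟨by linarith [h5.1], by linarith [h5.2], by linarith [h5.1]⟩

end LimitCycle

/-! ### Decomposition of near-critical data. -/

namespace LimitCycle

variable {Γ : Type*} [NormedAddCommGroup Γ] [NormedSpace ℝ Γ] {n : ℕ} {R : RGFlow Γ n}
  {c : LimitCycle R} {Eu Es : Submodule ℝ Γ} {F₁ : Γ} {lam : ℝ} {pr : Γ →L[ℝ] ℝ × Es}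
  {ℓ : Γ →L[ℝ] ℝ}

/-- If no point of the exit tubes lies on the stable manifold, then data off the stable manifold
decompose, and decomposed data leave through the exit tubes. -/
lemma exists_decomposition [CompleteSpace Γ] {κ : ℝ} {δ₀ : ℝ} {f' : ℝ × Γ → ℝ × Γ →L[ℝ] Γ}
    {K : NNReal} (H : c.SmoothData δ₀ f' K)
    (co : c.Coordinates Eu Es F₁ (Real.exp (κ * c.period)) lam pr ℓ) (hκ : 0 < κ)
    {P : ℝ × Es → ℝ × Es} {p : ℝ × Es → ℝ} {r C θ α C' : ℝ} (h : c.LocalPoincare Es F₁ P p r C)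
    (hP : SaddleMap P (Real.exp (κ * c.period)) θ α C')
    (hθ : Real.exp (κ * c.period) + θ < Real.exp (κ * c.period) ^ 2)
    {ρ ε δ₃ : ℝ} (hε : 0 < ε) (hεr : ε ≤ r) (hερ : 2 * ε ≤ ρ) (hCρ : C * ε ≤ ρ) (hδ₃ : 0 < δ₃)
    (hfate : ∀ σ : ℝ, |σ| = 1 → ∀ U ∈ c.exitTube Eu Es F₁ κ ρ σ ε δ₃, U ∉ c.stableManifold)
    {dm : ℝ} (hdm : 0 < dm) :
    ∃ δ > 0, δ ≤ dm ∧
      (∃ δ' > 0, ∀ U, c.distTo U < δ' → U ∉ c.stableManifold →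
        ∃ s₀ b Uperp, b ≠ 0 ∧ c.DecomposedAt Eu Es F₁ δ s₀ b Uperp U) ∧
      (∀ s₀ b Uperp U, c.DecomposedAt Eu Es F₁ δ s₀ b Uperp U → c.distTo U ≤ 2 * δ) ∧
      (∃ B, ∀ s₀ b Uperp U, c.DecomposedAt Eu Es F₁ δ s₀ b Uperp U → b ≠ 0 →
        ∀ σ : ℝ, |σ| = 1 → σ * b = |b| → ∃ T, R.Alive T U ∧
          R.map T U ∈ c.exitTube Eu Es F₁ κ ρ σ ε δ₃ ∧ |Real.log |b| + κ * T| ≤ B) ∧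
      (∀ ζ > 0, ∃ b₀ > 0, ∀ s₀ b Uperp U, c.DecomposedAt Eu Es F₁ δ s₀ b Uperp U →
        b ≠ 0 → |b| ≤ b₀ → ∃ s, R.Alive s U ∧ c.distTo (R.map s U) < ζ) := by
  have hr := h.pos
  obtain ⟨δ₄, hδ₄, B, hB⟩ := h.exists_exitTube co hκ hP hθ hε hεr hερ hCρ hδ₃
  obtain ⟨A, hA1, hA⟩ := H.exists_transversal co
  set μ := Real.exp (κ * c.period)
  have h1 := hP.one_lt
  have h3 := hP.θ_nonneg
  have hν : 1 < μ + θ := by linarith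
  -- The division leaves room for the one expanding step with which an orbit may enter the unstable
  -- cone.
  set δ₆ := min δ₄ (r / 2) / (μ + θ) with hδ₆
  have hδ₆0 : 0 < δ₆ := by positivity
  have hδ₆ν : (μ + θ) * δ₆ = min δ₄ (r / 2) := by rw [hδ₆]; field_simp
  have hδ₆le : δ₆ ≤ min δ₄ (r / 2) := by
    rw [← hδ₆ν]; exact le_mul_of_one_le_left hδ₆0.le hν.le
  have hδ₆4 : δ₆ ≤ δ₄ := hδ₆le.trans (min_le_left _ _)
  have hδ₆r : δ₆ ≤ r / 2 := hδ₆le.trans (min_le_right _ _)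
  -- near the origin, points of the stable manifold stay in the stable cone
  have hstab : ∀ y : ℝ × Es, ‖y‖ ≤ δ₆ → c.base + chart Es F₁ y ∈ c.stableManifold →
      ∀ k, |(P^[k] y).1| ≤ ‖(P^[k] y).2‖ := by
    intro y hy hys
    -- An orbit that enters the cone is compared with the fixed point 0 and reaches an exit tube,
    -- which contains no point of the stable manifold.
    refine (hP.stable_or_enters y).resolve_right ?_
    rintro ⟨i, hi, hle⟩
    have hle' : ∀ j ≤ i, ‖P^[j] y‖ ≤ min δ₄ (r / 2) := fun j hj => by
      refine (hle j hj).trans ?_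
      rw [← hδ₆ν]; gcongr
    obtain ⟨a1, a2⟩ := h.iterate (x := y) (k := i) fun j hj =>
      ((hle' j hj.le).trans (min_le_right _ _)).trans (by linarith)
    obtain ⟨σ, hσ, hσe⟩ := SaddleMap.exists_sign (P^[i] y).1
    obtain ⟨T, b1, b2, -⟩ := hB σ hσ (P^[i] y) 0 ((hle' i le_rfl).trans (min_le_left _ _))
      (by simpa using hδ₄.le) (fun j => by simp [hP.iterate_zero_point])
      (by simpa [hσe] using hi.le) (by
        simp only [Prod.fst_zero, sub_zero, hσe]
        exact (norm_nonneg _).trans_lt hi)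
    refine hfate σ hσ _ b2 (map_mem_stableManifold (R.alive_nonneg _ _ b1) ?_)
    rw [← a2]
    exact map_mem_stableManifold (R.alive_nonneg _ _ a1) hys
  set δ := min dm (min (2 * A)⁻¹ (δ₆ / (2 * A))) with hδ
  have hδ0 : 0 < δ := by positivity
  have hδA : 2 * δ ≤ A⁻¹ := by
    have : δ ≤ (2 * A)⁻¹ := (min_le_right _ _).trans (min_le_left _ _)
    rw [mul_inv] at this
    linarith
  have hδ₆A : A * (2 * δ) ≤ δ₆ := by
    have : δ ≤ δ₆ / (2 * A) := (min_le_right _ _).trans (min_le_right _ _)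
    rw [le_div_iff₀ (by positivity)] at this
    linarith
  have hdist : ∀ s₀ b Uperp U, c.DecomposedAt Eu Es F₁ δ s₀ b Uperp U →
      ‖U - c.point s₀‖ ≤ 2 * δ := by
    rintro s₀ b Uperp U ⟨hs, -, -, hn, hb, rfl⟩
    obtain ⟨Q, τ, hQ⟩ := hA s₀ hs
    rw [add_sub_right_comm]
    refine (norm_add_le _ _).trans ?_
    rw [norm_smul, hQ.norm_mode, mul_one, Real.norm_eq_abs]
    linarith
  -- the images of a decomposed datum and of its stable part in the Poincaré section
  have hsetup : ∀ s₀ b Uperp U, c.DecomposedAt Eu Es F₁ δ s₀ b Uperp U → ∀ σ : ℝ, |σ| = 1 →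
      σ * b = |b| → ∃ (x y : ℝ × Es) (t : ℝ), |t| ≤ A ∧ R.Alive t U ∧
        R.map t U = c.base + chart Es F₁ x ∧ ‖x‖ ≤ δ₆ ∧ ‖y‖ ≤ δ₆ ∧
        (∀ j, ‖P^[j] y‖ ≤ α ^ j * ‖y‖) ∧ ‖x.2 - y.2‖ ≤ σ * (x.1 - y.1) ∧
        A⁻¹ * |b| ≤ σ * (x.1 - y.1) ∧ σ * (x.1 - y.1) ≤ A * |b| := by
    intro s₀ b Uperp U hdec σ hσ hσb
    have hU := (hdist _ _ _ _ hdec)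
    obtain ⟨hs, hst, -, hn, hb, rfl⟩ := hdec
    obtain ⟨Q, τ, hQ⟩ := hA s₀ hs
    have hU' := hU.trans hδA
    have hn' : ‖Uperp - c.point s₀‖ ≤ A⁻¹ := hn.trans (by linarith)
    obtain ⟨c1, c2, c3⟩ := hQ.cone Uperp b σ hσ hσb hn' hU'
    have hy : ‖Q Uperp‖ ≤ δ₆ := (hQ.norm_le _ hn').trans
      (le_trans (by gcongr; linarith) hδ₆A)
    have hyW : c.base + chart Es F₁ (Q Uperp) ∈ c.stableManifold := by
      rw [← hQ.map_eq _ hn']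
      exact map_mem_stableManifold (R.alive_nonneg _ _ (hQ.alive _ hn')) hst
    have hys := hstab _ hy hyW
    refine ⟨_, Q Uperp, τ _, hQ.time_le _ hU', hQ.alive _ hU', hQ.map_eq _ hU',
      (hQ.norm_le _ hU').trans (le_trans (by gcongr) hδ₆A), hy,
      fun j => hP.norm_iterate_le_of_stable (hys j), ?_, c1, c2⟩
    linarith [norm_nonneg ((Q (Uperp + b • c.relevantMode F₁ s₀)).2 - (Q Uperp).2)]
  refine ⟨δ, hδ0, min_le_left _ _, ?_, ?_, ?_, ?_⟩
  · -- existence of the decomposition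
    -- This makes ‖Q U‖ at most an eighth of the displacement of `Q` caused by t = ±δ/2, so the two
    -- ends of the segment lie strictly in opposite halves of the cone.
    set r' := min (δ / 2) (δ / (16 * A ^ 2)) with hr'
    have hr'0 : 0 < r' := by positivity
    have hr'A : A * r' ≤ A⁻¹ * (δ / 2) / 8 := by
      have : r' ≤ δ / (16 * A ^ 2) := min_le_right _ _
      calc A * r' ≤ A * (δ / (16 * A ^ 2)) := by gcongr
        _ = A⁻¹ * (δ / 2) / 8 := by field_simp; ring
    obtain ⟨δ', hδ', hsec⟩ := H.exists_section co hr'0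
    refine ⟨δ', hδ', fun U hU hUs => ?_⟩
    obtain ⟨s₀, hs₀, ⟨F, hF, hUF⟩, hUr⟩ := hsec U hU
    obtain ⟨Q, τ, hQ⟩ := hA s₀ hs₀
    set e := c.relevantMode F₁ s₀ with he
    have hUA : ‖U - c.point s₀‖ ≤ A⁻¹ := hUr.trans ((min_le_left _ _).trans (by linarith))
    have hline : ∀ t ∈ Icc (-(δ / 2)) (δ / 2), ‖U + t • e - c.point s₀‖ ≤ δ := by
      intro t ht
      rw [add_sub_right_comm]
      refine (norm_add_le _ _).trans ?_
      rw [norm_smul, hQ.norm_mode, mul_one, Real.norm_eq_abs]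
      have := abs_le.2 ht
      have := hUr.trans (min_le_left _ _)
      linarith
    have hlineA : ∀ t ∈ Icc (-(δ / 2)) (δ / 2), ‖U + t • e - c.point s₀‖ ≤ A⁻¹ := fun t ht =>
      (hline t ht).trans (by linarith)
    have hcont : ContinuousOn (fun t : ℝ => Q (U + t • e)) (Icc (-(δ / 2)) (δ / 2)) :=
      hQ.continuousOn.comp (f := fun t : ℝ => U + t • e) (by fun_prop) hlineA
    have hQU : ‖Q U‖ ≤ A⁻¹ * (δ / 2) / 8 :=
      (hQ.norm_le U hUA).trans (le_trans (by gcongr) hr'A)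
    have hQ1 : |(Q U).1| ≤ ‖Q U‖ := norm_fst_le (Q U)
    have hQ2 : ‖(Q U).2‖ ≤ ‖Q U‖ := norm_snd_le (Q U)
    have hpos : 0 < A⁻¹ * (δ / 2) := by positivity
    have hend : ∀ σ : ℝ, |σ| = 1 → ∀ t ∈ Icc (-(δ / 2)) (δ / 2), σ * t = |t| → |t| = δ / 2 →
        ‖(Q (U + t • e)).2‖ < σ * (Q (U + t • e)).1 := by
      intro σ hσ t ht hσt habs
      obtain ⟨c1, -, c3⟩ := hQ.cone U t σ hσ hσt hUA (hlineA t ht)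
      rw [habs] at c1
      have h5 : ‖(Q (U + t • e)).2‖ ≤ ‖(Q (U + t • e)).2 - (Q U).2‖ + ‖(Q U).2‖ := by
        simpa using norm_add_le ((Q (U + t • e)).2 - (Q U).2) (Q U).2
      have h6 : -|(Q U).1| ≤ σ * (Q U).1 := by
        have := neg_abs_le (σ * (Q U).1)
        rwa [abs_mul, hσ, one_mul] at this
      rw [mul_sub] at c1 c3
      linarith
    have hm1 : δ / 2 ∈ Icc (-(δ / 2)) (δ / 2) := ⟨by linarith, le_rfl⟩
    have hm2 : -(δ / 2) ∈ Icc (-(δ / 2)) (δ / 2) := ⟨le_rfl, by linarith⟩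
    have habs : |δ / 2| = δ / 2 := abs_of_pos (by linarith)
    have habs' : |-(δ / 2)| = δ / 2 := by rw [abs_neg, habs]
    obtain ⟨t, ht, hts⟩ := hP.exists_stable_of_crossing isPreconnected_Icc hcont hm1 hm2
      (by simpa using hend 1 (by simp) _ hm1 (by rw [one_mul, habs]) habs)
      (by simpa using hend (-1) (by simp) _ hm2 (by rw [habs']; ring) habs')
    have hW : U + t • e ∈ c.stableManifold := by
      refine mem_stableManifold_of_map (hQ.alive _ (hlineA t ht)) ?_
      rw [hQ.map_eq _ (hlineA t ht)]
      refine h.mem_stableManifold H co.ne_zero hP ?_ hts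
      refine (hQ.norm_le _ (hlineA t ht)).trans ?_
      have : A * ‖U + t • e - c.point s₀‖ ≤ A * (2 * δ) := by
        gcongr
        linarith [hline t ht]
      linarith
    -- If t vanished, U itself would lie on the stable manifold.
    refine ⟨s₀, -t, U + t • e, fun ht0 => hUs ?_, hs₀, hW, ?_, hline t ht, ?_, ?_⟩
    · rw [neg_eq_zero.1 ht0, zero_smul, add_zero] at hW
      exact hW
    · refine ⟨F + t • (‖R.tangentMap s₀ c.base F₁‖⁻¹ • F₁), ?_, ?_⟩
      · refine Submodule.add_mem _ hF (Submodule.smul_mem _ _ (Submodule.smul_mem _ _ ?_))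
        rw [co.mem_iff]
        have : F₁ = chart Es F₁ (‖F₁‖, 0) := by
          rw [chart_apply, smul_smul, mul_inv_cancel₀ (norm_ne_zero_iff.2 co.ne_zero), one_smul]
          simp
        rw [this]; exact co.ℓ_chart _
      · rw [map_add, map_smul, map_smul, ← add_assoc, ← hUF]; rfl
    · rw [abs_neg]
      have := abs_le.2 ht
      linarith
    · rw [neg_smul]; abel
  · intro s₀ b Uperp U hdec
    exact (c.distTo_le (c.point_mem_orbit hdec.1.1) U).trans (hdist _ _ _ _ hdec)
  · refine ⟨B + Real.log A + κ * A, fun s₀ b Uperp U hdec hb σ hσ hσb => ?_⟩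
    obtain ⟨x, y, t, ht, e1, e2, e3, e4, e5, e6, e7, e8⟩ := hsetup _ _ _ _ hdec σ hσ hσb
    have hb0 : 0 < |b| := abs_pos.2 hb
    have hd0 : 0 < σ * (x.1 - y.1) := lt_of_lt_of_le (by positivity) e7
    obtain ⟨T, g1, g2, g3⟩ := hB σ hσ x y (e3.trans hδ₆4) (e4.trans hδ₆4) e5 e6 hd0
    rw [← e2] at g1 g2
    refine ⟨t + T, e1.add g1, by rw [e1.map_add g1]; exact g2, ?_⟩
    have hlog : |Real.log |b| - Real.log (σ * (x.1 - y.1))| ≤ Real.log A := by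
      have l1 := Real.log_le_log (by positivity) e7
      have l2 := Real.log_le_log hd0 e8
      rw [Real.log_mul (by positivity) hb0.ne', Real.log_inv] at l1
      rw [Real.log_mul (by positivity) hb0.ne'] at l2
      rw [abs_le]
      constructor <;> linarith
    have hκt : |κ * t| ≤ κ * A := by rw [abs_mul, abs_of_pos hκ]; gcongr
    have e : Real.log |b| + κ * (t + T) = (Real.log (σ * (x.1 - y.1)) + κ * T) +
        (Real.log |b| - Real.log (σ * (x.1 - y.1))) + κ * t := by ring
    rw [e]
    exact (abs_add_le _ _).trans (add_le_add ((abs_add_le _ _).trans (add_le_add g3 hlog)) hκt)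
  · intro ζ hζ
    -- After a number `j` of steps depending only on ζ the reference orbit is close to the fixed
    -- point; the bound on |b| keeps the separation small for that long.
    obtain ⟨j, hj⟩ := ((tendsto_pow_atTop_nhds_zero_of_lt_one hP.α_nonneg
      hP.α_lt).eventually_lt_const (show 0 < ζ / (8 * δ₆) by positivity)).exists
    refine ⟨min (ζ / 8) (r / 2) / ((μ + θ) ^ j * A), by positivity,
      fun s₀ b Uperp U hdec hb hb₀ => ?_⟩
    obtain ⟨σ, hσ, hσb⟩ := SaddleMap.exists_sign b
    obtain ⟨x, y, t, ht, e1, e2, e3, e4, e5, e6, e7, e8⟩ := hsetup _ _ _ _ hdec σ hσ hσb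
    rw [le_div_iff₀ (by positivity)] at hb₀
    have hxy : ∀ i ≤ j, ‖P^[i] x - P^[i] y‖ ≤ min (ζ / 8) (r / 2) := by
      intro i hi
      obtain ⟨u1, -, u3⟩ := hP.unstable_iterate hσ e6 i
      have n1 : ‖P^[i] x - P^[i] y‖ ≤ σ * ((P^[i] x).1 - (P^[i] y).1) := by
        have hnn : |(P^[i] x).1 - (P^[i] y).1| = σ * ((P^[i] x).1 - (P^[i] y).1) := by
          rw [← abs_of_nonneg ((norm_nonneg _).trans u1), abs_mul, hσ, one_mul]
        rw [SaddleMap.norm_sub_of_le (hnn ▸ u1), hnn]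
      have n2 : (μ + θ) ^ i ≤ (μ + θ) ^ j := pow_le_pow_right₀ hν.le hi
      have hd : 0 ≤ σ * (x.1 - y.1) := (norm_nonneg _).trans e6
      calc _ ≤ (μ + θ) ^ i * (σ * (x.1 - y.1)) := n1.trans u3
        _ ≤ (μ + θ) ^ j * (A * |b|) := by gcongr
        _ = |b| * ((μ + θ) ^ j * A) := by ring
        _ ≤ _ := hb₀
    have hxn : ∀ i ≤ j, ‖P^[i] x‖ ≤ min (ζ / 8) (r / 2) + α ^ i * δ₆ := by
      intro i hi
      have n1 := norm_add_le (P^[i] x - P^[i] y) (P^[i] y)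
      rw [sub_add_cancel] at n1
      refine n1.trans (add_le_add (hxy i hi) ((e5 i).trans ?_))
      exact mul_le_mul_of_nonneg_left e4 (pow_nonneg hP.α_nonneg i)
    obtain ⟨g1, g2⟩ := h.iterate (x := x) (k := j) fun i hi => by
      have n1 : α ^ i * δ₆ ≤ δ₆ :=
        mul_le_of_le_one_left hδ₆0.le (pow_le_one₀ hP.α_nonneg hP.α_lt.le)
      have n2 := min_le_right (ζ / 8) (r / 2)
      linarith [hxn i hi.le]
    rw [← e2] at g1 g2
    refine ⟨_, e1.add g1, ?_⟩
    rw [e1.map_add g1, g2]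
    refine (c.distTo_le c.base_mem_orbit _).trans_lt ?_
    rw [add_sub_cancel_left]
    refine (norm_chart_le Es co.ne_zero _).trans_lt ?_
    rw [lt_div_iff₀ (by positivity)] at hj
    have n2 := min_le_left (ζ / 8) (r / 2)
    linarith [hxn j le_rfl]

/-! ### Mass scaling and the main theorem. -/

/-- The physical radius reached after the time `T + s` with `κ T = - log |b| + O(1)`. -/
lemma radius_bounds {κ β B sHigh b T s : ℝ} (hκ : 0 < κ) (hb : 0 < |b|) (hs : 0 < s)
    (hs2 : s ≤ sHigh) (hT : |Real.log |b| + κ * T| ≤ B) (ξ : Ioi (0 : ℝ)) :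
    (ξ : ℝ) * Real.exp (-(|β| * sHigh + |β / κ| * B)) * |b| ^ (β / κ) ≤ RGFlow.radius β (T + s) ξ ∧
    RGFlow.radius β (T + s) ξ ≤ ξ * Real.exp (|β| * sHigh + |β / κ| * B) * |b| ^ (β / κ) := by
  have hξ : (0 : ℝ) < ξ := ξ.2
  -- The bounded remainder of the exponent -β(T + s) after splitting off (β/κ) log |b|.
  set X := -β * s - β / κ * (Real.log |b| + κ * T) with hX
  have hXle : |X| ≤ |β| * sHigh + |β / κ| * B := by
    rw [hX, sub_eq_add_neg]
    refine (abs_add_le _ _).trans ?_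
    rw [abs_neg, abs_mul, abs_mul, abs_neg, abs_of_pos hs]
    gcongr
  have e : RGFlow.radius β (T + s) ξ = ξ * Real.exp X * |b| ^ (β / κ) := by
    rw [RGFlow.radius, Real.rpow_def_of_pos hb, mul_assoc, ← Real.exp_add, mul_comm]
    congr 2
    rw [hX]
    field_simp
    ring
  rw [e]
  rw [abs_le] at hXle
  have hp : 0 ≤ |b| ^ (β / κ) := by positivity
  constructor
  · gcongr; exact hXle.1
  · gcongr; exact hXle.2

end LimitCycle

theorem theorem2 {Γ : Type*} [NormedAddCommGroup Γ] [NormedSpace ℝ Γ] [CompleteSpace Γ] {n : ℕ}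
    (R : RGFlow Γ n) (c : LimitCycle R) (Eu Es : Submodule ℝ Γ) (N : ℕ) (F₁ : Γ) (κ : ℝ)
    (hsplit : c.HyperbolicSplitting Eu Es N)
    (hsmooth : c.SmoothNear)
    (hrel : c.UniqueRelevantMode Eu N F₁ κ) :
    -- `ρ` and `ε` are sufficiently small, depending only on the flow near the limit cycle
    ∃ ρ₀ > 0, ∀ ρ, 0 < ρ → ρ ≤ ρ₀ → ∃ ε₀ > 0, ∀ ε, 0 < ε → ε ≤ ε₀ →
      ∀ (Flat : Set Γ) (β : ℝ) (MAH MBH M₀ : Γ → ℝ),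
        c.ExitFates Eu Es F₁ κ ρ ε Flat →
        R.HorizonMassRelation β MAH →
        c.FinalMassRelation MAH MBH →
        ∃ η > 0, ∃ δ > 0,
          -- all data close to the limit cycle and off the stable manifold lie on one of its sides
          (∃ δ' > 0, ∀ U, c.distTo U < δ' → U ∉ c.stableManifold →
            ∃ s₀ b Uperp, b ≠ 0 ∧ c.DecomposedAt Eu Es F₁ δ s₀ b Uperp U) ∧
          -- they finally deviate from the limit cycle, and their fate is decided by the side
          (∀ s₀ b Uperp U, c.DecomposedAt Eu Es F₁ δ s₀ b Uperp U → b ≠ 0 →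
            U ∉ c.stableManifold ∧ c.FinallyDeviates η U ∧
            (b < 0 → R.TendsToFlat Flat U) ∧ (0 < b → R.FormsBlackHole U)) ∧
          -- they approach the limit cycle first, arbitrarily closely as `b → 0`
          (∀ ζ > 0, ∃ b₀ > 0, ∀ s₀ b Uperp U, c.DecomposedAt Eu Es F₁ δ s₀ b Uperp U →
            b ≠ 0 → |b| ≤ b₀ → ∃ s, R.Alive s U ∧ c.distTo (R.map s U) < ζ) ∧
          -- the scaling law for the black hole mass
          (∀ m M, 0 < m → ∃ C₁ > 0, ∃ C₂ > 0, ∀ s₀ b Uperp U,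
            c.DecomposedAt Eu Es F₁ δ s₀ b Uperp U → 0 < b → m ≤ M₀ U → M₀ U ≤ M →
              C₁ * |b| ^ (β / κ) ≤ MBH U / M₀ U ∧ MBH U / M₀ U ≤ C₂ * |b| ^ (β / κ)) := by
  obtain ⟨hκ, lam, pr, ℓ, co⟩ := LimitCycle.exists_coordinates hsplit hrel
  obtain ⟨δ₀, f', K, H⟩ := hsmooth.exists_data
  obtain ⟨P, p, r, C, θ, α, C', hP, hθ, hloc⟩ := H.exists_localPoincare co
  obtain ⟨η₁, hη₁, hflat⟩ := H.exists_finallyDeviates_of_flat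
  have hr := hloc.pos
  have hC := hloc.C_nonneg
  -- Any threshold for ρ works. What matters is that ε is small against ρ, so that the backward
  -- orbits constructed in the chart meet the size and return-time requirements of the local
  -- unstable manifold.
  refine ⟨1, one_pos, fun ρ hρ _ => ⟨min r (min (ρ / 2) (ρ / (C + 1))), by positivity,
    fun ε hε hε₀ Flat β MAH MBH M₀ hfates hMA hMB => ?_⟩⟩
  have hεr : ε ≤ r := hε₀.trans (min_le_left _ _)
  have hερ : 2 * ε ≤ ρ := by
    have := hε₀.trans ((min_le_right _ _).trans (min_le_left _ _))
    linarith
  have hCρ : C * ε ≤ ρ := by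
    have := hε₀.trans ((min_le_right _ _).trans (min_le_right _ _))
    rw [le_div_iff₀ (by positivity)] at this
    linarith
  obtain ⟨δ₃, hδ₃, hminus, sLow, hsLow, sHigh, ξLow, hξLow, ξHigh, hplus⟩ := hfates
  obtain ⟨CA, hCA, hMA⟩ := hMA
  obtain ⟨CB, hCB, δB, hδB, hMB⟩ := hMB
  set η := min η₁ δ₀
  have hη : 0 < η := lt_min hη₁ H.pos
  -- Blow-up and convergence to a flat datum both imply final deviation, which excludes convergence
  -- to the cycle.
  have hfate : ∀ σ : ℝ, |σ| = 1 → ∀ U ∈ c.exitTube Eu Es F₁ κ ρ σ ε δ₃, U ∉ c.stableManifold := by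
    intro σ hσ U hU
    rcases eq_or_eq_neg_of_abs_eq hσ with rfl | rfl
    · obtain ⟨s, ξ, hs, -⟩ := hplus U hU
      exact (H.finallyDeviates_of_horizon hs).notMem H.pos
    · exact (hflat Flat U (hminus U hU)).notMem hη₁
  obtain ⟨δ, hδ, hδB', hdecomp, hnear, ⟨B, hexit⟩, happroach⟩ :=
    LimitCycle.exists_decomposition H co hκ hloc hP hθ hε hεr hερ hCρ hδ₃ hfate
      -- Decomposed data are within 2δ of the cycle, so δ ≤ δB/3 puts them in the range of the final
      -- mass relation.
      (show 0 < δB / 3 by positivity)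
  have hneg : ∀ s₀ b Uperp U, c.DecomposedAt Eu Es F₁ δ s₀ b Uperp U → b < 0 →
      R.TendsToFlat Flat U := by
    intro s₀ b Uperp U hdec hb
    obtain ⟨T, hT, hmem, -⟩ := hexit _ _ _ _ hdec hb.ne (-1) (by simp) (by rw [abs_of_neg hb]; ring)
    exact (hminus _ hmem).of_map hT
  have hpos : ∀ s₀ b Uperp U, c.DecomposedAt Eu Es F₁ δ s₀ b Uperp U → 0 < b →
      ∃ T s ξ, R.HorizonAt U (T + s) ξ ∧ sLow ≤ s ∧ s ≤ sHigh ∧ ξLow ≤ (ξ : ℝ) ∧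
        (ξ : ℝ) ≤ ξHigh ∧ |Real.log |b| + κ * T| ≤ B := by
    intro s₀ b Uperp U hdec hb
    obtain ⟨T, hT, hmem, hlog⟩ := hexit _ _ _ _ hdec hb.ne' 1 (by simp)
      (by rw [abs_of_pos hb, one_mul])
    obtain ⟨s, ξ, hs, h1, h2, h3, h4⟩ := hplus _ hmem
    exact ⟨T, s, ξ, hs.of_map hT, h1, h2, h3, h4, hlog⟩
  refine ⟨η, hη, δ, hδ, hdecomp, fun s₀ b Uperp U hdec hb => ?_, happroach, fun m M hm => ?_⟩
  · have hdev : c.FinallyDeviates η U := by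
      rcases lt_or_gt_of_ne hb with hb | hb
      · exact (hflat Flat U (hneg _ _ _ _ hdec hb)).mono (min_le_left _ _)
      · obtain ⟨T, s, ξ, hs, -⟩ := hpos _ _ _ _ hdec hb
        exact (H.finallyDeviates_of_horizon hs).mono (min_le_right _ _)
    refine ⟨hdev.notMem hη, hdev, hneg _ _ _ _ hdec, fun hb => ?_⟩
    obtain ⟨T, s, ξ, hs, -⟩ := hpos _ _ _ _ hdec hb
    exact ⟨_, _, hs⟩
  · set Y := |β| * sHigh + |β / κ| * B
    -- The signs of `M` and `ξHigh` are not prescribed; |M| + 1 and |ξHigh| + 1 keep both constants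
    -- positive.
    refine ⟨CB⁻¹ * (CA⁻¹ * (ξLow * Real.exp (-Y))) / (|M| + 1), by positivity,
      CB * (CA * ((|ξHigh| + 1) * Real.exp Y)) / m, by positivity,
      fun s₀ b Uperp U hdec hb hmU hUM => ?_⟩
    obtain ⟨T, s, ξ, hs, h1, h2, h3, h4, hlog⟩ := hpos _ _ _ _ hdec hb
    have hb' : 0 < |b| := abs_pos.2 hb.ne'
    have hU0 : 0 < M₀ U := hm.trans_le hmU
    obtain ⟨r1, r2⟩ := LimitCycle.radius_bounds (β := β) hκ hb' (hsLow.trans_le h1) h2 hlog ξ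
    obtain ⟨a1, a2⟩ := hMA U _ _ hs
    obtain ⟨b1, b2⟩ := hMB U
      ((hnear _ _ _ _ hdec).trans_lt (by linarith)) ⟨_, _, hs⟩
    have hpow : 0 < |b| ^ (β / κ) := by positivity
    have hUM' : M₀ U ≤ |M| + 1 := by linarith [le_abs_self M]
    constructor
    · have e1 : CB⁻¹ * (CA⁻¹ * (ξLow * Real.exp (-Y) * |b| ^ (β / κ))) ≤ MBH U := by
        refine le_trans ?_ b1
        gcongr
        refine le_trans ?_ a1
        gcongr
        refine le_trans ?_ r1
        gcongr
      have e0 : 0 ≤ CB⁻¹ * (CA⁻¹ * (ξLow * Real.exp (-Y) * |b| ^ (β / κ))) := by positivity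
      calc _ = CB⁻¹ * (CA⁻¹ * (ξLow * Real.exp (-Y) * |b| ^ (β / κ))) / (|M| + 1) := by ring
        _ ≤ MBH U / M₀ U := div_le_div₀ (e0.trans e1) e1 hU0 hUM'
    · have e1 : MBH U ≤ CB * (CA * ((|ξHigh| + 1) * Real.exp Y * |b| ^ (β / κ))) := by
        refine b2.trans ?_
        gcongr
        refine a2.trans ?_
        gcongr
        refine r2.trans ?_
        gcongr
        linarith [le_abs_self ξHigh]
      have e0 : 0 ≤ CB * (CA * ((|ξHigh| + 1) * Real.exp Y * |b| ^ (β / κ))) := by positivity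
      calc MBH U / M₀ U ≤ CB * (CA * ((|ξHigh| + 1) * Real.exp Y * |b| ^ (β / κ))) / m :=
            div_le_div₀ e0 e1 hm hmU
        _ = _ := by ring
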